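/- **Setting.** There are $m$ machines and $n$ jobs that arrive online one at a time. Job $j$ can be scheduled on machine $i$ in at most $r$ ways; way $k$ incurs a load $p_{ijk}\in\mathbb{R}_{\ge 0}$ (with $p_{ijk}=\infty$ if this way does not exist). A partial allocation $x$ rejects each job or schedules it on one machine in one existing way ($x_{ijk}\in\{0,1\}$). Each machine $i$ has a monotone norm $\|\cdot\|_i$ on $\mathbb{R}^{nr}$, and $\Lambda_i(x)=\|(x_{ijk}p_{ijk})_{j,k}\|_i$. Given an aggregate function $f:\mathbb{R}_{\ge0}^m\to\mathbb{R}_{\ge0}$ and a budget $B\ge 0$ with $f(0)\le B$, the problem Sched-Pack$_{f,\{\|\cdot\|_i\}_i}$ is to maximize $\sum_{i,j,k}x_{ijk}$ subject to $f(\Lambda(x))\le B$; its offline optimum is $\mathrm{OPT}$. Norm-Pack$_{\|\cdot\|}$ is the case of a single machine with norm $\|\cdot\|$ and $f$ the identity. A randomized online algorithm knows $m,n,r,f$, the norms, $B$ and a number $M$ up front, and decides irrevocably on each job when its loads are revealed. For $\alpha\in[0,1]$ and $c\ge1$, the problem is *$(\alpha,c)$-solvable* if for all budgets $B$ and numbers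 $M$ there is such an algorithm that, on every job sequence, always incurs aggregate load at most $cB$, and schedules at least $\alpha M$ jobs in expectation whenever $M\le\mathrm{OPT}$. For $p\ge1$, a monotone, differentiable, convex function $f:\mathbb{R}_{\ge0}^m\to\mathbb{R}_{\ge0}$ is *$p$-bounded* if $\nabla f$ is coordinatewise monotone increasing ($x\le y$ implies $\nabla f(x)\le\nabla f(y)$) and $\langle\nabla f(y),y\rangle\le p\,f(y)$ for all $y\in\mathbb{R}_{\ge0}^m$. **Theorem.** There is an absolute constant $C>0$ such that the following holds for all $m\ge2$, all $n,r$, all $p\ge1$, $\alpha\in[0,1]$, $c\ge1$, all $f$ and all monotone norms $\|\cdot\|_1,\dots,\|\cdot\|_m$ on $\mathbb{R}^{nr}$. If $f$ is $p$-bounded and Norm-Pack$_{\|\cdot\|_i}$ is $(\alpha,c)$-solvable for every $i\in[m]$, then Sched-Pack$_{f,\{\|\cdot\|_i\}_i}$ is $\left(\frac{C\alpha}{\log^2 m},\,(3pc)^p\right)$-solvable. -/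

import Mathlib

open scoped ENNReal

noncomputable section

namespace OnlineSched

/-- A job: `p i k` is the load of the job when it is scheduled on machine `i` in way `k`.
A job has at most `r` ways on each machine; the value `∞` marks a way that does not exist. -/
abbrev Job (m r : ℕ) : Type := Fin m → Fin r → ℝ≥0∞

/-- The sequence of the `n` jobs, in the order of arrival. -/
abbrev JobSeq (m n r : ℕ) : Type := Fin n → Job m r

/-- A partial allocation (integral): each job is rejected (`none`) or is scheduled on one machine
in one way; `x j = some (i, k)` means `x_{ijk} = 1`. -/
abbrev PartialAlloc (m n r : ℕ) : Type := Fin n → Option (Fin m × Fin r)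

/-- A norm on `ℝ^{nr}` is given as a seminorm that is definite; monotonicity is only asked for on
nonnegative vectors. -/
structure IsMonotoneNorm {n r : ℕ} (N : Seminorm ℝ (Fin n × Fin r → ℝ)) : Prop where
  definite : ∀ x, N x = 0 → x = 0
  monotone : ∀ x y, 0 ≤ x → x ≤ y → N x ≤ N y

/-- The number of scheduled jobs, `∑ x_{ijk}`. -/
def numScheduled {m n r : ℕ} (x : PartialAlloc m n r) : ℕ :=
  (Finset.univ.filter fun j => (x j).isSome = true).card

/-- Only existing ways are used. -/
def Admissible {m n r : ℕ} (I : JobSeq m n r) (x : PartialAlloc m n r) : Prop :=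
  ∀ j i k, x j = some (i, k) → I j i k ≠ ∞

/-- The load vector `Λ(x)`, with `Λ_i(x) = ‖(x_{ijk} p_{ijk})_{j,k}‖_i`. -/
def loads {m n r : ℕ} (N : Fin m → Seminorm ℝ (Fin n × Fin r → ℝ)) (I : JobSeq m n r)
    (x : PartialAlloc m n r) : Fin m → ℝ :=
  fun i => N i fun jk => if x jk.1 = some (i, jk.2) then (I jk.1 i jk.2).toReal else 0

open Classical in
/-- The offline optimum of Schedule-Packing: the largest number of jobs in a partial allocation
whose aggregate load `f(Λ(x))` is at most the budget `B`. -/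
def opt {m n r : ℕ} (f : (Fin m → ℝ) → ℝ) (N : Fin m → Seminorm ℝ (Fin n × Fin r → ℝ)) (B : ℝ)
    (I : JobSeq m n r) : ℕ :=
  (Finset.univ.filter fun x : PartialAlloc m n r => Admissible I x ∧ f (loads N I x) ≤ B).sup
    numScheduled

/-- A randomized online algorithm for sequences of `n` jobs: a random seed `ω` is drawn once, and
the decision on job `j` is a function of the seed and of the jobs that arrived up to and
including `j`. -/
structure OnlineAlg (m n r : ℕ) where
  Ω : Type
  mΩ : MeasurableSpace Ω
  μ : MeasureTheory.Measure Ω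
  prob : MeasureTheory.IsProbabilityMeasure μ
  run : Ω → JobSeq m n r → PartialAlloc m n r
  online : ∀ ω I I' j, (∀ l, l ≤ j → I l = I' l) → run ω I j = run ω I' j
  meas : ∀ I j d, MeasurableSet {ω | run ω I j = d}

/-- The expected number of jobs that the algorithm schedules on the job sequence `I`. -/
def OnlineAlg.expectedValue {m n r : ℕ} (A : OnlineAlg m n r) (I : JobSeq m n r) : ℝ :=
  letI := A.mΩ
  ∫ ω, (numScheduled (A.run ω I) : ℝ) ∂A.μ

/-- `(α, c)`-solvability of online Schedule-Packing with aggregate function `f` and machine norms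
`N i`. The aggregate function, the norms, the budget `B` and a number `M` are known up front, the
loads are revealed online. The load is at most `c * B` on every job sequence and for
every outcome of the randomness; if `M` is a lower bound on the optimum, then the expected value
is at least `α * M`. The budgets are those for which the empty allocation is feasible. -/
def SchedPackSolvable {m n r : ℕ} (f : (Fin m → ℝ) → ℝ)
    (N : Fin m → Seminorm ℝ (Fin n × Fin r → ℝ)) (α c : ℝ) : Prop :=
  0 ≤ α ∧ α ≤ 1 ∧ 1 ≤ c ∧
  ∀ B : ℝ, 0 ≤ B → f 0 ≤ B → ∀ M : ℝ, ∃ A : OnlineAlg m n r, ∀ I : JobSeq m n r,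
    (∀ ω, Admissible I (A.run ω I) ∧ f (loads N I (A.run ω I)) ≤ c * B) ∧
    (M ≤ (opt f N B I : ℝ) → α * M ≤ A.expectedValue I)

/-- Norm-Packing: Schedule-Packing on one machine, the aggregate function being the identity. -/
def NormPackSolvable {n r : ℕ} (N : Seminorm ℝ (Fin n × Fin r → ℝ)) (α c : ℝ) : Prop :=
  SchedPackSolvable (m := 1) (fun z => z 0) (fun _ => N) α c

/-- The nonnegative orthant `ℝ_{≥0}^m`. -/
def orthant (m : ℕ) : Set (Fin m → ℝ) := {y | 0 ≤ y}

/-- The `i`-th partial derivative on the orthant (one-sided at boundary points). -/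
def partialDeriv {m : ℕ} (f : (Fin m → ℝ) → ℝ) (i : Fin m) (y : Fin m → ℝ) : ℝ :=
  fderivWithin ℝ f (orthant m) y (Pi.single i 1)

/-- `p`-bounded functions `f : ℝ_{≥0}^m → ℝ_{≥0}` (the values of `f` outside the orthant play no
role). The last clause is `⟨∇f(y), y⟩ / f(y) ≤ p`, written so that it makes sense if `f y = 0`. -/
structure PBounded {m : ℕ} (p : ℝ) (f : (Fin m → ℝ) → ℝ) : Prop where
  one_le : 1 ≤ p
  nonneg : ∀ y ∈ orthant m, 0 ≤ f y
  monotone : MonotoneOn f (orthant m)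
  convex : ConvexOn ℝ (orthant m) f
  differentiable : DifferentiableOn ℝ f (orthant m)
  gradient_monotone : ∀ i, MonotoneOn (partialDeriv f i) (orthant m)
  bounded : ∀ y ∈ orthant m, ∑ i, partialDeriv f i y * y i ≤ p * f y

end OnlineSched

end

noncomputable section
namespace OnlineSched

/-! ### Analysis of `p`-bounded functions -/

variable {m : ℕ} {p : ℝ} {f : (Fin m → ℝ) → ℝ}

/-! The algorithm rounds a deterministic fractional process that simulates the Norm-Packing
algorithms. Let `K` be `log₂ m` rounded up, `θ = 3p/2` and `D = (θ+1)^p * B`. Every machine `i` is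
split into atoms `(i, κ, k)`. Size class `κ` guesses that the optimum puts about `M / 2^κ` jobs on
`i`; level `k` has probability proportional to `2^k`, so that level `0` is cheap even when summed
over all machines and the top level has probability `1 / (144 (K+3))`. A started atom runs
Norm-Packing on its machine with a fixed budget until the packing optimum of the jobs offered to it
reaches a target of about `M / (2^(κ+2) (K+1))`. Level `k+1` may start only once level `k` is
completed. A job is offered until its mass, the expected number of atoms that accept it, reaches
`1/24`.

Prices. Let `Φ` be the expectation of `f` at the vector of opened budgets when each machine
independently draws at most one of its atoms. Starting an atom raises `Φ` by its probability times a
price (`expLoad_update`). Monotone gradients make increments grow with the base point, so prices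
only rise, and the prices of the optimal loads `b` add up to at most the expectation of `f (y + b)`,
where `y` is the random vector of budgets. The bound on the inner product of gradient and argument
gives `f (t • y) ≤ t^p * f y`; with convexity, the expectation of `f (y + b)` is at most `D` as long
as `Φ ≤ θ^p * B` (`sum_price_le`). Hence machines priced above `4D / 2^κ` carry at most `M/4` jobs
of the optimum.

Value. If the bound on `Φ` ever blocks a start, then atoms of positive level have cost at least
`D/12`, and each is charged to the completed atom one level below, which has half its probability
(`mass_of_blocked`). Otherwise either many jobs are saturated, or machines carrying `3/8` of the
optimum complete every level of their class (`completed_of_affordable`), and their top atoms supply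
the mass (`fractional_value`). The two logarithms come from the classes sharing one seed and the
levels sharing the target.

Rounding. Seeds and simulated algorithms are independent across machines. A job is rejected if `f`
of the opened budgets exceeds `(3p)^p * B`. Conditionally on the seed of one machine this has
probability at most `5/6` by Markov, and Bonferroni controls collisions, so a job is scheduled with
probability at least a twelfth of its mass (`mass_le_acceptProb`). The loads are at most `c` times
the opened budgets, which costs a factor `c^p` (`load_roundRun_le`).

Machines whose axis never drives `f` above `B` have no influence on `f` (`PBounded.le_of_le_off`);
they receive jobs for free and are split off in the final theorem. -/

theorem single_mem_orthant {i : Fin m} {t : ℝ} (ht : 0 ≤ t) :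
    (Pi.single i t : Fin m → ℝ) ∈ orthant m :=
  Pi.single_nonneg.2 ht

theorem add_mem_orthant {a b : Fin m → ℝ} (ha : a ∈ orthant m) (hb : b ∈ orthant m) :
    a + b ∈ orthant m :=
  add_nonneg (show (0 : Fin m → ℝ) ≤ a from ha) hb

theorem zero_mem_orthant : (0 : Fin m → ℝ) ∈ orthant m :=
  le_refl (0 : Fin m → ℝ)

theorem smul_mem_orthant {a : Fin m → ℝ} {t : ℝ} (ht : 0 ≤ t) (ha : a ∈ orthant m) :
    t • a ∈ orthant m :=
  smul_nonneg ht (show (0 : Fin m → ℝ) ≤ a from ha)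

theorem PBounded.hasDerivWithinAt_line (hf : PBounded p f) {a v : Fin m → ℝ}
    (ha : a ∈ orthant m) (hv : v ∈ orthant m) {t : ℝ} (ht : 0 ≤ t) :
    HasDerivWithinAt (fun t : ℝ => f (a + t • v))
      (fderivWithin ℝ f (orthant m) (a + t • v) v) (Set.Ici 0) t := by
  have h1 : HasFDerivWithinAt f (fderivWithin ℝ f (orthant m) (a + t • v)) (orthant m)
      (a + t • v) :=
    (hf.differentiable _ (add_mem_orthant ha (smul_mem_orthant ht hv))).hasFDerivWithinAt
  have h2 : HasDerivWithinAt (fun t : ℝ => a + t • v) v (Set.Ici 0) t := by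
    simpa using ((hasDerivWithinAt_id t (Set.Ici (0 : ℝ))).smul_const v).const_add a
  exact h1.comp_hasDerivWithinAt t h2
    (fun x hx => add_mem_orthant ha (smul_mem_orthant hx hv))

theorem PBounded.hasDerivAt_line (hf : PBounded p f) {a v : Fin m → ℝ}
    (ha : a ∈ orthant m) (hv : v ∈ orthant m) {t : ℝ} (ht : 0 < t) :
    HasDerivAt (fun t : ℝ => f (a + t • v))
      (fderivWithin ℝ f (orthant m) (a + t • v) v) t :=
  (hf.hasDerivWithinAt_line ha hv ht.le).hasDerivAt (Ici_mem_nhds ht)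

theorem PBounded.continuousOn_line (hf : PBounded p f) {a v : Fin m → ℝ}
    (ha : a ∈ orthant m) (hv : v ∈ orthant m) :
    ContinuousOn (fun t : ℝ => f (a + t • v)) (Set.Ici 0) :=
  fun _ ht => (hf.hasDerivWithinAt_line ha hv ht).continuousWithinAt

/-- Increments along a coordinate are monotone in the base point. -/
theorem PBounded.increment_mono (hf : PBounded p f) {a b : Fin m → ℝ} (ha : a ∈ orthant m)
    (hab : a ≤ b) (i : Fin m) {t : ℝ} (ht : 0 ≤ t) :
    f (a + Pi.single i t) - f a ≤ f (b + Pi.single i t) - f b := by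
  have hb : b ∈ orthant m := le_trans (show (0 : Fin m → ℝ) ≤ a from ha) hab
  have hv : (Pi.single i 1 : Fin m → ℝ) ∈ orthant m := single_mem_orthant zero_le_one
  have hmono : MonotoneOn (fun t : ℝ => f (b + t • (Pi.single i 1 : Fin m → ℝ))
      - f (a + t • (Pi.single i 1 : Fin m → ℝ))) (Set.Ici 0) := by
    refine monotoneOn_of_hasDerivWithinAt_nonneg (f' := fun t =>
      fderivWithin ℝ f (orthant m) (b + t • (Pi.single i 1 : Fin m → ℝ)) (Pi.single i 1) -
      fderivWithin ℝ f (orthant m) (a + t • (Pi.single i 1 : Fin m → ℝ)) (Pi.single i 1))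
      (convex_Ici 0) ((hf.continuousOn_line hb hv).sub (hf.continuousOn_line ha hv)) ?_ ?_
    · intro x hx
      rw [interior_Ici] at hx
      exact ((hf.hasDerivAt_line hb hv hx).sub (hf.hasDerivAt_line ha hv hx)).hasDerivWithinAt
    · intro x hx
      rw [interior_Ici] at hx
      have hx0 : 0 ≤ x := le_of_lt hx
      have := hf.gradient_monotone i (add_mem_orthant ha (smul_mem_orthant hx0 hv))
        (add_mem_orthant hb (smul_mem_orthant hx0 hv)) (add_le_add_left hab _)
      simpa [partialDeriv] using this
  have h := hmono (Set.self_mem_Ici) (Set.mem_Ici.2 ht) ht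
  simp only [zero_smul, add_zero, ← Pi.single_smul, smul_eq_mul, mul_one] at h
  linarith

/-- Add the coordinates of `s` to `y` one at a time: each increment has a base point above `z i`, so
it dominates the one at `z i`, and the sum telescopes. The base points may differ from one
coordinate to the next, as needed when each machine is priced with its own coordinate emptied. -/
theorem PBounded.sum_increment_le (hf : PBounded p f) {y s : Fin m → ℝ}
    (hs : s ∈ orthant m) (z : Fin m → Fin m → ℝ) (hz : ∀ i, z i ∈ orthant m)
    (hzy : ∀ i, z i ≤ y) :
    ∑ i, (f (z i + Pi.single i (s i)) - f (z i)) ≤ f (y + s) - f y := by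
  have key : ∀ A : Finset (Fin m), ∑ i ∈ A, (f (z i + Pi.single i (s i)) - f (z i)) ≤
      f (y + ∑ i ∈ A, Pi.single i (s i)) - f y := by
    intro A
    induction A using Finset.induction_on with
    | empty => simp
    | insert i A hi ih =>
      rw [Finset.sum_insert hi, Finset.sum_insert hi]
      have h0 : (0 : Fin m → ℝ) ≤ ∑ i ∈ A, Pi.single i (s i) :=
        Finset.sum_nonneg fun l _ => Pi.single_nonneg.2 (hs l)
      have := hf.increment_mono (hz i)
        ((hzy i).trans (le_add_of_nonneg_right h0)) i (hs i)
      rw [add_comm (Pi.single i (s i) : Fin m → ℝ), ← add_assoc]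
      linarith
  simpa [Finset.univ_sum_single] using key Finset.univ

theorem PBounded.fderiv_self_le (hf : PBounded p f) {y : Fin m → ℝ} (hy : y ∈ orthant m) :
    fderivWithin ℝ f (orthant m) y y ≤ p * f y := by
  have h := hf.bounded y hy
  have : fderivWithin ℝ f (orthant m) y y = ∑ i, partialDeriv f i y * y i := by
    conv_lhs => rw [← Finset.univ_sum_single y, map_sum]
    refine Finset.sum_congr rfl fun i _ => ?_
    rw [Finset.univ_sum_single, partialDeriv]
    have : (Pi.single i (y i) : Fin m → ℝ) = y i • Pi.single i 1 := by
      rw [← Pi.single_smul]; simp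
    rw [this, map_smul, smul_eq_mul, mul_comm]
  rw [this]; exact h

/-- A `p`-bounded function grows at most like the `p`-th power. -/
theorem PBounded.smul_le (hf : PBounded p f) {y : Fin m → ℝ} (hy : y ∈ orthant m) {t : ℝ}
    (ht : 1 ≤ t) : f (t • y) ≤ t ^ p * f y := by
  -- The sign of the derivative of `t^(-p) * f (t • y)` is the inequality `fderiv_self_le` at the
  -- point `t • y`.
  have hanti : AntitoneOn (fun t : ℝ => t ^ (-p) * f (0 + t • y)) (Set.Ici 1) := by
    refine antitoneOn_of_hasDerivWithinAt_nonpos (f' := fun t =>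
      (-p * t ^ (-p - 1)) * f (0 + t • y) +
        t ^ (-p) * fderivWithin ℝ f (orthant m) (0 + t • y) y) (convex_Ici 1) ?_ ?_ ?_
    · refine ContinuousOn.mul ?_ ((hf.continuousOn_line zero_mem_orthant hy).mono
        (Set.Ici_subset_Ici.2 zero_le_one))
      exact fun x hx => (Real.continuousAt_rpow_const x (-p)
        (Or.inl (by linarith [Set.mem_Ici.1 hx]))).continuousWithinAt
    · intro x hx
      rw [interior_Ici] at hx
      have hx0 : 0 < x := lt_trans zero_lt_one hx
      exact ((Real.hasDerivAt_rpow_const (p := -p) (Or.inl hx0.ne')).mul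
        (hf.hasDerivAt_line zero_mem_orthant hy hx0)).hasDerivWithinAt
    · intro x hx
      rw [interior_Ici] at hx
      have hx0 : 0 < x := lt_trans zero_lt_one hx
      have h := hf.fderiv_self_le (smul_mem_orthant hx0.le hy)
      rw [map_smul, smul_eq_mul] at h
      simp only [zero_add]
      have e : x ^ (-p) = x ^ (-p - 1) * x := by
        rw [Real.rpow_sub_one hx0.ne']; field_simp
      rw [e]
      have h3 : 0 ≤ x ^ (-p - 1) := Real.rpow_nonneg hx0.le _
      nlinarith [mul_le_mul_of_nonneg_left h h3]
  have h := hanti (Set.self_mem_Ici) (Set.mem_Ici.2 ht) ht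
  simp only [zero_add, Real.one_rpow, one_mul, one_smul] at h
  have t0 : 0 < t := by linarith
  rw [Real.rpow_neg t0.le, inv_mul_le_iff₀ (Real.rpow_pos_of_pos t0 p)] at h
  exact h

/-- The sum `a + b` is the convex combination of `((θ+1)/θ) • a` and `(θ+1) • b` with weights
`θ/(θ+1)` and `1/(θ+1)`; `smul_le` bounds both ends. With `f a ≤ θ^p * B` and `f b ≤ B` the outcome
is `(θ+1)^p * B`, as if the `p`-th root of `f` were subadditive. -/
theorem PBounded.add_le (hf : PBounded p f) {a b : Fin m → ℝ} (ha : a ∈ orthant m)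
    (hb : b ∈ orthant m) {θ : ℝ} (hθ : 0 < θ) :
    f (a + b) ≤ ((θ + 1) / θ) ^ (p - 1) * f a + (θ + 1) ^ (p - 1) * f b := by
  have h1 : 0 < θ + 1 := by linarith
  have hc := hf.convex.2 (smul_mem_orthant (t := (θ + 1) / θ) (by positivity) ha)
    (smul_mem_orthant h1.le hb) (show 0 ≤ θ / (θ + 1) by positivity)
    (show 0 ≤ 1 / (θ + 1) by positivity) (by field_simp)
  rw [smul_smul, smul_smul] at hc
  have e1 : θ / (θ + 1) * ((θ + 1) / θ) = 1 := by field_simp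
  have e2 : 1 / (θ + 1) * (θ + 1) = 1 := by field_simp
  rw [e1, e2, one_smul, one_smul, smul_eq_mul, smul_eq_mul] at hc
  have ha' := hf.smul_le ha (t := (θ + 1) / θ) (by rw [le_div_iff₀ hθ]; linarith)
  have hb' := hf.smul_le hb (t := θ + 1) (by linarith)
  have p1 : (0 : ℝ) < (θ + 1) / θ := by positivity
  rw [Real.rpow_sub_one p1.ne', Real.rpow_sub_one h1.ne']
  calc f (a + b) ≤ _ := hc
    _ ≤ θ / (θ + 1) * (((θ + 1) / θ) ^ p * f a) + 1 / (θ + 1) * ((θ + 1) ^ p * f b) := by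
      gcongr
    _ = _ := by field_simp

theorem add_le_constants {θ : ℝ} (hθ : 0 < θ) (p B : ℝ) :
    ((θ + 1) / θ) ^ (p - 1) * (θ ^ p * B) + (θ + 1) ^ (p - 1) * B = (θ + 1) ^ p * B := by
  have h1 : 0 < θ + 1 := by linarith
  rw [Real.div_rpow h1.le hθ.le, Real.rpow_sub_one hθ.ne', Real.rpow_sub_one h1.ne']
  have := Real.rpow_pos_of_pos hθ p
  field_simp

/-- If the `i`-th axis carries a bounded function then `f` does not depend on the `i`-th
coordinate. -/
theorem PBounded.add_single_le (hf : PBounded p f) {i : Fin m} {B : ℝ}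
    (hB : ∀ u, 0 ≤ u → f (Pi.single i u) ≤ B) {y : Fin m → ℝ} (hy : y ∈ orthant m) {t : ℝ}
    (ht : 0 ≤ t) : f (y + Pi.single i t) ≤ f y := by
  -- Write `y + t e_i` as `l (y/l) + (1-l) (t/(1-l)) e_i`. The second point stays on the axis, where
  -- `f` is at most `B`, so its contribution vanishes as `l` tends to `1`.
  have key : ∀ l : ℝ, l ∈ Set.Ioo (0 : ℝ) 1 →
      f (y + Pi.single i t) ≤ l * ((1 / l) ^ p * f y) + (1 - l) * B := by
    rintro l ⟨h0, h1⟩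
    have h2 : 0 < 1 - l := by linarith
    have hc := hf.convex.2 (smul_mem_orthant (t := 1 / l) (by positivity) hy)
      (single_mem_orthant (i := i) (t := t / (1 - l)) (by positivity)) h0.le h2.le (by ring)
    rw [smul_smul, ← Pi.single_smul, smul_eq_mul, mul_one_div_cancel h0.ne', one_smul,
      mul_div_cancel₀ _ h2.ne', smul_eq_mul, smul_eq_mul] at hc
    refine hc.trans (add_le_add ?_ ?_)
    · exact mul_le_mul_of_nonneg_left
        (hf.smul_le hy (by rw [le_div_iff₀ h0]; linarith)) h0.le
    · exact mul_le_mul_of_nonneg_left (hB _ (by positivity)) h2.le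
  have hlim : Filter.Tendsto (fun l : ℝ => l * ((1 / l) ^ p * f y) + (1 - l) * B)
      (nhdsWithin 1 (Set.Iio 1)) (nhds (1 * ((1 / 1) ^ p * f y) + (1 - 1) * B)) := by
    refine Filter.Tendsto.mono_left ?_ nhdsWithin_le_nhds
    have : ContinuousAt (fun l : ℝ => l * ((1 / l) ^ p * f y) + (1 - l) * B) 1 := by
      have h1 : ContinuousAt (fun l : ℝ => 1 / l) 1 :=
        continuousAt_const.div continuousAt_id one_ne_zero
      have h2 : ContinuousAt (fun l : ℝ => (1 / l) ^ p) 1 :=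
        h1.rpow_const (Or.inl (by norm_num))
      fun_prop
    exact this
  simp only [div_one, Real.one_rpow, one_mul, sub_self, zero_mul, add_zero] at hlim
  exact ge_of_tendsto hlim (Filter.eventually_of_mem (Ioo_mem_nhdsLT zero_lt_one) key)

/-- The vector `y` lies below `z` plus the axis vectors of the free coordinates, and these are
removed one by one with `add_single_le`. This lets free machines take arbitrary loads. -/
theorem PBounded.le_of_le_off (hf : PBounded p f) {B : ℝ} {y z : Fin m → ℝ}
    (hy : y ∈ orthant m) (hz : z ∈ orthant m)
    (h : ∀ i, y i ≤ z i ∨ ∀ u, 0 ≤ u → f (Pi.single i u) ≤ B) : f y ≤ f z := by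
  classical
  set S := Finset.univ.filter fun i => ∀ u, 0 ≤ u → f (Pi.single i u) ≤ B with hS
  have key : ∀ A ⊆ S, f (z + ∑ i ∈ A, Pi.single i (y i)) ≤ f z := by
    intro A
    induction A using Finset.induction_on with
    | empty => simp
    | insert i A hi ih =>
      intro hA
      rw [Finset.sum_insert hi, add_comm (Pi.single i (y i) : Fin m → ℝ), ← add_assoc]
      have h0 : (0 : Fin m → ℝ) ≤ ∑ i ∈ A, Pi.single i (y i) :=
        Finset.sum_nonneg fun l _ => Pi.single_nonneg.2 (hy l)
      refine (hf.add_single_le (B := B) ?_ (add_mem_orthant hz h0) (hy i)).trans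
        (ih ((Finset.subset_insert i A).trans hA))
      exact (Finset.mem_filter.1 (hA (Finset.mem_insert_self i A))).2
  have hnn : ∀ l, (0 : Fin m → ℝ) ≤ Pi.single l (y l) := fun l => Pi.single_nonneg.2 (hy l)
  refine (hf.monotone hy (add_mem_orthant hz (Finset.sum_nonneg fun l _ => hnn l)) ?_).trans
    (key S le_rfl)
  intro i
  rw [Pi.add_apply, Finset.sum_apply]
  have hzi : 0 ≤ z i := hz i
  by_cases hi : i ∈ S
  · have : (Pi.single i (y i) : Fin m → ℝ) i ≤ ∑ l ∈ S, (Pi.single l (y l) : Fin m → ℝ) i :=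
      Finset.single_le_sum (f := fun l => (Pi.single l (y l) : Fin m → ℝ) i)
        (fun l _ => hnn l i) hi
    rw [Pi.single_eq_same] at this
    linarith
  · have h1 : y i ≤ z i := (h i).resolve_right fun h' =>
      hi (Finset.mem_filter.2 ⟨Finset.mem_univ i, h'⟩)
    have : 0 ≤ ∑ l ∈ S, (Pi.single l (y l) : Fin m → ℝ) i :=
      Finset.sum_nonneg fun l _ => hnn l i
    linarith

/-! ### Expectation over independent finite seeds -/

section ProductExpectation

variable {ι T : Type*} [Fintype ι] [DecidableEq ι] [Fintype T]

/-- The expectation of `g` when the coordinates are independent with weights `q`. -/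
def prodExp (q : T → ℝ) (g : (ι → T) → ℝ) : ℝ :=
  ∑ σ, (∏ i, q (σ i)) * g σ

variable {q : T → ℝ}

theorem prodExp_mono (hq : ∀ t, 0 ≤ q t) {g h : (ι → T) → ℝ} (hgh : ∀ σ, g σ ≤ h σ) :
    prodExp q g ≤ prodExp q h :=
  Finset.sum_le_sum fun σ _ =>
    mul_le_mul_of_nonneg_left (hgh σ) (Finset.prod_nonneg fun _ _ => hq _)

theorem prodExp_nonneg (hq : ∀ t, 0 ≤ q t) {g : (ι → T) → ℝ} (hg : ∀ σ, 0 ≤ g σ) :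
    0 ≤ prodExp q g :=
  Finset.sum_nonneg fun σ _ => mul_nonneg (Finset.prod_nonneg fun _ _ => hq _) (hg σ)

theorem prodExp_add (g h : (ι → T) → ℝ) :
    prodExp q (fun σ => g σ + h σ) = prodExp q g + prodExp q h := by
  simp only [prodExp, mul_add, Finset.sum_add_distrib]

theorem prodExp_sub (g h : (ι → T) → ℝ) :
    prodExp q (fun σ => g σ - h σ) = prodExp q g - prodExp q h := by
  simp only [prodExp, mul_sub, Finset.sum_sub_distrib]

theorem prodExp_mul_left (c : ℝ) (g : (ι → T) → ℝ) :
    prodExp q (fun σ => c * g σ) = c * prodExp q g := by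
  simp only [prodExp, Finset.mul_sum]
  exact Finset.sum_congr rfl fun σ _ => by ring

theorem prodExp_sum {κ : Type*} (s : Finset κ) (g : κ → (ι → T) → ℝ) :
    prodExp q (fun σ => ∑ k ∈ s, g k σ) = ∑ k ∈ s, prodExp q (g k) := by
  simp only [prodExp, Finset.mul_sum]
  exact Finset.sum_comm

theorem prodExp_const (hq : ∑ t, q t = 1) (c : ℝ) :
    prodExp q (fun _ : ι → T => c) = c := by
  have h : ∏ _i : ι, ∑ t, q t = ∑ σ : ι → T, ∏ i, q (σ i) := by
    rw [Finset.prod_univ_sum, Fintype.piFinset_univ]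
  rw [prodExp, ← Finset.sum_mul, ← h]
  simp [hq]

/-- Resampling one coordinate does not change the expectation. -/
theorem prodExp_update (hq : ∑ t, q t = 1) (i : ι) (g : (ι → T) → ℝ) :
    prodExp q g = ∑ t, q t * prodExp q (fun σ => g (Function.update σ i t)) := by
  classical
  -- Exchanging a fresh sample with coordinate `i` is an involution that preserves the product
  -- weight.
  let e : T × (ι → T) ≃ T × (ι → T) :=
    { toFun := fun x => (x.2 i, Function.update x.2 i x.1)
      invFun := fun x => (x.2 i, Function.update x.2 i x.1)
      left_inv := fun x => by simp
      right_inv := fun x => by simp }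
  have hw : ∀ x : T × (ι → T),
      q (e x).1 * ∏ l, q ((e x).2 l) = q x.1 * ∏ l, q (x.2 l) := by
    rintro ⟨t, σ⟩
    simp only [e, Equiv.coe_fn_mk]
    rw [← Finset.mul_prod_erase Finset.univ (fun l => q (Function.update σ i t l))
      (Finset.mem_univ i), ← Finset.mul_prod_erase Finset.univ (fun l => q (σ l))
      (Finset.mem_univ i), Function.update_self]
    have : ∏ l ∈ Finset.univ.erase i, q (Function.update σ i t l) =
        ∏ l ∈ Finset.univ.erase i, q (σ l) :=
      Finset.prod_congr rfl fun l hl => by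
        rw [Function.update_of_ne (Finset.ne_of_mem_erase hl)]
    rw [this]; ring
  calc prodExp q g = ∑ x : T × (ι → T), (q x.1 * ∏ l, q (x.2 l)) * g x.2 := by
        rw [Fintype.sum_prod_type]
        simp only [mul_assoc, ← Finset.mul_sum]
        rw [← Finset.sum_mul, hq, one_mul, prodExp]
    _ = ∑ x : T × (ι → T), (q (e x).1 * ∏ l, q ((e x).2 l)) * g (e x).2 :=
        (Equiv.sum_comp e (fun x => (q x.1 * ∏ l, q (x.2 l)) * g x.2)).symm
    _ = _ := by
        simp only [hw]
        rw [Fintype.sum_prod_type]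
        simp only [e, Equiv.coe_fn_mk, mul_assoc, ← Finset.mul_sum, prodExp]

theorem prodExp_coord (hq : ∑ t, q t = 1) (i : ι) (a : T → ℝ) :
    prodExp q (fun σ : ι → T => a (σ i)) = ∑ t, q t * a t := by
  rw [prodExp_update hq i]
  simp [prodExp_const hq]

theorem prodExp_coord_mul (hq : ∑ t, q t = 1) {i l : ι} (hil : i ≠ l) (a b : T → ℝ) :
    prodExp q (fun σ : ι → T => a (σ i) * b (σ l)) =
      (∑ t, q t * a t) * ∑ t, q t * b t := by
  rw [prodExp_update hq i]
  simp only [Function.update_self, Function.update_of_ne hil.symm, prodExp_mul_left,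
    prodExp_coord hq, Finset.sum_mul, mul_assoc]

end ProductExpectation

/-! ### Random load vectors -/

section RandomLoad

variable {m : ℕ} {S : Type*} {p : ℝ} {f : (Fin m → ℝ) → ℝ} {q : Option S → ℝ}

/-- The load vector when machine `i` is opened with budget `bud (i, s)` if its seed is `s`. -/
def seedLoad (bud : Fin m × S → ℝ) (σ : Fin m → Option S) : Fin m → ℝ :=
  fun i => (σ i).elim 0 fun s => bud (i, s)

theorem seedLoad_mem {bud : Fin m × S → ℝ} (hb : 0 ≤ bud) (σ : Fin m → Option S) :
    seedLoad bud σ ∈ orthant m := by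
  intro i
  rcases h : σ i with _ | s
  · simp [seedLoad, h]
  · simpa [seedLoad, h] using hb (i, s)

theorem seedLoad_mono {bud bud' : Fin m × S → ℝ} (h : bud ≤ bud') (σ : Fin m → Option S) :
    seedLoad bud σ ≤ seedLoad bud' σ := by
  intro i
  rcases hs : σ i with _ | s
  · simp [seedLoad, hs]
  · simpa [seedLoad, hs] using h (i, s)

theorem seedLoad_update (bud : Fin m × S → ℝ) (σ : Fin m → Option S) (i : Fin m)
    (t : Option S) :
    seedLoad bud (Function.update σ i t) =
      Function.update (seedLoad bud σ) i (t.elim 0 fun s => bud (i, s)) := by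
  ext l
  by_cases h : l = i
  · subst h; simp [seedLoad]
  · simp [seedLoad, Function.update_of_ne h]

theorem update_mem_orthant {y : Fin m → ℝ} (hy : y ∈ orthant m) (i : Fin m) {u : ℝ}
    (hu : 0 ≤ u) : Function.update y i u ∈ orthant m := by
  intro l
  by_cases h : l = i
  · subst h; simpa using hu
  · simpa [Function.update_of_ne h] using hy l

theorem update_eq_add_single (y : Fin m → ℝ) (i : Fin m) (u : ℝ) :
    Function.update y i u = Function.update y i 0 + Pi.single i u := by
  ext l
  by_cases h : l = i
  · subst h; simp
  · simp [Function.update_of_ne h, Pi.single_eq_of_ne h]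

theorem update_zero_le {y : Fin m → ℝ} (hy : y ∈ orthant m) (i : Fin m) :
    Function.update y i 0 ≤ y := by
  intro l
  by_cases h : l = i
  · subst h; simpa using hy l
  · simp [Function.update_of_ne h]

variable [Fintype S]

/-- The expected aggregate load. -/
def expLoad (q : Option S → ℝ) (f : (Fin m → ℝ) → ℝ) (bud : Fin m × S → ℝ) : ℝ :=
  prodExp q fun σ => f (seedLoad bud σ)

/-- The expected cost of opening machine `i` with budget `u`. -/
def price (q : Option S → ℝ) (f : (Fin m → ℝ) → ℝ) (bud : Fin m × S → ℝ) (i : Fin m)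
    (u : ℝ) : ℝ :=
  prodExp q fun σ => f (Function.update (seedLoad bud σ) i u) -
    f (Function.update (seedLoad bud σ) i 0)

theorem expLoad_zero (hq1 : ∑ t, q t = 1) : expLoad q f (0 : Fin m × S → ℝ) = f 0 := by
  have : ∀ σ : Fin m → Option S, seedLoad (0 : Fin m × S → ℝ) σ = 0 := fun σ => by
    ext i
    rcases h : σ i with _ | s <;> simp [seedLoad, h]
  simp only [expLoad, this, prodExp_const hq1]

theorem expLoad_mono (hf : PBounded p f) (hq : ∀ t, 0 ≤ q t) {bud bud' : Fin m × S → ℝ}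
    (hb : 0 ≤ bud) (h : bud ≤ bud') : expLoad q f bud ≤ expLoad q f bud' :=
  prodExp_mono hq fun σ => hf.monotone (seedLoad_mem hb σ) (seedLoad_mem (hb.trans h) σ)
    (seedLoad_mono h σ)

/-- Opening an atom costs its probability times its price. -/
theorem expLoad_update [DecidableEq S] (hq1 : ∑ t, q t = 1) {bud : Fin m × S → ℝ}
    {i : Fin m} {s : S} (h0 : bud (i, s) = 0) (u : ℝ) :
    expLoad q f (Function.update bud (i, s) u) = expLoad q f bud + q (some s) * price q f bud i u
    := by
  rw [expLoad, expLoad, prodExp_update hq1 i, prodExp_update hq1 i (fun σ => f (seedLoad bud σ)),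
    ← sub_eq_iff_eq_add', ← Finset.sum_sub_distrib]
  -- After resampling the seed of machine `i`, only the outcome `some s` sees the changed entry.
  rw [Finset.sum_eq_single (some s)]
  · rw [← mul_sub, ← prodExp_sub, price]
    congr 2
    funext σ
    rw [seedLoad_update, seedLoad_update]
    congr 2
    · ext l
      by_cases h : l = i
      · subst h; simp
      · rw [Function.update_of_ne h, Function.update_of_ne h]
        rcases hl : σ l with _ | t
        · simp [seedLoad, hl]
        · simp [seedLoad, hl, h]
    · simp [h0]
  · intro t _ ht
    rw [← mul_sub, ← prodExp_sub]
    have : ∀ σ : Fin m → Option S, seedLoad (Function.update bud (i, s) u) (Function.update σ i t)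
        = seedLoad bud (Function.update σ i t) := by
      intro σ
      ext l
      by_cases h : l = i
      · subst h
        rcases t with _ | t
        · simp [seedLoad]
        · have : t ≠ s := fun h => ht (by rw [h])
          simp [seedLoad, this]
      · rcases hl : σ l with _ | t
        · simp [seedLoad, hl, Function.update_of_ne h]
        · simp [seedLoad, hl, h]
    simp [this, prodExp]
  · simp

theorem price_zero (bud : Fin m × S → ℝ) (i : Fin m) : price q f bud i 0 = 0 := by
  simp [price, prodExp]

/-- Pointwise in the seeds this is `increment_mono` at the load vectors with coordinate `i` emptied.
Since budgets only grow, prices only rise over time. -/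
theorem price_mono (hf : PBounded p f) (hq : ∀ t, 0 ≤ q t) {bud bud' : Fin m × S → ℝ}
    (hb : 0 ≤ bud) (h : bud ≤ bud') (i : Fin m) {u : ℝ} (hu : 0 ≤ u) :
    price q f bud i u ≤ price q f bud' i u := by
  refine prodExp_mono hq fun σ => ?_
  rw [update_eq_add_single _ i u, update_eq_add_single (seedLoad bud' σ) i u]
  exact hf.increment_mono (update_mem_orthant (seedLoad_mem hb σ) i le_rfl)
    (update_le_update_iff.2 ⟨le_rfl, fun l _ => seedLoad_mono h σ l⟩) i hu

theorem expLoad_bound (hf : PBounded p f) (hq : ∀ t, 0 ≤ q t) (hq1 : ∑ t, q t = 1)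
    {bud : Fin m × S → ℝ} (hb : 0 ≤ bud) {θ B : ℝ} (hθ : 0 < θ)
    (hΦ : expLoad q f bud ≤ θ ^ p * B) {b : Fin m → ℝ} (hbo : b ∈ orthant m) (hfb : f b ≤ B) :
    prodExp q (fun σ => f (seedLoad bud σ + b)) ≤ (θ + 1) ^ p * B := by
  rw [← add_le_constants hθ]
  have h1 : 0 ≤ ((θ + 1) / θ) ^ (p - 1) := Real.rpow_nonneg (by positivity) _
  have h2 : 0 ≤ (θ + 1) ^ (p - 1) := Real.rpow_nonneg (by positivity) _
  calc _ ≤ prodExp q (fun σ => ((θ + 1) / θ) ^ (p - 1) * f (seedLoad bud σ) +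
        (θ + 1) ^ (p - 1) * f b) := prodExp_mono hq fun σ => hf.add_le (seedLoad_mem hb σ) hbo hθ
    _ = ((θ + 1) / θ) ^ (p - 1) * expLoad q f bud + (θ + 1) ^ (p - 1) * f b := by
        rw [prodExp_add, prodExp_mul_left, prodExp_const hq1, expLoad]
    _ ≤ _ := by gcongr

/-- For each seed vector, with `y` the resulting load, `sum_increment_le` bounds the sum of the
increments at the emptied vectors by `f (y + b) - f y`, hence by `f (y + b)`, whose expectation is
controlled by `expLoad_bound`. -/
theorem sum_price_le (hf : PBounded p f) (hq : ∀ t, 0 ≤ q t) (hq1 : ∑ t, q t = 1)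
    {bud : Fin m × S → ℝ} (hb : 0 ≤ bud) {θ B : ℝ} (hθ : 0 < θ)
    (hΦ : expLoad q f bud ≤ θ ^ p * B) {b : Fin m → ℝ} (hbo : b ∈ orthant m) (hfb : f b ≤ B) :
    ∑ i, price q f bud i (b i) ≤ (θ + 1) ^ p * B := by
  refine le_trans ?_ (expLoad_bound hf hq hq1 hb hθ hΦ hbo hfb)
  simp only [price]
  rw [← prodExp_sum]
  refine prodExp_mono hq fun σ => ?_
  have hy := seedLoad_mem hb σ
  have := hf.sum_increment_le hbo (fun i => Function.update (seedLoad bud σ) i 0)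
    (fun i => update_mem_orthant hy i le_rfl) (fun i => update_zero_le hy i)
  simp only [← update_eq_add_single] at this
  linarith [hf.nonneg _ hy]

theorem expLoad_update_bound (hf : PBounded p f) (hq : ∀ t, 0 ≤ q t) (hq1 : ∑ t, q t = 1)
    {bud : Fin m × S → ℝ} (hb : 0 ≤ bud) {θ B : ℝ} (hθ : 0 < θ)
    (hΦ : expLoad q f bud ≤ θ ^ p * B) {i : Fin m} {u : ℝ} (hu : 0 ≤ u)
    (hfb : f (Pi.single i u) ≤ B) :
    prodExp q (fun σ => f (Function.update (seedLoad bud σ) i u)) ≤ (θ + 1) ^ p * B := by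
  have hs : (Pi.single i u : Fin m → ℝ) ∈ orthant m := single_mem_orthant hu
  refine le_trans (prodExp_mono hq fun σ => ?_) (expLoad_bound hf hq hq1 hb hθ hΦ hs hfb)
  have hy := seedLoad_mem hb σ
  refine hf.monotone (update_mem_orthant hy i hu) (add_mem_orthant hy hs) ?_
  rw [update_eq_add_single]
  exact add_le_add_left (update_zero_le hy i) _

/-- The budgets at which machine `i` can be opened at a price of at most `R`. -/
def affordable (q : Option S → ℝ) (f : (Fin m → ℝ) → ℝ) (B : ℝ) (bud : Fin m × S → ℝ)
    (i : Fin m) (R : ℝ) : Set ℝ :=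
  {u | 0 ≤ u ∧ price q f bud i u ≤ R ∧ f (Pi.single i u) ≤ B}

theorem PBounded.continuousOn_single (hf : PBounded p f) {y : Fin m → ℝ} (hy : y ∈ orthant m)
    (i : Fin m) : ContinuousOn (fun u : ℝ => f (Function.update y i u)) (Set.Ici 0) := by
  have h := hf.continuousOn_line (update_mem_orthant hy i le_rfl)
    (single_mem_orthant (i := i) zero_le_one)
  refine h.congr fun u _ => ?_
  simp only [update_eq_add_single y i u, ← Pi.single_smul, smul_eq_mul, mul_one]

theorem isClosed_affordable (hf : PBounded p f) {bud : Fin m × S → ℝ} (hb : 0 ≤ bud) (B : ℝ)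
    (i : Fin m) (R : ℝ) : IsClosed (affordable q f B bud i R) := by
  have h1 : ContinuousOn (fun u => price q f bud i u) (Set.Ici 0) := by
    simp only [price, prodExp]
    exact continuousOn_finsetSum _ fun σ _ => continuousOn_const.mul
      ((hf.continuousOn_single (seedLoad_mem hb σ) i).sub continuousOn_const)
  have h2 : ContinuousOn (fun u : ℝ => f (Pi.single i u)) (Set.Ici 0) :=
    hf.continuousOn_single zero_mem_orthant i
  have e : affordable q f B bud i R = (Set.Ici 0 ∩ (fun u => price q f bud i u) ⁻¹' Set.Iic R) ∩
      (Set.Ici 0 ∩ (fun u : ℝ => f (Pi.single i u)) ⁻¹' Set.Iic B) := by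
    ext u
    simp only [affordable, Set.mem_ofPred_eq, Set.mem_inter_iff, Set.mem_Ici, Set.mem_preimage,
      Set.mem_Iic]
    tauto
  rw [e]
  exact (h1.preimage_isClosed_of_isClosed isClosed_Ici isClosed_Iic).inter
    (h2.preimage_isClosed_of_isClosed isClosed_Ici isClosed_Iic)

/-- The supremum is attained because the set is closed and contains `0`; hence a machine can be
opened at the largest affordable budget itself. -/
theorem sSup_mem_affordable (hf : PBounded p f) {bud : Fin m × S → ℝ} (hb : 0 ≤ bud) {B : ℝ}
    (hB : f 0 ≤ B) {i : Fin m} {R : ℝ} (hR : 0 ≤ R) (h : BddAbove (affordable q f B bud i R)) :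
    sSup (affordable q f B bud i R) ∈ affordable q f B bud i R :=
  (isClosed_affordable hf hb B i R).csSup_mem
    ⟨0, le_rfl, by rwa [price_zero], by simpa using hB⟩ h

theorem bddAbove_affordable (hf : PBounded p f) (bud : Fin m × S → ℝ) {B : ℝ} {i : Fin m}
    (R : ℝ) (h : ¬ ∀ u, 0 ≤ u → f (Pi.single i u) ≤ B) :
    BddAbove (affordable q f B bud i R) := by
  push Not at h
  obtain ⟨v, hv0, hv⟩ := h
  refine ⟨v, fun u hu => ?_⟩
  by_contra! hlt
  have := hf.monotone (single_mem_orthant (i := i) hv0) (single_mem_orthant (i := i) hu.1)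
    (Pi.single_le_single.2 hlt.le)
  linarith [hu.2.2]

end RandomLoad
/-! ### The deterministic fractional process -/

/-- What the process may observe about the machines: `pr i u w S j` is the probability that the
Norm-Packing algorithm of machine `i` with budget `u` and target `w` schedules job `j` when the
jobs in `S` are offered, and `nopt i u S` is the Norm-Packing optimum for these jobs. -/
structure Oracle (m n : ℕ) where
  pr : Fin m → ℝ → ℕ → Finset (Fin n) → Fin n → ℝ
  nopt : Fin m → ℝ → Finset (Fin n) → ℕ

/-- `pr_insert` expresses that the simulated algorithm is online, `nopt_mono` makes completion
permanent, and `gain` turns the completion of an atom into expected scheduled jobs. -/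
structure Oracle.Valid {m n : ℕ} (O : Oracle m n) (α : ℝ) : Prop where
  pr_nonneg : ∀ i u w S j, 0 ≤ O.pr i u w S j
  pr_le_one : ∀ i u w S j, O.pr i u w S j ≤ 1
  pr_notMem : ∀ i u w S j, j ∉ S → O.pr i u w S j = 0
  pr_insert : ∀ i u w S j l, j < l → O.pr i u w (insert l S) j = O.pr i u w S j
  nopt_mono : ∀ i u S S', S ⊆ S' → O.nopt i u S ≤ O.nopt i u S'
  gain : ∀ i u w S, 0 ≤ u → w ≤ O.nopt i u S → α * w ≤ ∑ j, O.pr i u w S j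

/-- An atom is a machine together with a size class and a level. -/
abbrev Atom (m a L : ℕ) : Type := Fin m × (Fin a × Fin L)

/-- The parameters of the process: the probabilities of the atoms, the targets of the size
classes, the bound on the fractional value of a job, and the choice of budgets. -/
structure Scheme (m a L : ℕ) where
  q : Fin a × Fin L → ℝ
  w : Fin a → ℕ
  cap : ℝ
  pick : (Atom m a L → ℝ) → Atom m a L → Option ℝ

structure State (m n a L : ℕ) where
  started : Finset (Atom m a L)
  bud : Atom m a L → ℝ
  seg : Atom m a L → Finset (Fin n)

section FractionalProcess

variable {m n a L : ℕ} (P : Scheme m a L) (O : Oracle m n)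

/-- Completion is measured by the packing optimum of the offered jobs, not by what the algorithm
accepted. It is therefore deterministic and independent of the seeds. -/
def State.Completed (st : State m n a L) (e : Atom m a L) : Prop :=
  e ∈ st.started ∧ P.w e.2.1 ≤ O.nopt e.1 (st.bud e) (st.seg e)

/-- An atom may be started once the previous level is completed. -/
def State.Ready (st : State m n a L) (e : Atom m a L) : Prop :=
  ∀ k : Fin L, (k : ℕ) + 1 = e.2.2 → st.Completed P O (e.1, (e.2.1, k))

/-- The fraction to which a job is scheduled. -/
def State.mass (st : State m n a L) (j : Fin n) : ℝ :=
  ∑ e : Atom m a L, P.q e.2 * O.pr e.1 (st.bud e) (P.w e.2.1) (st.seg e) j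

open Classical in
def State.start (st : State m n a L) (e : Atom m a L) (u : ℝ) : State m n a L :=
  ⟨insert e st.started, Function.update st.bud e u, st.seg⟩

open Classical in
def State.offer (st : State m n a L) (j : Fin n) (e : Atom m a L) : State m n a L :=
  ⟨st.started, st.bud, Function.update st.seg e (insert j (st.seg e))⟩

open Classical in
def State.startStep (st : State m n a L) (e : Atom m a L) : State m n a L :=
  if e ∉ st.started ∧ st.Ready P O e then
    match P.pick st.bud e with
    | none => st
    | some u => st.start e u
  else st

open Classical in
def State.offerStep (st : State m n a L) (j : Fin n) (e : Atom m a L) : State m n a L :=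
  if e ∈ st.started ∧ ¬ st.Completed P O e then st.offer j e else st

open Classical in
-- Saturated jobs are skipped. The start comes before the offer, so an atom opened by a job can
-- receive that same job.
def State.step (st : State m n a L) (j : Fin n) (e : Atom m a L) : State m n a L :=
  if st.mass P O j < P.cap then (st.startStep P O e).offerStep P O j e else st

/-- The number of steps per job. -/
def stepsPerJob (m a L : ℕ) : ℕ := m * (a * L)

/-- The steps, in lexicographic order. -/
def stepEquiv (n m a L : ℕ) : Fin n × Atom m a L ≃ Fin (n * stepsPerJob m a L) :=
  ((Equiv.refl _).prodCongr (((Equiv.refl _).prodCongr finProdFinEquiv).trans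
    finProdFinEquiv)).trans finProdFinEquiv

def time (j : Fin n) (e : Atom m a L) : ℕ := (stepEquiv n m a L (j, e) : ℕ)

def runTo : ℕ → State m n a L
  | 0 => ⟨∅, 0, fun _ => ∅⟩
  | t + 1 =>
    if h : t < n * stepsPerJob m a L then
      (runTo t).step P O ((stepEquiv n m a L).symm ⟨t, h⟩).1 ((stepEquiv n m a L).symm ⟨t, h⟩).2
    else runTo t

theorem time_eq (j : Fin n) (e : Atom m a L) :
    time j e = (e.2.2 + L * e.2.1 + (a * L) * e.1) + stepsPerJob m a L * j := by
  rfl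

theorem time_lt (j : Fin n) (e : Atom m a L) : time j e < n * stepsPerJob m a L :=
  (stepEquiv n m a L (j, e)).2

theorem time_bounds (j : Fin n) (e : Atom m a L) :
    stepsPerJob m a L * j ≤ time j e ∧ time j e < stepsPerJob m a L * (j + 1) := by
  have h1 : ((finProdFinEquiv (e.1, finProdFinEquiv e.2) : Fin (m * (a * L))) : ℕ) <
    stepsPerJob m a L := (finProdFinEquiv (e.1, finProdFinEquiv e.2)).2
  have h2 : time j e = ((finProdFinEquiv (e.1, finProdFinEquiv e.2) : Fin (m * (a * L))) : ℕ)
      + stepsPerJob m a L * j := by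
    simp [time_eq]
  rw [h2, mul_add]
  omega

/-- Consecutive levels are visited in consecutive steps, so when level `k` is completed at its own
step for a job, level `k + 1` is ready for the same job. -/
theorem time_next (j : Fin n) (i : Fin m) (κ : Fin a) {k k' : Fin L} (h : (k : ℕ) + 1 = k') :
    time j (i, (κ, k')) = time j (i, (κ, k)) + 1 := by
  rw [time_eq, time_eq]
  simp only [← h]
  ring

theorem time_lt_time {j j' : Fin n} (h : j < j') (e : Atom m a L) : time j e < time j' e := by
  have h0 : 0 < stepsPerJob m a L := by
    by_contra h0
    have := time_bounds j e
    simp only [not_lt, Nat.le_zero] at h0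
    simp [h0] at this
  rw [time_eq, time_eq]
  have : stepsPerJob m a L * (j : ℕ) < stepsPerJob m a L * (j' : ℕ) :=
    Nat.mul_lt_mul_of_pos_left h h0
  omega

theorem runTo_succ_time (j : Fin n) (e : Atom m a L) :
    runTo P O (time j e + 1) = (runTo P O (time j e)).step P O j e := by
  rw [runTo, dif_pos (time_lt j e)]
  have : (⟨time j e, time_lt j e⟩ : Fin (n * stepsPerJob m a L)) = stepEquiv n m a L (j, e) := rfl
  rw [this, Equiv.symm_apply_apply]

theorem runTo_succ_cases (t : ℕ) :
    (runTo P O (t + 1) = runTo P O t ∧ n * stepsPerJob m a L ≤ t) ∨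
      ∃ j e, t = time j e ∧ runTo P O (t + 1) = (runTo P O t).step P O j e := by
  by_cases h : t < n * stepsPerJob m a L
  · right
    refine ⟨((stepEquiv n m a L).symm ⟨t, h⟩).1, ((stepEquiv n m a L).symm ⟨t, h⟩).2, ?_, ?_⟩
    · simp [time]
    · rw [runTo, dif_pos h]
  · left
    exact ⟨by rw [runTo, dif_neg h], not_lt.1 h⟩

variable {P O}

theorem State.step_induction {I : State m n a L → Prop} {st : State m n a L} {j : Fin n}
    {e : Atom m a L} (h0 : I st)
    (hs : ∀ st, I st → e ∉ st.started → st.Ready P O e → ∀ u, P.pick st.bud e = some u →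
      I (st.start e u))
    (ho : ∀ st, I st → e ∈ st.started → ¬ st.Completed P O e → I (st.offer j e)) :
    I (st.step P O j e) := by
  rw [State.step]
  split_ifs
  · have h1 : I (st.startStep P O e) := by
      rw [State.startStep]
      split_ifs with h
      · rcases hp : P.pick st.bud e with _ | u
        · exact h0
        · exact hs st h0 h.1 h.2 u hp
      · exact h0
    rw [State.offerStep]
    split_ifs with h
    · exact ho _ h1 h.1 h.2
    · exact h1
  · exact h0

/-- An invariant preserved by starting an atom and by offering a job holds throughout. -/
theorem runTo_induction {I : State m n a L → Prop} (h0 : I ⟨∅, 0, fun _ => ∅⟩)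
    (hs : ∀ st e, I st → e ∉ st.started → st.Ready P O e → ∀ u, P.pick st.bud e = some u →
      I (st.start e u))
    (ho : ∀ st j e, I st → e ∈ st.started → ¬ st.Completed P O e → I (st.offer j e)) (t : ℕ) :
    I (runTo P O t) := by
  induction t with
  | zero => exact h0
  | succ t ih =>
    rcases runTo_succ_cases P O t with ⟨h, -⟩ | ⟨j, e, -, h⟩
    · rwa [h]
    · rw [h]
      exact State.step_induction ih (fun st hi => hs st e hi) (fun st hi => ho st j e hi)

/-- Atoms that have not been started carry no budget and no jobs. -/
theorem runTo_not_started (t : ℕ) :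
    ∀ e, e ∉ (runTo P O t).started → (runTo P O t).bud e = 0 ∧ (runTo P O t).seg e = ∅ := by
  refine runTo_induction (P := P) (O := O) (I := fun st => ∀ e, e ∉ st.started →
    st.bud e = 0 ∧ st.seg e = ∅) ?_ ?_ ?_ t
  · simp
  · intro st e hst _ _ u _ e' he'
    simp only [State.start, Finset.mem_insert, not_or] at he' ⊢
    rw [Function.update_of_ne he'.1]
    exact hst e' he'.2
  · intro st j e hst he _ e' he'
    simp only [State.offer] at he' ⊢
    have : e' ≠ e := fun h => he' (h ▸ he)
    rw [Function.update_of_ne this]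
    exact hst e' he'

/-- The process only extends states. -/
structure State.Le (st st' : State m n a L) : Prop where
  started : st.started ⊆ st'.started
  bud : ∀ e ∈ st.started, st'.bud e = st.bud e
  seg : ∀ e, st.seg e ⊆ st'.seg e

theorem State.Le.rfl {st : State m n a L} : st.Le st :=
  ⟨subset_rfl, fun _ _ => _root_.rfl, fun _ => subset_rfl⟩

theorem State.Le.trans {st st' st'' : State m n a L} (h : st.Le st') (h' : st'.Le st'') :
    st.Le st'' :=
  ⟨h.started.trans h'.started, fun e he => (h'.bud e (h.started he)).trans (h.bud e he),
    fun e => (h.seg e).trans (h'.seg e)⟩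

theorem State.le_start (st : State m n a L) {e : Atom m a L} (he : e ∉ st.started)
    (u : ℝ) : st.Le (st.start e u) := by
  refine ⟨Finset.subset_insert _ _, fun e' he' => ?_, fun e' => subset_rfl⟩
  have : e' ≠ e := fun h => he (h ▸ he')
  simp [State.start, this]

theorem State.le_offer (st : State m n a L) (j : Fin n) (e : Atom m a L) :
    st.Le (st.offer j e) := by
  refine ⟨subset_rfl, fun _ _ => rfl, fun e' => ?_⟩
  by_cases h' : e' = e
  · subst h'; simp [State.offer]
  · simp [State.offer, h']

theorem State.le_step (st : State m n a L) (j : Fin n) (e : Atom m a L) :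
    st.Le (st.step P O j e) :=
  State.step_induction (I := fun st' => st.Le st') State.Le.rfl
    (fun st' h he _ u _ => h.trans (st'.le_start he u))
    (fun st' h _ _ => h.trans (st'.le_offer j e))

theorem runTo_le {t t' : ℕ} (h : t ≤ t') : (runTo P O t).Le (runTo P O t') := by
  induction t', h using Nat.le_induction with
  | base => exact State.Le.rfl
  | succ t' _ ih =>
    refine ih.trans ?_
    rcases runTo_succ_cases P O t' with ⟨h, -⟩ | ⟨j, e, -, h⟩
    · rw [h]; exact State.Le.rfl
    · rw [h]; exact State.le_step _ _ _

theorem State.Completed.mono {α : ℝ} (hO : O.Valid α) {st st' : State m n a L} (h : st.Le st')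
    {e : Atom m a L} (hc : st.Completed P O e) : st'.Completed P O e :=
  ⟨h.started hc.1, by rw [h.bud e hc.1]; exact hc.2.trans (hO.nopt_mono _ _ _ _ (h.seg e))⟩

/-- Only jobs that have arrived are in the segments. -/
theorem runTo_seg_lt (t : ℕ) (e : Atom m a L) (l : Fin n) (hl : l ∈ (runTo P O t).seg e) :
    stepsPerJob m a L * l < t := by
  induction t generalizing e l with
  | zero => simp [runTo] at hl
  | succ t ih =>
    rcases runTo_succ_cases P O t with ⟨h, -⟩ | ⟨j, e', ht, h⟩
    · rw [h] at hl; exact (ih e l hl).trans (Nat.lt_succ_self t)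
    · rw [h] at hl
      have key : ∀ e, ∀ l ∈ ((runTo P O t).step P O j e').seg e, stepsPerJob m a L * l < t + 1 := by
        refine State.step_induction (I := fun st => ∀ e, ∀ l ∈ st.seg e,
          stepsPerJob m a L * l < t + 1) ?_ ?_ ?_
        · exact fun e l hl => (ih e l hl).trans (Nat.lt_succ_self t)
        · exact fun st hst _ _ u _ => hst
        · intro st hst _ _ e l hl
          by_cases h' : e = e'
          · subst h'
            simp only [State.offer, Function.update_self, Finset.mem_insert] at hl
            rcases hl with rfl | hl
            · rw [ht]; exact Nat.lt_succ_of_le (time_bounds l e).1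
            · exact hst e l hl
          · simp only [State.offer, Function.update_of_ne h'] at hl
            exact hst e l hl
      exact key e l hl

theorem runTo_seg_le {j : Fin n} {t : ℕ}
    (ht : t ≤ stepsPerJob m a L * (j + 1)) {e : Atom m a L} {l : Fin n}
    (hl : l ∈ (runTo P O t).seg e) : l ≤ j := by
  have := (runTo_seg_lt t e l hl).trans_le ht
  have := lt_of_mul_lt_mul_left this (Nat.zero_le _)
  exact Fin.le_def.2 (Nat.lt_succ_iff.1 this)

end FractionalProcess

/-! ### Evolution of the masses, dependence on the past only, and progress of the levels. -/

section FractionalProcess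

variable {m n a L : ℕ} {P : Scheme m a L} {O : Oracle m n} {α : ℝ}

theorem State.mass_start (hO : O.Valid α) {st : State m n a L} {e : Atom m a L}
    (h : st.seg e = ∅) (u : ℝ) (j : Fin n) : (st.start e u).mass P O j = st.mass P O j := by
  refine Finset.sum_congr rfl fun e' _ => ?_
  by_cases h' : e' = e
  · subst h'
    simp [State.start, h, hO.pr_notMem]
  · simp [State.start, h']

/-- All jobs of the segment precede `j` or equal it, so by `pr_insert` offering `j` leaves the
acceptance probabilities of the earlier jobs unchanged. -/
theorem State.mass_offer_of_ne (hO : O.Valid α) {st : State m n a L} {e : Atom m a L}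
    {j l : Fin n} (h : ∀ l ∈ st.seg e, l ≤ j) (hl : l ≠ j) :
    (st.offer j e).mass P O l = st.mass P O l := by
  refine Finset.sum_congr rfl fun e' _ => ?_
  by_cases h' : e' = e
  · subst h'
    simp only [State.offer, Function.update_self]
    by_cases hm : l ∈ st.seg e'
    · rw [← hO.pr_insert e'.1 (st.bud e') (P.w e'.2.1) (st.seg e') l j
        (lt_of_le_of_ne (h l hm) hl)]
    · rw [hO.pr_notMem _ _ _ _ _ hm, hO.pr_notMem]
      simp [hl, hm]
  · simp [State.offer, h']

theorem State.mass_offer_self (hO : O.Valid α) (hq : ∀ s, 0 ≤ P.q s) (st : State m n a L)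
    (e : Atom m a L) (j : Fin n) :
    st.mass P O j ≤ (st.offer j e).mass P O j ∧
      (st.offer j e).mass P O j ≤ st.mass P O j + P.q e.2 := by
  classical
  have hdiff : (st.offer j e).mass P O j - st.mass P O j = P.q e.2 *
      (O.pr e.1 (st.bud e) (P.w e.2.1) (insert j (st.seg e)) j -
        O.pr e.1 (st.bud e) (P.w e.2.1) (st.seg e) j) := by
    rw [State.mass, State.mass, ← Finset.sum_sub_distrib, Finset.sum_eq_single e]
    · simp only [State.offer, Function.update_self, mul_sub]
    · intro e' _ h'
      simp [State.offer, h']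
    · simp
  have h0 := hO.pr_nonneg e.1 (st.bud e) (P.w e.2.1) (st.seg e) j
  have h1 := hO.pr_le_one e.1 (st.bud e) (P.w e.2.1) (insert j (st.seg e)) j
  have h2 := hO.pr_nonneg e.1 (st.bud e) (P.w e.2.1) (insert j (st.seg e)) j
  have hqe := hq e.2
  constructor
  · by_cases hj : j ∈ st.seg e
    · rw [Finset.insert_eq_of_mem hj] at hdiff
      linarith [mul_nonneg hqe (sub_nonneg.2 h1), hdiff, sub_self
        (O.pr e.1 (st.bud e) (P.w e.2.1) (st.seg e) j), mul_zero (P.q e.2)]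
    · rw [hO.pr_notMem _ _ _ _ _ hj] at hdiff
      nlinarith [mul_nonneg hqe h2]
  · nlinarith [mul_le_mul_of_nonneg_left (show O.pr e.1 (st.bud e) (P.w e.2.1)
      (insert j (st.seg e)) j - O.pr e.1 (st.bud e) (P.w e.2.1) (st.seg e) j ≤ 1 by linarith) hqe]

/-- One step changes only the mass of its own job, by at most the probability of the atom. -/
theorem State.mass_step (hO : O.Valid α) (hq : ∀ s, 0 ≤ P.q s) {st : State m n a L}
    {e : Atom m a L} {j : Fin n} (hle : ∀ l ∈ st.seg e, l ≤ j)
    (hns : e ∉ st.started → st.seg e = ∅) :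
    (∀ l, l ≠ j → (st.step P O j e).mass P O l = st.mass P O l) ∧
      st.mass P O j ≤ (st.step P O j e).mass P O j ∧
      (st.mass P O j < P.cap → (st.step P O j e).mass P O j ≤ st.mass P O j + P.q e.2) ∧
      (¬ st.mass P O j < P.cap → (st.step P O j e).mass P O j = st.mass P O j) := by
  have h1 : (st.startStep P O e).seg = st.seg ∧
      ∀ l, (st.startStep P O e).mass P O l = st.mass P O l := by
    rw [State.startStep]
    split_ifs with h
    · rcases hp : P.pick st.bud e with _ | u
      · exact ⟨rfl, fun _ => rfl⟩
      · exact ⟨rfl, fun l => State.mass_start hO (hns h.1) u l⟩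
    · exact ⟨rfl, fun _ => rfl⟩
  have hself := State.mass_offer_self (P := P) hO hq (st.startStep P O e) e j
  rw [h1.2] at hself
  rw [State.step]
  split_ifs with hc
  · rw [State.offerStep]
    split_ifs
    · refine ⟨fun l hl => ?_, hself.1, fun _ => hself.2, fun h => absurd hc h⟩
      rw [State.mass_offer_of_ne hO (by rwa [h1.1]) hl, h1.2]
    · simp only [h1.2]
      exact ⟨fun _ _ => trivial, le_rfl, fun _ => by linarith [hq e.2], fun _ => trivial⟩
  · exact ⟨fun _ _ => rfl, le_rfl, fun h => absurd h hc, fun _ => rfl⟩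

theorem mass_runTo_succ (hO : O.Valid α) (hq : ∀ s, 0 ≤ P.q s) (t : ℕ) (l : Fin n) :
    (runTo P O t).mass P O l ≤ (runTo P O (t + 1)).mass P O l := by
  rcases runTo_succ_cases P O t with ⟨h, -⟩ | ⟨j, e, ht, h⟩
  · rw [h]
  · have := State.mass_step (P := P) (st := runTo P O t) (e := e) (j := j) hO hq
      (fun l hl => runTo_seg_le (by rw [ht]; exact (time_bounds j e).2.le) hl)
      (fun he => (runTo_not_started t e he).2)
    rw [h]
    by_cases hl : l = j
    · rw [hl]; exact this.2.1
    · rw [this.1 l hl]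

theorem mass_runTo_mono (hO : O.Valid α) (hq : ∀ s, 0 ≤ P.q s) (l : Fin n) :
    Monotone fun t => (runTo P O t).mass P O l :=
  monotone_nat_of_le_succ fun t => mass_runTo_succ hO hq t l

theorem mass_runTo_eq (hO : O.Valid α) (hq : ∀ s, 0 ≤ P.q s) (l : Fin n) {t : ℕ}
    (ht : stepsPerJob m a L * (l + 1) ≤ t) :
    (runTo P O t).mass P O l = (runTo P O (stepsPerJob m a L * (l + 1))).mass P O l := by
  induction t, ht using Nat.le_induction with
  | base => rfl
  | succ t hlt ih =>
    rw [← ih]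
    rcases runTo_succ_cases P O t with ⟨h, -⟩ | ⟨j, e, ht, h⟩
    · rw [h]
    · have := State.mass_step (P := P) (st := runTo P O t) (e := e) (j := j) hO hq
        (fun l hl => runTo_seg_le (by rw [ht]; exact (time_bounds j e).2.le) hl)
        (fun he => (runTo_not_started t e he).2)
      rw [h]
      refine this.1 l ?_
      rintro rfl
      have := (time_bounds l e).2
      omega

/-- A step acts only while the mass is below the cap and adds at most one atom probability; this is
the overshoot `η`. -/
theorem mass_runTo_le (hO : O.Valid α) (hq : ∀ s, 0 ≤ P.q s) {η : ℝ} (hη : ∀ s, P.q s ≤ η)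
    (hη0 : 0 ≤ η) (hcap : 0 ≤ P.cap) (t : ℕ) (l : Fin n) :
    (runTo P O t).mass P O l ≤ P.cap + η := by
  induction t with
  | zero =>
    simp only [runTo, State.mass, hO.pr_notMem _ _ _ _ _ (Finset.notMem_empty _), mul_zero,
      Finset.sum_const_zero]
    linarith
  | succ t ih =>
    rcases runTo_succ_cases P O t with ⟨h, -⟩ | ⟨j, e, ht, h⟩
    · rwa [h]
    · have := State.mass_step (P := P) (st := runTo P O t) (e := e) (j := j) hO hq
        (fun l hl => runTo_seg_le (by rw [ht]; exact (time_bounds j e).2.le) hl)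
        (fun he => (runTo_not_started t e he).2)
      rw [h]
      by_cases hl : l = j
      · subst hl
        by_cases hc : (runTo P O t).mass P O l < P.cap
        · linarith [this.2.2.1 hc, hη e.2]
        · rwa [this.2.2.2 hc]
      · rwa [this.1 l hl]

/-- Later steps do not change the part of a segment that has been processed. -/
theorem runTo_mem_seg_iff {j l : Fin n} (hl : l ≤ j) (e : Atom m a L) {t : ℕ}
    (ht : stepsPerJob m a L * (j + 1) ≤ t) :
    l ∈ (runTo P O t).seg e ↔ l ∈ (runTo P O (stepsPerJob m a L * (j + 1))).seg e := by
  induction t, ht using Nat.le_induction with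
  | base => rfl
  | succ t hlt ih =>
    rw [← ih]
    rcases runTo_succ_cases P O t with ⟨h, -⟩ | ⟨j', e', ht, h⟩
    · rw [h]
    · rw [h]
      have hne : l ≠ j' := by
        rintro rfl
        have h1 := (time_bounds l e').2
        have h2 : stepsPerJob m a L * (l + 1 : ℕ) ≤ stepsPerJob m a L * (j + 1 : ℕ) :=
          Nat.mul_le_mul_left _ (Nat.succ_le_succ (Fin.le_def.1 hl))
        omega
      refine State.step_induction (I := fun st => l ∈ st.seg e ↔ l ∈ (runTo P O t).seg e)
        Iff.rfl (fun st hst _ _ _ _ => hst) ?_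
      intro st hst _ _
      by_cases h' : e = e'
      · subst h'
        simp [State.offer, hne, hst]
      · simpa [State.offer, h'] using hst

/-- The process is online. -/
theorem runTo_congr {O' : Oracle m n} {j : Fin n}
    (hpr : ∀ i u w S, (∀ l ∈ S, l ≤ j) → O.pr i u w S = O'.pr i u w S)
    (hnopt : ∀ i u S, (∀ l ∈ S, l ≤ j) → O.nopt i u S = O'.nopt i u S) {t : ℕ}
    (ht : t ≤ stepsPerJob m a L * (j + 1)) : runTo P O t = runTo P O' t := by
  classical
  induction t with
  | zero => rfl
  | succ t ih =>
    have ih := ih (by omega)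
    by_cases h : t < n * stepsPerJob m a L
    · rw [runTo, runTo, dif_pos h, dif_pos h, ← ih]
      generalize ((stepEquiv n m a L).symm ⟨t, h⟩).1 = j'
      generalize ((stepEquiv n m a L).symm ⟨t, h⟩).2 = e
      have hseg : ∀ e, ∀ l ∈ (runTo P O t).seg e, l ≤ j :=
        fun e l hl => runTo_seg_le (by omega) hl
      generalize hst : runTo P O t = st at hseg ⊢
      have hcomp : ∀ st' : State m n a L, (∀ e, ∀ l ∈ st'.seg e, l ≤ j) → ∀ e,
          (st'.Completed P O e ↔ st'.Completed P O' e) := fun st' h' e => by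
        rw [State.Completed, State.Completed, hnopt _ _ _ (h' e)]
      have hmass : ∀ l, st.mass P O l = st.mass P O' l := fun l => by
        refine Finset.sum_congr rfl fun e _ => ?_
        rw [hpr _ _ _ _ (hseg e)]
      have hready : st.Ready P O e ↔ st.Ready P O' e :=
        forall_congr' fun k => imp_congr_right fun _ => hcomp st hseg _
      have hstart : st.startStep P O e = st.startStep P O' e := by
        rw [State.startStep, State.startStep]
        exact if_congr (and_congr_right fun _ => hready) rfl rfl
      have hsseg : ∀ e', ∀ l ∈ (st.startStep P O e).seg e', l ≤ j := by
        rw [State.startStep]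
        split_ifs
        · rcases hp : P.pick st.bud e with _ | u
          · exact hseg
          · exact hseg
        · exact hseg
      rw [State.step, State.step, hmass, ← hstart, State.offerStep, State.offerStep]
      exact if_congr Iff.rfl (if_congr (and_congr_right fun _ =>
        not_congr (hcomp _ hsseg e)) rfl rfl) rfl
    · rw [runTo, runTo, dif_neg h, dif_neg h, ih]

/-- An atom that is ready and affordable when a job arrives that never becomes saturated takes
the job, unless it is completed. -/
theorem step_progress {st : State m n a L} {j : Fin n} {e : Atom m a L}
    (hm : st.mass P O j < P.cap) (hr : st.Ready P O e) (hp : P.pick st.bud e ≠ none) :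
    (st.step P O j e).Completed P O e ∨
      (e ∈ (st.step P O j e).started ∧ j ∈ (st.step P O j e).seg e ∧
        ¬ (st.step P O j e).Completed P O e) := by
  by_cases hc : (st.step P O j e).Completed P O e
  · exact Or.inl hc
  right
  refine ⟨?_, ?_, hc⟩ <;> rw [State.step, if_pos hm] at hc ⊢
  all_goals
    have hs : e ∈ (st.startStep P O e).started := by
      rw [State.startStep]
      split_ifs with h
      · obtain ⟨u, hu⟩ := Option.ne_none_iff_exists'.1 hp
        rw [hu]
        exact Finset.mem_insert_self _ _
      · by_contra hn
        exact h ⟨hn, hr⟩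
    rw [State.offerStep] at hc ⊢
    by_cases h : (st.startStep P O e).Completed P O e
    · rw [if_neg (fun h' => h'.2 h)] at hc
      exact absurd h hc
    · rw [if_pos ⟨hs, h⟩]
      first
        | exact hs
        | simp [State.offer]

/-- A set of unsaturated jobs is small if the machine does not complete all levels of a class. -/
theorem card_le_of_not_completed (hO : O.Valid α) (i : Fin m) (κ : Fin a)
    (J : Finset (Fin n)) (hJ : ∀ j ∈ J, ∀ t, (runTo P O t).mass P O j < P.cap)
    (hp : ∀ t k, P.pick (runTo P O t).bud (i, (κ, k)) ≠ none)
    (hopt : ∀ t k, (i, (κ, k)) ∈ (runTo P O t).started → ∀ J' ⊆ J,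
      J' ⊆ (runTo P O t).seg (i, (κ, k)) →
      J'.card ≤ O.nopt i ((runTo P O t).bud (i, (κ, k))) ((runTo P O t).seg (i, (κ, k))))
    {k : Fin L} {t₀ : ℕ} (ht₀ : n * stepsPerJob m a L ≤ t₀)
    (hk : ¬ (runTo P O t₀).Completed P O (i, (κ, k))) :
    J.card ≤ L * (P.w κ - 1) := by
  classical
  -- Each job of `J` is absorbed at some level that is still incomplete right after taking it.
  have evid : ∀ j ∈ J, ∃ k' : Fin L, ∃ t, t = time j (i, (κ, k')) ∧
      (i, (κ, k')) ∈ (runTo P O (t + 1)).started ∧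
      j ∈ (runTo P O (t + 1)).seg (i, (κ, k')) ∧
      ¬ (runTo P O (t + 1)).Completed P O (i, (κ, k')) := by
    intro j hj
    by_contra! hno
    -- Otherwise the steps of this job would find or make the levels complete one after another,
    -- including level `k`, against `hk`.
    have key : ∀ b : ℕ, ∀ hb : b < L,
        (runTo P O (time j (i, (κ, (⟨b, hb⟩ : Fin L))) + 1)).Completed P O (i, (κ, ⟨b, hb⟩)) := by
      intro b
      induction b with
      | zero =>
        intro hb
        have hr : (runTo P O (time j (i, (κ, (⟨0, hb⟩ : Fin L))))).Ready P O (i, (κ, ⟨0, hb⟩)) :=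
          fun k hk => absurd hk (Nat.succ_ne_zero _)
        have h := step_progress (hJ j hj _) hr (hp _ _)
        rw [← runTo_succ_time] at h
        exact h.elim id fun h => hno _ _ rfl h.1 h.2.1
      | succ b ih =>
        intro hb
        have hr : (runTo P O (time j (i, (κ, (⟨b + 1, hb⟩ : Fin L))))).Ready P O
            (i, (κ, ⟨b + 1, hb⟩)) := by
          intro k hk
          have hk' : k = ⟨b, by omega⟩ := Fin.ext (by simpa using hk)
          rw [hk', time_next j i κ (k := ⟨b, by omega⟩) (k' := ⟨b + 1, hb⟩) rfl]
          exact ih _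
        have h := step_progress (hJ j hj _) hr (hp _ _)
        rw [← runTo_succ_time] at h
        exact h.elim id fun h => hno _ _ rfl h.1 h.2.1
    refine hk ((key k k.2).mono hO (runTo_le ?_))
    have := time_lt j (i, (κ, (⟨k, k.2⟩ : Fin L)))
    omega
  have : Nonempty (Fin L) := ⟨k⟩
  choose! lev tm htm hst hseg hnc using evid
  -- When the last job of the fibre is taken, the segment contains the whole fibre and its optimum
  -- is still below the target, so the fibre has at most `w - 1` jobs.
  have hfib : ∀ k' ∈ (Finset.univ : Finset (Fin L)),
      (J.filter fun j => lev j = k').card ≤ P.w κ - 1 := by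
    intro k' _
    rcases (J.filter fun j => lev j = k').eq_empty_or_nonempty with h | h
    · rw [h]; simp
    · obtain ⟨hjm, hlev⟩ := Finset.mem_filter.1 (Finset.max'_mem _ h)
      set j := (J.filter fun j => lev j = k').max' h
      have h1 : (J.filter fun j => lev j = k') ⊆ (runTo P O (tm j + 1)).seg (i, (κ, k')) := by
        intro l hl
        have hle : l ≤ j := Finset.le_max' _ l hl
        obtain ⟨hlm, hll⟩ := Finset.mem_filter.1 hl
        have h2 := hseg l hlm
        rw [hll] at h2
        refine (runTo_le ?_).seg _ h2
        rw [htm l hlm, htm j hjm, hll, hlev]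
        rcases hle.eq_or_lt with h | h
        · rw [h]
        · exact Nat.succ_le_succ (time_lt_time h _).le
      have h3 := hopt _ k' (hlev ▸ hst j hjm) _ (Finset.filter_subset _ _) h1
      have h4 := hnc j hjm
      rw [hlev, State.Completed, not_and, not_le] at h4
      have h5 := h4 (hlev ▸ hst j hjm)
      simp only at h5
      omega
  calc J.card = ∑ k' : Fin L, (J.filter fun j => lev j = k').card :=
        Finset.card_eq_sum_card_fiberwise fun _ _ => Finset.mem_coe.2 (Finset.mem_univ _)
    _ ≤ ∑ k' : Fin L, (P.w κ - 1) := Finset.sum_le_sum hfib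
    _ = L * (P.w κ - 1) := by simp

/-- The mass of the jobs pays for the completed atoms. -/
theorem sum_completed_le_mass (hO : O.Valid α) (hq : ∀ s, 0 ≤ P.q s) {st : State m n a L}
    (hbud : 0 ≤ st.bud) (F : Finset (Atom m a L)) (hF : ∀ e ∈ F, st.Completed P O e) :
    ∑ e ∈ F, P.q e.2 * (α * P.w e.2.1) ≤ ∑ j, st.mass P O j := by
  simp only [State.mass]
  rw [Finset.sum_comm]
  calc ∑ e ∈ F, P.q e.2 * (α * P.w e.2.1)
      ≤ ∑ e ∈ F, ∑ j, P.q e.2 * O.pr e.1 (st.bud e) (P.w e.2.1) (st.seg e) j := by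
        refine Finset.sum_le_sum fun e he => ?_
        rw [← Finset.mul_sum]
        exact mul_le_mul_of_nonneg_left (hO.gain _ _ _ _ (hbud e) (hF e he).2) (hq _)
    _ ≤ _ := Finset.sum_le_univ_sum_of_nonneg fun e =>
        Finset.sum_nonneg fun j _ => mul_nonneg (hq _) (hO.pr_nonneg _ _ _ _ _)

end FractionalProcess
/-! ### The parameters of the process -/

/-- With `θ = 3p/2`, the ratio `(1 + 1/θ)^p` is at most `exp (2/3) ≤ 2`, and `2x ≤ 6(x - 1)` holds
for `x = θ^p ≥ 3/2`. After multiplication by `B`, the room between the initial bound `f 0 ≤ B` and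
the limit `θ^p * B` is at least `D/6`. -/
theorem rpow_theta_facts {p : ℝ} (hp : 1 ≤ p) :
    (3 / 2 * p + 1) ^ p ≤ 6 * ((3 / 2 * p) ^ p - 1) := by
  have h0 : 0 < 3 / 2 * p := by linarith
  have h1 : 3 / 2 ≤ (3 / 2 * p) ^ p := by
    have := Real.rpow_le_rpow_of_exponent_le (show 1 ≤ 3 / 2 * p by linarith) hp
    rw [Real.rpow_one] at this
    linarith
  have h2 : (3 / 2 * p + 1) ^ p ≤ (3 / 2 * p) ^ p * 2 := by
    have e : 3 / 2 * p + 1 = (3 / 2 * p) * (1 / (3 / 2 * p) + 1) := by field_simp; ring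
    rw [e, Real.mul_rpow h0.le (by positivity)]
    refine mul_le_mul_of_nonneg_left ?_ (Real.rpow_nonneg h0.le p)
    calc (1 / (3 / 2 * p) + 1) ^ p ≤ (Real.exp (1 / (3 / 2 * p))) ^ p :=
          Real.rpow_le_rpow (by positivity) (Real.add_one_le_exp _) (by linarith)
      _ = Real.exp (2 / 3) := by
          rw [← Real.exp_mul]; congr 1; field_simp
      _ ≤ 2 := by
          have h3 : Real.exp (2 / 3) ^ 3 = Real.exp 1 ^ 2 := by
            rw [← Real.exp_nat_mul, ← Real.exp_nat_mul]; norm_num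
          have h4 := Real.exp_one_lt_d9
          have h5 := Real.exp_pos 1
          by_contra! h6
          have h7 : (2 : ℝ) ^ 3 < Real.exp (2 / 3) ^ 3 := by gcongr
          rw [h3] at h7
          nlinarith
  linarith

/-- For `p ≥ 1` one has `3p/2 + 1 ≤ 5p/2 = (5/6)(3p)`. The factor `5/6` is the failure probability
left by Markov's inequality. -/
theorem rpow_markov_facts {p : ℝ} (hp : 1 ≤ p) :
    (3 / 2 * p + 1) ^ p ≤ 5 / 6 * (3 * p) ^ p := by
  calc (3 / 2 * p + 1) ^ p ≤ (5 / 6 * (3 * p)) ^ p :=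
        Real.rpow_le_rpow (by linarith) (by linarith) (by linarith)
    _ = (5 / 6) ^ p * (3 * p) ^ p := Real.mul_rpow (by norm_num) (by linarith)
    _ ≤ 5 / 6 * (3 * p) ^ p := by
        refine mul_le_mul_of_nonneg_right ?_ (Real.rpow_nonneg (by linarith) p)
        have := Real.rpow_le_rpow_of_exponent_ge (x := 5 / 6) (by norm_num) (by norm_num) hp
        rwa [Real.rpow_one] at this

/-- The probability of a size class and a level. -/
def atomProb (K : ℕ) (s : Fin (K + 3) × Fin (K + 1)) : ℝ :=
  -- Doubling along the levels runs from a total of order `1/(K+3)` over all `m ≤ 2^K` machines at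
  -- level `0` to `1/(144 (K+3))` for a single machine at level `K`.
  2 ^ (s.2 : ℕ) / (144 * 2 ^ K * (K + 3))

theorem atomProb_pos (K : ℕ) (s : Fin (K + 3) × Fin (K + 1)) : 0 < atomProb K s := by
  unfold atomProb; positivity

theorem atomProb_le (K : ℕ) (s : Fin (K + 3) × Fin (K + 1)) : atomProb K s ≤ 1 / 144 := by
  have h1 : (2 : ℝ) ^ (s.2 : ℕ) ≤ 2 ^ K :=
    pow_le_pow_right₀ (by norm_num) (Nat.lt_succ_iff.1 s.2.2)
  have h2 : (0 : ℝ) < 2 ^ K := by positivity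
  rw [atomProb, div_le_div_iff₀ (by positivity) (by norm_num)]
  nlinarith [mul_nonneg h2.le (Nat.cast_nonneg (α := ℝ) K)]

theorem sum_atomProb_le (K : ℕ) : ∑ s, atomProb K s ≤ 1 / 72 := by
  have h1 : ∑ k : Fin (K + 1), (2 : ℝ) ^ (k : ℕ) ≤ 2 * 2 ^ K := by
    rw [Fin.sum_univ_eq_sum_range (fun k => (2 : ℝ) ^ k), geom_sum_eq (by norm_num)]
    rw [pow_succ]; linarith
  simp only [atomProb, ← Finset.sum_div]
  rw [Fintype.sum_prod_type]
  simp only [Finset.sum_const, Finset.card_univ, Fintype.card_fin, nsmul_eq_mul]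
  rw [div_le_div_iff₀ (by positivity) (by norm_num)]
  push_cast
  nlinarith [mul_le_mul_of_nonneg_left h1 (show (0 : ℝ) ≤ K + 3 by positivity)]

/-- The distribution of the seed of a machine. -/
def seedProb (K : ℕ) : Option (Fin (K + 3) × Fin (K + 1)) → ℝ
  | none => 1 - ∑ s, atomProb K s
  | some s => atomProb K s

theorem seedProb_pos (K : ℕ) (s : Option (Fin (K + 3) × Fin (K + 1))) : 0 < seedProb K s := by
  rcases s with _ | s
  · have := sum_atomProb_le K
    simp only [seedProb]; linarith
  · exact atomProb_pos K s

theorem sum_seedProb (K : ℕ) : ∑ s, seedProb K s = 1 := by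
  rw [Fintype.sum_option]; simp [seedProb]

section Scheme

variable {m n : ℕ}

/-- The largest price at which an atom of class `κ` is started. -/
def classCost (p B : ℝ) (κ : ℕ) : ℝ := 4 * ((3 / 2 * p + 1) ^ p * B) / 2 ^ κ

/-- A machine of class `κ` has more than `M / 2^(κ+1)` jobs in the optimum. If at least half are
unsaturated, more than `M / 2^(κ+2)` remain to fill `K + 1` levels. -/
def classTarget (M K κ : ℕ) : ℕ := ⌈(M : ℝ) / (2 ^ (κ + 2) * (K + 1))⌉₊

open Classical in
-- The load test uses the class cost, an upper bound on the price, so passing it keeps the expected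
-- load within its limit. Boundedness is required because `sSup` of an unbounded set would be the
-- default value `0`.
def pickBudget (K : ℕ) (p : ℝ) (f : (Fin m → ℝ) → ℝ) (B : ℝ)
    (bud : Atom m (K + 3) (K + 1) → ℝ) (e : Atom m (K + 3) (K + 1)) : Option ℝ :=
  if expLoad (seedProb K) f bud + atomProb K e.2 * classCost p B e.2.1 ≤ (3 / 2 * p) ^ p * B ∧
      BddAbove (affordable (seedProb K) f B bud e.1 (classCost p B e.2.1)) then
    some (sSup (affordable (seedProb K) f B bud e.1 (classCost p B e.2.1)))
  else none

def packScheme (K : ℕ) (p : ℝ) (f : (Fin m → ℝ) → ℝ) (B : ℝ) (M : ℕ) :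
    Scheme m (K + 3) (K + 1) where
  q := atomProb K
  w := fun κ => classTarget M K κ
  -- Together with the overshoot of at most `1/144` this stays below the `1/12` required by
  -- `prodExp_collision`.
  cap := 1 / 24
  pick := pickBudget K p f B

variable {K M : ℕ} {p B α : ℝ} {f : (Fin m → ℝ) → ℝ} {O : Oracle m n}

theorem classCost_nonneg (hp : 1 ≤ p) (hB : 0 ≤ B) (κ : ℕ) : 0 ≤ classCost p B κ := by
  have : 0 ≤ (3 / 2 * p + 1) ^ p := Real.rpow_nonneg (by linarith) _
  unfold classCost; positivity

/-- The invariants of the process that concern the aggregate function. -/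
structure Invariant (K : ℕ) (p : ℝ) (f : (Fin m → ℝ) → ℝ) (B : ℝ) (M : ℕ) (O : Oracle m n)
    (st : State m n (K + 3) (K + 1)) : Prop where
  not_started : ∀ e, e ∉ st.started → st.bud e = 0
  bud_nonneg : 0 ≤ st.bud
  single_le : ∀ e, f (Pi.single e.1 (st.bud e)) ≤ B
  expLoad_le : expLoad (seedProb K) f st.bud ≤ (3 / 2 * p) ^ p * B
  expLoad_le_sum : expLoad (seedProb K) f st.bud ≤
    f 0 + ∑ e ∈ st.started, atomProb K e.2 * classCost p B e.2.1
  ready : ∀ e ∈ st.started, st.Ready (packScheme K p f B M) O e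
  -- Affordable sets shrink as prices rise, so the maximal budget taken at the start dominates every
  -- budget that is affordable later.
  affordable_le : ∀ e ∈ st.started,
    ∀ v ∈ affordable (seedProb K) f B st.bud e.1 (classCost p B e.2.1), v ≤ st.bud e

theorem State.Ready.mono {a L : ℕ} {P : Scheme m a L} (hO : O.Valid α) {st st' : State m n a L}
    (h : st.Le st') {e : Atom m a L} (hr : st.Ready P O e) : st'.Ready P O e :=
  fun k hk => (hr k hk).mono hO h

theorem invariant_runTo (hf : PBounded p f) (hB : 0 ≤ B) (hfB : f 0 ≤ B) (hO : O.Valid α)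
    (t : ℕ) : Invariant K p f B M O (runTo (packScheme K p f B M) O t) := by
  have hq := fun s => (seedProb_pos K s).le
  refine runTo_induction (I := Invariant K p f B M O) ?_ ?_ ?_ t
  · refine ⟨fun _ _ => rfl, le_rfl, fun e => ?_, ?_, ?_, ?_, ?_⟩
    · simpa using hfB
    · rw [expLoad_zero (sum_seedProb K)]
      refine hfB.trans (le_mul_of_one_le_left hB ?_)
      exact Real.one_le_rpow (by linarith [hf.one_le]) (by linarith [hf.one_le])
    · rw [expLoad_zero (sum_seedProb K)]; simp
    · simp
    · simp
  · intro st e hst he hr u hu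
    change pickBudget K p f B st.bud e = some u at hu
    rw [pickBudget] at hu
    split_ifs at hu with hc
    have hu' := Option.some.inj hu
    have hmem := sSup_mem_affordable hf hst.bud_nonneg hfB
      (classCost_nonneg hf.one_le hB e.2.1) hc.2
    rw [hu'] at hmem
    have hcost : expLoad (seedProb K) f (st.start e u).bud ≤
        expLoad (seedProb K) f st.bud + atomProb K e.2 * classCost p B e.2.1 := by
      have := expLoad_update (f := f) (sum_seedProb K) (bud := st.bud) (i := e.1) (s := e.2)
        (hst.not_started e he) u
      simp only [State.start]
      rw [show (e.1, e.2) = e from rfl] at this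
      have h2 : Function.update st.bud e u = @Function.update _ _ (fun a b =>
        instDecidableEqProd a b) st.bud e u := by congr!
      rw [h2, this]
      have := mul_le_mul_of_nonneg_left hmem.2.1 (atomProb_pos K e.2).le
      simp only [seedProb]
      linarith
    have hle : st.bud ≤ (st.start e u).bud := by
      intro e'
      by_cases h : e' = e
      · subst h; rw [hst.not_started _ he]; simpa [State.start] using hmem.1
      · simp [State.start, h]
    refine ⟨?_, hst.bud_nonneg.trans hle, ?_, hcost.trans hc.1, ?_, ?_, ?_⟩
    · intro e' he'
      simp only [State.start, Finset.mem_insert, not_or] at he' ⊢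
      rw [Function.update_of_ne he'.1]
      exact hst.not_started e' he'.2
    · intro e'
      by_cases h : e' = e
      · subst h; simpa [State.start] using hmem.2.2
      · simpa [State.start, h] using hst.single_le e'
    · rw [State.start, Finset.sum_insert he]
      have := hst.expLoad_le_sum
      simp only [State.start] at hcost
      linarith
    · intro e' he'
      simp only [State.start, Finset.mem_insert] at he'
      rcases he' with rfl | he'
      · exact hr.mono hO (st.le_start he u)
      · exact (hst.ready e' he').mono hO (st.le_start he u)
    · intro e' he' v hv
      have hv' : v ∈ affordable (seedProb K) f B st.bud e'.1 (classCost p B e'.2.1) :=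
        ⟨hv.1, (price_mono hf hq hst.bud_nonneg hle _ hv.1).trans hv.2.1, hv.2.2⟩
      simp only [State.start, Finset.mem_insert] at he'
      by_cases h : e' = e
      · subst h
        have : v ≤ u := hu' ▸ le_csSup hc.2 hv'
        simpa [State.start] using this
      · exact (hst.affordable_le e' (he'.resolve_left h) v hv').trans (hle e')
  · intro st j e hst _ _
    exact ⟨hst.not_started, hst.bud_nonneg, hst.single_le, hst.expLoad_le, hst.expLoad_le_sum,
      fun e' he' => (hst.ready e' he').mono hO (st.le_offer j e), hst.affordable_le⟩

end Scheme

/-! ### Lower bounds on the total mass: the blocked case. -/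

section FractionalValue

variable {m n K M : ℕ} {p B α : ℝ} {f : (Fin m → ℝ) → ℝ} {O : Oracle m n}

theorem le_classTarget (M K κ : ℕ) :
    (M : ℝ) / (2 ^ (κ + 2) * (K + 1)) ≤ classTarget M K κ := Nat.le_ceil _

theorem sum_inv_two_pow_le (a : ℕ) : ∑ κ : Fin a, (1 : ℝ) / 2 ^ (κ : ℕ) ≤ 2 := by
  rw [Fin.sum_univ_eq_sum_range (fun k => (1 : ℝ) / 2 ^ k)]
  simp only [← one_div_pow]
  rw [geom_sum_eq (by norm_num)]
  have : (0 : ℝ) ≤ (1 / 2) ^ a := by positivity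
  have e : ((1 / 2 : ℝ) ^ a - 1) / (1 / 2 - 1) = 2 - 2 * (1 / 2) ^ a := by ring
  rw [e]; linarith

/-- The atoms of level `0` are cheap. -/
theorem sum_level_zero_le (hp : 1 ≤ p) (hB : 0 ≤ B) (hK : m ≤ 2 ^ K)
    (F : Finset (Atom m (K + 3) (K + 1))) (hF : ∀ e ∈ F, (e.2.2 : ℕ) = 0) :
    ∑ e ∈ F, atomProb K e.2 * classCost p B e.2.1 ≤ (3 / 2 * p + 1) ^ p * B / 18 := by
  have hD : 0 ≤ (3 / 2 * p + 1) ^ p * B := mul_nonneg (Real.rpow_nonneg (by linarith) _) hB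
  set D := (3 / 2 * p + 1) ^ p * B with hDdef
  have hK' : (m : ℝ) ≤ 2 ^ K := by exact_mod_cast hK
  have hinj : Set.InjOn (fun e : Atom m (K + 3) (K + 1) => (e.1, e.2.1)) F := by
    rintro ⟨i, κ, k⟩ he ⟨i', κ', k'⟩ he' h
    simp only [Prod.mk.injEq] at h
    have h1 := hF _ he
    have h2 := hF _ he'
    simp only at h1 h2
    have : k = k' := Fin.ext (h1.trans h2.symm)
    rw [h.1, h.2, this]
  calc ∑ e ∈ F, atomProb K e.2 * classCost p B e.2.1
      = ∑ e ∈ F, (1 / (144 * 2 ^ K * (K + 3)) * (4 * D)) * (1 / 2 ^ (e.2.1 : ℕ)) := by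
        refine Finset.sum_congr rfl fun e he => ?_
        rw [atomProb, hF e he, classCost, ← hDdef]
        ring
    _ = ∑ x ∈ F.image (fun e : Atom m (K + 3) (K + 1) => ((e.1, e.2.1) : Fin m × Fin (K + 3))),
          (1 / (144 * 2 ^ K * (K + 3)) * (4 * D)) * (1 / 2 ^ (x.2 : ℕ)) :=
        (Finset.sum_image (f := fun x : Fin m × Fin (K + 3) =>
          (1 / (144 * 2 ^ K * (K + 3)) * (4 * D)) * (1 / 2 ^ (x.2 : ℕ))) hinj).symm
    _ ≤ ∑ x : Fin m × Fin (K + 3),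
          (1 / (144 * 2 ^ K * (K + 3)) * (4 * D)) * (1 / 2 ^ (x.2 : ℕ)) :=
        Finset.sum_le_univ_sum_of_nonneg fun x => by positivity
    _ = m * ((1 / (144 * 2 ^ K * (K + 3)) * (4 * D)) *
          ∑ κ : Fin (K + 3), (1 : ℝ) / 2 ^ (κ : ℕ)) := by
        rw [Fintype.sum_prod_type]
        simp only [← Finset.mul_sum]
        rw [Finset.sum_const, Finset.card_univ, Fintype.card_fin, nsmul_eq_mul]
        ring
    _ ≤ 2 ^ K * ((1 / (144 * 2 ^ K * (K + 3)) * (4 * D)) * 2) := by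
        gcongr
        exact sum_inv_two_pow_le _
    _ = D / (18 * (K + 3)) := by field_simp; ring
    _ ≤ D / 18 := div_le_div_of_nonneg_left hD (by norm_num) (by
        have : (0 : ℝ) ≤ K := Nat.cast_nonneg K
        linarith)

/-- Every started atom of positive level is paid for by the completed atom one level below. -/
theorem sum_level_pos_le (hα : 0 ≤ α) (hp : 1 ≤ p) (hB : 0 ≤ B) (hO : O.Valid α)
    {st : State m n (K + 3) (K + 1)} (hst : Invariant K p f B M O st)
    (F : Finset (Atom m (K + 3) (K + 1))) (hFs : F ⊆ st.started)
    (hF : ∀ e ∈ F, (e.2.2 : ℕ) ≠ 0) :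
    α * M * ∑ e ∈ F, atomProb K e.2 * classCost p B e.2.1 ≤
      32 * ((3 / 2 * p + 1) ^ p * B) * (K + 1) * ∑ j, st.mass (packScheme K p f B M) O j := by
  have hD : 0 ≤ (3 / 2 * p + 1) ^ p * B := mul_nonneg (Real.rpow_nonneg (by linarith) _) hB
  set D := (3 / 2 * p + 1) ^ p * B with hDdef
  let g : Atom m (K + 3) (K + 1) → Atom m (K + 3) (K + 1) := fun e =>
    (e.1, (e.2.1, ⟨(e.2.2 : ℕ) - 1, by omega⟩))
  have hinj : Set.InjOn g F := by
    rintro ⟨i, κ, k⟩ he ⟨i', κ', k'⟩ he' h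
    simp only [g, Prod.mk.injEq, Fin.mk.injEq] at h
    have h1 := hF _ he
    have h2 := hF _ he'
    simp only at h1 h2
    have : k = k' := Fin.ext (by omega)
    rw [h.1, h.2.1, this]
  have hc : ∀ e ∈ F.image g, st.Completed (packScheme K p f B M) O e := by
    intro e' he'
    obtain ⟨e, he, rfl⟩ := Finset.mem_image.1 he'
    refine hst.ready e (hFs he) _ ?_
    have := hF e he
    change (e.2.2 : ℕ) - 1 + 1 = e.2.2
    omega
  have hW := sum_completed_le_mass hO (fun s => (atomProb_pos K s).le) hst.bud_nonneg _ hc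
  rw [Finset.sum_image hinj] at hW
  rw [mul_comm (α * M), Finset.sum_mul]
  refine le_trans ?_ (mul_le_mul_of_nonneg_left hW
    (show (0 : ℝ) ≤ 32 * D * (K + 1) by positivity))
  rw [Finset.mul_sum]
  refine Finset.sum_le_sum fun e he => ?_
  change _ ≤ 32 * D * (K + 1) * (atomProb K (g e).2 * (α * classTarget M K e.2.1))
  have h1 : atomProb K e.2 = 2 * atomProb K (g e).2 := by
    have : (e.2.2 : ℕ) = (e.2.2 : ℕ) - 1 + 1 := by have := hF e he; omega
    simp only [atomProb, g]
    rw [this, pow_succ, Nat.add_sub_cancel]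
    ring
  have h2 := le_classTarget M K e.2.1
  have h3 := (atomProb_pos K (g e).2).le
  -- The factor `32` is `2 * 4 * 4`: the ratio of the probabilities, the constant of the class cost,
  -- and the `2^2` in the target.
  calc atomProb K e.2 * classCost p B e.2.1 * (α * M)
      = 32 * D * (K + 1) * (atomProb K (g e).2 *
          (α * ((M : ℝ) / (2 ^ ((e.2.1 : ℕ) + 2) * (K + 1))))) := by
        rw [h1, classCost, ← hDdef, pow_add]
        field_simp
        ring
    _ ≤ _ := by gcongr

/-- If the process is ever blocked by the bound on the expected load, it has gained a lot. -/
theorem mass_of_blocked (hf : PBounded p f) (hm : m ≤ 2 ^ K) (hα : 0 ≤ α) (hB : 0 ≤ B)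
    (hfB : f 0 ≤ B) (hO : O.Valid α) {t t₀ : ℕ} (ht : t ≤ t₀) (e : Atom m (K + 3) (K + 1))
    (hblock : (3 / 2 * p) ^ p * B < expLoad (seedProb K) f
      (runTo (packScheme K p f B M) O t).bud + atomProb K e.2 * classCost p B e.2.1) :
    α * M ≤ 384 * (K + 1) *
      ∑ j, (runTo (packScheme K p f B M) O t₀).mass (packScheme K p f B M) O j := by
  have hp := hf.one_le
  have hinv := invariant_runTo (K := K) (M := M) hf hB hfB hO
  set st := runTo (packScheme K p f B M) O t
  set st₀ := runTo (packScheme K p f B M) O t₀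
  have hle : st.Le st₀ := runTo_le ht
  have hbud : st.bud ≤ st₀.bud := by
    intro e
    by_cases h : e ∈ st.started
    · exact (hle.bud e h).ge
    · rw [(hinv t).not_started e h]; exact (hinv t₀).bud_nonneg e
  have hmono := expLoad_mono hf (fun s => (seedProb_pos K s).le) (hinv t).bud_nonneg hbud
  have hD0 : 0 ≤ (3 / 2 * p + 1) ^ p := Real.rpow_nonneg (by linarith) _
  -- For `B = 0` all class costs vanish, and blocking would contradict the invariant on the expected
  -- load.
  rcases hB.eq_or_lt with rfl | hB
  · exfalso
    have h1 := (hinv t).expLoad_le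
    simp only [classCost, mul_zero, zero_div, add_zero] at hblock h1
    linarith
  have hDpos : 0 < (3 / 2 * p + 1) ^ p * B :=
    mul_pos (Real.rpow_pos_of_pos (by linarith) _) hB
  have hnum := mul_le_mul_of_nonneg_right (rpow_theta_facts hp) hB.le
  have hcost : atomProb K e.2 * classCost p B e.2.1 ≤ (3 / 2 * p + 1) ^ p * B / 36 := by
    have h1 : classCost p B e.2.1 ≤ 4 * ((3 / 2 * p + 1) ^ p * B) :=
      div_le_self (by linarith) (one_le_pow₀ (by norm_num))
    have h2 := classCost_nonneg hp hB.le e.2.1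
    calc _ ≤ 1 / 144 * (4 * ((3 / 2 * p + 1) ^ p * B)) :=
          mul_le_mul (atomProb_le K e.2) h1 h2 (by norm_num)
      _ = _ := by ring
  have hsplit := Finset.sum_filter_add_sum_filter_not st₀.started (fun e => (e.2.2 : ℕ) = 0)
    (fun e => atomProb K e.2 * classCost p B e.2.1)
  have hzero := sum_level_zero_le (m := m) hp hB.le hm
    (st₀.started.filter fun e => (e.2.2 : ℕ) = 0) (fun e he => (Finset.mem_filter.1 he).2)
  have hpos := sum_level_pos_le hα hp hB.le hO (hinv t₀)
    (st₀.started.filter fun e => ¬ (e.2.2 : ℕ) = 0) (Finset.filter_subset _ _)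
    (fun e he => (Finset.mem_filter.1 he).2)
  have hsum := (hinv t₀).expLoad_le_sum
  set D := (3 / 2 * p + 1) ^ p * B
  set X := ∑ e ∈ st₀.started.filter (fun e => ¬ (e.2.2 : ℕ) = 0),
    atomProb K e.2 * classCost p B e.2.1
  set W := ∑ j, st₀.mass (packScheme K p f B M) O j
  -- From the room `D/6` subtract `D/36` for the blocked atom and `D/18` for level `0`.
  have hX : D / 12 ≤ X := by linarith
  have h1 : α * M * (D / 12) ≤ 32 * D * (K + 1) * W :=
    (mul_le_mul_of_nonneg_left hX (by positivity)).trans hpos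
  have h2 : D * (α * M) ≤ D * (384 * (K + 1) * W) := by linarith
  exact le_of_mul_le_mul_left h2 hDpos

end FractionalValue

/-! ### Lower bounds on the total mass: the unblocked case and the conclusion. -/

section FractionalValue

variable {m n K M : ℕ} {p B α : ℝ} {f : (Fin m → ℝ) → ℝ} {O : Oracle m n}

theorem exists_size_class {M c K : ℕ} (hc : c ≤ M) (hM : M < c * 2 ^ (K + 3)) :
    ∃ κ : Fin (K + 3), M < c * 2 ^ ((κ : ℕ) + 1) ∧ c * 2 ^ (κ : ℕ) ≤ M := by
  classical
  have hex : ∃ κ, M < c * 2 ^ (κ + 1) := ⟨K + 2, hM⟩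
  refine ⟨⟨Nat.find hex, Nat.lt_succ_of_le (Nat.find_min' hex hM)⟩, Nat.find_spec hex, ?_⟩
  change c * 2 ^ Nat.find hex ≤ M
  rcases h : Nat.find hex with _ | κ
  · simpa using hc
  · exact not_lt.1 (Nat.find_min hex (m := κ) (by omega))

/-- A machine of the optimum with affordable load and with enough jobs that are not saturated
completes all levels of its size class. -/
theorem completed_of_affordable (hf : PBounded p f) (hB : 0 ≤ B) (hfB : f 0 ≤ B)
    (hO : O.Valid α) {t₀ : ℕ} (ht₀ : t₀ = n * stepsPerJob m (K + 3) (K + 1)) {i : Fin m} {v : ℝ}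
    {κ : Fin (K + 3)}
    (hp : ∀ t ≤ t₀, ∀ k, pickBudget K p f B (runTo (packScheme K p f B M) O t).bud (i, (κ, k)) ≠ none)
    (hv : v ∈ affordable (seedProb K) f B (runTo (packScheme K p f B M) O t₀).bud i
      (classCost p B κ)) (J : Finset (Fin n))
    (hJ : ∀ j ∈ J, (runTo (packScheme K p f B M) O t₀).mass (packScheme K p f B M) O j < 1 / 24)
    (hopt : ∀ u S J', J' ⊆ J → J' ⊆ S → v ≤ u → J'.card ≤ O.nopt i u S)
    (hcard : (M : ℝ) / 2 ^ ((κ : ℕ) + 2) < J.card) (k : Fin (K + 1)) :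
    (runTo (packScheme K p f B M) O t₀).Completed (packScheme K p f B M) O (i, (κ, k)) := by
  have hq : ∀ s, 0 ≤ (packScheme (m := m) K p f B M).q s := fun s => (atomProb_pos K s).le
  by_contra hk
  -- No steps remain after `t₀`, so conditions known up to `t₀` hold at all times.
  have hconst : ∀ t, t₀ ≤ t →
      runTo (packScheme K p f B M) O t = runTo (packScheme K p f B M) O t₀ := by
    intro t ht
    induction t, ht using Nat.le_induction with
    | base => rfl
    | succ t ht ih => rw [runTo, dif_neg (by omega), ih]
  have hred : ∀ t, ∃ t' ≤ t₀,
      runTo (packScheme K p f B M) O t = runTo (packScheme K p f B M) O t' := fun t => by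
    rcases le_total t t₀ with h | h
    · exact ⟨t, h, rfl⟩
    · exact ⟨t₀, le_rfl, hconst t h⟩
  have hle := card_le_of_not_completed (P := packScheme K p f B M) hO i κ J ?_ ?_ ?_
    ht₀.ge hk
  -- The `- 1` gained at each level absorbs the rounding up in the target, so at most `M / 2^(κ+2)`
  -- jobs can be absorbed, fewer than `J` has.
  · have hw : ((packScheme (m := m) K p f B M).w κ : ℝ) <
        (M : ℝ) / (2 ^ ((κ : ℕ) + 2) * (K + 1)) + 1 := Nat.ceil_lt_add_one (by positivity)
    have h1 : (J.card : ℝ) ≤ (K + 1) * (((packScheme (m := m) K p f B M).w κ - 1 : ℕ) : ℝ) := by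
      exact_mod_cast hle
    have h2 : (((packScheme (m := m) K p f B M).w κ - 1 : ℕ) : ℝ) ≤
        (M : ℝ) / (2 ^ ((κ : ℕ) + 2) * (K + 1)) := by
      rcases Nat.eq_zero_or_pos ((packScheme (m := m) K p f B M).w κ) with h | h
      · rw [h]; simp only [zero_tsub, Nat.cast_zero]; positivity
      · rw [Nat.cast_sub h]; push_cast; linarith
    have h3 : (K + 1 : ℝ) * ((M : ℝ) / (2 ^ ((κ : ℕ) + 2) * (K + 1))) =
        (M : ℝ) / 2 ^ ((κ : ℕ) + 2) := by field_simp
    have h4 := mul_le_mul_of_nonneg_left h2 (show (0 : ℝ) ≤ K + 1 by positivity)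
    linarith
  · intro j hj t
    obtain ⟨t', ht', h⟩ := hred t
    rw [h]
    exact (mass_runTo_mono hO hq j ht').trans_lt (hJ j hj)
  · intro t k
    obtain ⟨t', ht', h⟩ := hred t
    rw [h]
    exact hp t' ht' k
  · intro t k
    obtain ⟨t', ht', h⟩ := hred t
    rw [h]
    intro hs J' h1 h2
    refine hopt _ _ J' h1 h2 ?_
    have hle := runTo_le (P := packScheme K p f B M) (O := O) ht'
    rw [← hle.bud _ hs]
    exact (invariant_runTo hf hB hfB hO t₀).affordable_le _ (hle.started hs) v hv

/-- The fractional process schedules enough jobs. -/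
theorem fractional_value (hf : PBounded p f) (hm : m ≤ 2 ^ K) (hα : 0 ≤ α) (hα1 : α ≤ 1)
    (hB : 0 ≤ B) (hfB : f 0 ≤ B) (hO : O.Valid α) {t₀ : ℕ}
    (ht₀ : t₀ = n * stepsPerJob m (K + 3) (K + 1)) (v : Fin m → ℝ) (hv : v ∈ orthant m)
    (hvB : f v ≤ B) (J : Fin m → Finset (Fin n)) (hJM : ∑ i, (J i).card = M)
    (hJd : ∀ i i', i ≠ i' → Disjoint (J i) (J i'))
    (hfree : ∀ i, (J i).Nonempty → ¬ ∀ u, 0 ≤ u → f (Pi.single i u) ≤ B)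
    (hopt : ∀ i u S J', J' ⊆ J i → J' ⊆ S → v i ≤ u → J'.card ≤ O.nopt i u S) :
    α * M ≤ 1536 * ((K + 1) * (K + 3)) *
      ∑ j, (runTo (packScheme K p f B M) O t₀).mass (packScheme K p f B M) O j := by
  classical
  have hp1 := hf.one_le
  have hq : ∀ s, 0 ≤ (packScheme (m := m) K p f B M).q s := fun s => (atomProb_pos K s).le
  have hinv := invariant_runTo (K := K) (M := M) hf hB hfB hO t₀
  have hmass0 : ∀ j, 0 ≤ (runTo (packScheme K p f B M) O t₀).mass (packScheme K p f B M) O j :=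
    fun j => Finset.sum_nonneg fun e _ => mul_nonneg (hq _) (hO.pr_nonneg _ _ _ _ _)
  have hK0 : (0 : ℝ) ≤ K := Nat.cast_nonneg K
  have hM0 : (0 : ℝ) ≤ M := Nat.cast_nonneg M
  have hW0 : 0 ≤ ∑ j, (runTo (packScheme K p f B M) O t₀).mass (packScheme K p f B M) O j :=
    Finset.sum_nonneg fun j _ => hmass0 j
  by_cases hblock : ∃ t ≤ t₀, ∃ e : Atom m (K + 3) (K + 1), (3 / 2 * p) ^ p * B <
      expLoad (seedProb K) f (runTo (packScheme K p f B M) O t).bud +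
        atomProb K e.2 * classCost p B e.2.1
  · obtain ⟨t, ht, e, he⟩ := hblock
    refine (mass_of_blocked hf hm hα hB hfB hO ht e he).trans ?_
    refine mul_le_mul_of_nonneg_right ?_ hW0
    nlinarith
  push Not at hblock
  set st := runTo (packScheme K p f B M) O t₀ with hst
  set W := ∑ j, st.mass (packScheme K p f B M) O j with hWdef
  have hMW : α * M ≤ M := mul_le_of_le_one_left hM0 hα1
  -- the saturated jobs
  set Z := Finset.univ.filter fun j => 1 / 24 ≤ st.mass (packScheme K p f B M) O j with hZ
  have hZW : (Z.card : ℝ) * (1 / 24) ≤ W := by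
    calc (Z.card : ℝ) * (1 / 24) = ∑ _j ∈ Z, (1 / 24 : ℝ) := by simp
      _ ≤ ∑ j ∈ Z, st.mass (packScheme K p f B M) O j :=
          Finset.sum_le_sum fun j hj => (Finset.mem_filter.1 hj).2
      _ ≤ W := Finset.sum_le_univ_sum_of_nonneg hmass0
  -- With `M/8` saturated jobs the mass is already at least `M / (8 * 24)`.
  by_cases hZM : (M : ℝ) / 8 ≤ Z.card
  · have h1 : (M : ℝ) ≤ 192 * W := by linarith
    have h2 : 192 * W ≤ 1536 * ((K + 1) * (K + 3)) * W :=
      mul_le_mul_of_nonneg_right (by nlinarith) hW0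
    linarith
  push Not at hZM
  have hprice0 : ∀ i, 0 ≤ price (seedProb K) f st.bud i (v i) := fun i => by
    refine prodExp_nonneg (fun s => (seedProb_pos K s).le) fun σ => sub_nonneg.2 ?_
    have hy := seedLoad_mem hinv.bud_nonneg σ
    exact hf.monotone (update_mem_orthant hy i le_rfl) (update_mem_orthant hy i (hv i))
      (Function.update_mono (hv i))
  have hprice := sum_price_le hf (fun s => (seedProb_pos K s).le) (sum_seedProb K)
    hinv.bud_nonneg (by linarith) hinv.expLoad_le hv hvB
  set D := (3 / 2 * p + 1) ^ p * B with hD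
  have hD0 : 0 ≤ D := mul_nonneg (Real.rpow_nonneg (by linarith) _) hB
  -- the machines that complete all levels of the class of the right size
  let Good : Fin m → Fin (K + 3) → Prop := fun i κ =>
    (J i).card * 2 ^ (κ : ℕ) ≤ M ∧ st.Completed (packScheme K p f B M) O (i, (κ, Fin.last K))
  -- The four terms cover machines with too few jobs for any class, overpriced machines, machines
  -- with at least half of their jobs saturated, and machines that complete all levels.
  have hcase : ∀ i, ((J i).card : ℝ) ≤ M / 2 ^ (K + 3) +
      M / (4 * D) * price (seedProb K) f st.bud i (v i) + 2 * ((J i) ∩ Z).card +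
      (if ∃ κ, Good i κ then ((J i).card : ℝ) else 0) := by
    intro i
    have x1 : (0 : ℝ) ≤ M / 2 ^ (K + 3) := by positivity
    have x2 : 0 ≤ M / (4 * D) * price (seedProb K) f st.bud i (v i) :=
      mul_nonneg (by positivity) (hprice0 i)
    have x3 : (0 : ℝ) ≤ 2 * ((J i) ∩ Z).card := by positivity
    have x4 : (0 : ℝ) ≤ if ∃ κ, Good i κ then ((J i).card : ℝ) else 0 := by
      split_ifs <;> positivity
    by_contra! hlt
    have hcM : (J i).card ≤ M := hJM ▸ Finset.single_le_sum (f := fun i => (J i).card)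
      (fun _ _ => Nat.zero_le _) (Finset.mem_univ i)
    have h1 : (M : ℝ) / 2 ^ (K + 3) < (J i).card := by linarith
    rw [div_lt_iff₀ (by positivity)] at h1
    obtain ⟨κ, hκ1, hκ2⟩ := exists_size_class hcM (by exact_mod_cast h1)
    have hκ1' : (M : ℝ) < (J i).card * 2 ^ ((κ : ℕ) + 1) := by exact_mod_cast hκ1
    have hκ2' : ((J i).card : ℝ) * 2 ^ (κ : ℕ) ≤ M := by exact_mod_cast hκ2
    have hne : (J i).Nonempty := by
      rw [← Finset.card_pos]
      rcases Nat.eq_zero_or_pos (J i).card with h | h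
      · rw [h] at hκ1; simp at hκ1
      · exact h
    have haff : v i ∈ affordable (seedProb K) f B st.bud i (classCost p B κ) := by
      refine ⟨hv i, ?_, (hf.monotone (single_mem_orthant (hv i)) hv ?_).trans hvB⟩
      · by_contra! hbad
        have hle : price (seedProb K) f st.bud i (v i) ≤ D :=
          (Finset.single_le_sum (f := fun i => price (seedProb K) f st.bud i (v i))
            (fun i _ => hprice0 i) (Finset.mem_univ i)).trans hprice
        -- A machine can be overpriced only if `D > 0`, so the quotient `M / (4 * D)` is meaningful
        -- where it is used.
        have hDpos : 0 < D := ((classCost_nonneg hp1 hB κ).trans_lt hbad).trans_le hle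
        rw [classCost, ← hD, div_lt_iff₀ (by positivity)] at hbad
        have h2 : ((J i).card : ℝ) * (2 ^ (κ : ℕ) * (4 * D)) ≤
            M * (price (seedProb K) f st.bud i (v i) * 2 ^ (κ : ℕ)) := by
          rw [← mul_assoc]
          exact mul_le_mul hκ2' hbad.le (by positivity) hM0
        have h3 : ((J i).card : ℝ) ≤ M / (4 * D) * price (seedProb K) f st.bud i (v i) := by
          rw [div_mul_eq_mul_div, le_div_iff₀ (by positivity)]
          have h4 : (0 : ℝ) < 2 ^ (κ : ℕ) := by positivity
          refine le_of_mul_le_mul_right ?_ h4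
          linarith
        linarith
      · intro l
        by_cases h : l = i
        · subst h; simp
        · rw [Pi.single_eq_of_ne h]; exact hv l
    have hcard : (M : ℝ) / 2 ^ ((κ : ℕ) + 2) < (J i \ Z).card := by
      have h2 : ((J i ∩ Z).card : ℝ) + (J i \ Z).card = (J i).card := by
        exact_mod_cast Finset.card_inter_add_card_sdiff (J i) Z
      have h3 : ((J i).card : ℝ) < 2 * (J i \ Z).card := by linarith
      rw [div_lt_iff₀ (by positivity)]
      calc (M : ℝ) < (J i).card * 2 ^ ((κ : ℕ) + 1) := hκ1'
        _ ≤ (2 * (J i \ Z).card) * 2 ^ ((κ : ℕ) + 1) := by gcongr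
        _ = _ := by ring
    have hcomp := completed_of_affordable hf hB hfB hO ht₀ (i := i) (κ := κ) (M := M) ?_ haff
      (J i \ Z) ?_ (fun u S J' h h' hu => hopt i u S J' (h.trans Finset.sdiff_subset) h' hu)
      hcard (Fin.last K)
    · have hg : ∃ κ, Good i κ := ⟨κ, hκ2, hcomp⟩
      rw [if_pos hg] at hlt
      linarith
    · intro t ht k
      rw [pickBudget, if_pos ⟨hblock t ht _, bddAbove_affordable hf _ _ (hfree i hne)⟩]
      exact Option.some_ne_none _
    · intro j hj
      have := (Finset.mem_sdiff.1 hj).2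
      simpa [hZ] using this
  -- the gain of these machines
  have hgood : α * ∑ i, (if ∃ κ, Good i κ then ((J i).card : ℝ) else 0) ≤
      576 * ((K + 1) * (K + 3)) * W := by
    rw [← Finset.sum_filter]
    set F := Finset.univ.filter fun i => ∃ κ, Good i κ with hF
    have hex : ∀ i ∈ F, ∃ κ, Good i κ := fun i hi => (Finset.mem_filter.1 hi).2
    choose! κ hκ using hex
    have hinj : Set.InjOn (fun i => (i, (κ i, Fin.last K))) F := fun i _ i' _ h => by
      simpa using congrArg Prod.fst h
    have hW := sum_completed_le_mass hO hq hinv.bud_nonneg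
      (F.image fun i => (i, (κ i, Fin.last K))) (by
        intro e he
        obtain ⟨i, hi, rfl⟩ := Finset.mem_image.1 he
        exact (hκ i hi).2)
    rw [Finset.sum_image hinj] at hW
    refine le_trans ?_ (mul_le_mul_of_nonneg_left hW
      (show (0 : ℝ) ≤ 576 * ((K + 1) * (K + 3)) by positivity))
    rw [Finset.mul_sum, Finset.mul_sum]
    refine Finset.sum_le_sum fun i hi => ?_
    have h1 : ((J i).card : ℝ) ≤ M / 2 ^ (κ i : ℕ) := by
      rw [le_div_iff₀ (by positivity)]
      exact_mod_cast (hκ i hi).1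
    change _ ≤ 576 * ((K + 1) * (K + 3)) *
      (atomProb K (κ i, Fin.last K) * (α * classTarget M K (κ i)))
    -- Here `576 = 144 * 4`: the top level cancels `2^K` in the probability, and the target
    -- contributes `2^2`.
    calc α * ((J i).card : ℝ) ≤ α * (M / 2 ^ (κ i : ℕ)) := by gcongr
      _ = 576 * ((K + 1) * (K + 3)) * (atomProb K (κ i, Fin.last K) *
          (α * ((M : ℝ) / (2 ^ ((κ i : ℕ) + 2) * (K + 1))))) := by
          rw [atomProb, pow_add]
          simp only [Fin.val_last]
          field_simp
          ring
      _ ≤ _ := by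
          have := (atomProb_pos K (κ i, Fin.last K)).le
          gcongr
          exact le_classTarget _ _ _
  have hsum := Finset.sum_le_sum fun i (_ : i ∈ Finset.univ) => hcase i
  have htaken : ∑ i, (((J i) ∩ Z).card : ℝ) ≤ Z.card := by
    have h1 : ∑ i, ((J i) ∩ Z).card ≤ Z.card := by
      rw [← Finset.card_biUnion]
      · exact Finset.card_le_card (Finset.biUnion_subset.2 fun i _ => Finset.inter_subset_right)
      · intro i _ i' _ h
        exact (hJd i i' h).mono Finset.inter_subset_left Finset.inter_subset_left
    exact_mod_cast h1
  have hsmall : (m : ℝ) * (M / 2 ^ (K + 3)) ≤ M / 8 := by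
    have hK' : (m : ℝ) ≤ 2 ^ K := by exact_mod_cast hm
    calc (m : ℝ) * (M / 2 ^ (K + 3)) ≤ 2 ^ K * (M / 2 ^ (K + 3)) := by gcongr
      _ = M / 8 := by rw [pow_add]; field_simp; norm_num
  have hineff : M / (4 * D) * ∑ i, price (seedProb K) f st.bud i (v i) ≤ M / 4 := by
    refine (mul_le_mul_of_nonneg_left hprice (by positivity)).trans ?_
    -- For `D = 0` the division by `0` gives `0` and the bound is trivial.
    rcases hD0.eq_or_lt with h | h
    · rw [← h]; simp; positivity
    · apply le_of_eq; field_simp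
  simp only [Finset.sum_add_distrib, ← Finset.mul_sum, Finset.sum_const, Finset.card_univ,
    Fintype.card_fin, nsmul_eq_mul] at hsum
  have hJM' : ∑ i, ((J i).card : ℝ) = M := by exact_mod_cast hJM
  set G := ∑ i, (if ∃ κ, Good i κ then ((J i).card : ℝ) else 0)
  -- The losses are `M/8` for small machines, `M/4` for overpriced ones and `2 * M/8` for saturated
  -- ones; finally `576 * 8/3 = 1536`.
  have hG : 3 / 8 * (M : ℝ) ≤ G := by linarith
  have h1 : α * (3 / 8 * M) ≤ α * G := mul_le_mul_of_nonneg_left hG hα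
  linarith

end FractionalValue
/-! ### The oracle given by Norm-Packing algorithms -/

instance OnlineAlg.instMeasurableSpace {m n r : ℕ} (A : OnlineAlg m n r) : MeasurableSpace A.Ω :=
  A.mΩ

instance OnlineAlg.instIsProbabilityMeasure {m n r : ℕ} (A : OnlineAlg m n r) :
    MeasureTheory.IsProbabilityMeasure A.μ :=
  A.prob

/-- The probability that job `j` is scheduled. -/
def OnlineAlg.acceptProb {m n r : ℕ} (A : OnlineAlg m n r) (I : JobSeq m n r) (j : Fin n) : ℝ :=
  A.μ.real {ω | (A.run ω I j).isSome = true}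

theorem OnlineAlg.measurableSet_accept {m n r : ℕ} (A : OnlineAlg m n r) (I : JobSeq m n r)
    (j : Fin n) : MeasurableSet {ω | (A.run ω I j).isSome = true} := by
  have : {ω | (A.run ω I j).isSome = true} = {ω | A.run ω I j = none}ᶜ := by
    ext ω
    simp [Option.isSome_iff_ne_none]
  rw [this]
  exact (A.meas I j none).compl

theorem OnlineAlg.expectedValue_eq {m n r : ℕ} (A : OnlineAlg m n r) (I : JobSeq m n r) :
    A.expectedValue I = ∑ j, A.acceptProb I j := by
  have h : ∀ ω, (numScheduled (A.run ω I) : ℝ) =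
      ∑ j, Set.indicator {ω | (A.run ω I j).isSome = true} (fun _ => (1 : ℝ)) ω := by
    intro ω
    simp [numScheduled, Set.indicator_apply, Finset.sum_boole]
  rw [OnlineAlg.expectedValue]
  simp only [h]
  rw [MeasureTheory.integral_finsetSum]
  · refine Finset.sum_congr rfl fun j _ => ?_
    rw [MeasureTheory.integral_indicator_const _ (A.measurableSet_accept I j)]
    simp [OnlineAlg.acceptProb]
  · exact fun j _ => (MeasureTheory.integrable_const 1).indicator (A.measurableSet_accept I j)

section Restrict

variable {m n r : ℕ}

/-- The jobs in `S`, seen from machine `i`. -/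
def restrictTo (I : JobSeq m n r) (i : Fin m) (S : Finset (Fin n)) : JobSeq 1 n r :=
  -- Jobs outside `S` keep their position but lose all their ways, so the norm needs no reindexing.
  fun j _ k => if j ∈ S then I j i k else ⊤

theorem restrictTo_congr {I I' : JobSeq m n r} {i : Fin m} {S S' : Finset (Fin n)} {j : Fin n}
    (hI : ∀ l ≤ j, I l = I' l) (hS : ∀ l ≤ j, l ∈ S ↔ l ∈ S') :
    ∀ l ≤ j, restrictTo I i S l = restrictTo I' i S' l := by
  intro l hl
  funext _ k
  simp only [restrictTo, hI l hl, hS l hl]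

theorem mem_of_admissible {I : JobSeq m n r} {i : Fin m} {S : Finset (Fin n)}
    {y : PartialAlloc 1 n r} (hy : Admissible (restrictTo I i S) y) {j : Fin n} {d : Fin 1 × Fin r}
    (h : y j = some d) : j ∈ S := by
  by_contra hj
  exact hy j d.1 d.2 h (by simp [restrictTo, hj])

/-- The Norm-Packing optimum of machine `i` on the jobs in `S`. -/
def normOpt (N : Fin m → Seminorm ℝ (Fin n × Fin r → ℝ)) (I : JobSeq m n r) (i : Fin m) (u : ℝ)
    (S : Finset (Fin n)) : ℕ :=
  opt (fun z => z 0) (fun _ => N i) u (restrictTo I i S)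

theorem le_normOpt_of_admissible {N : Fin m → Seminorm ℝ (Fin n × Fin r → ℝ)} {I : JobSeq m n r}
    {i : Fin m} {u : ℝ} {S S' : Finset (Fin n)} (hS : S ⊆ S') {y : PartialAlloc 1 n r}
    (hy : Admissible (restrictTo I i S) y)
    (hu : loads (fun _ => N i) (restrictTo I i S) y 0 ≤ u) :
    numScheduled y ≤ normOpt N I i u S' := by
  classical
  have hval : ∀ j k, y j = some (0, k) → restrictTo I i S' j 0 k = restrictTo I i S j 0 k := by
    intro j k h
    have := mem_of_admissible hy h
    simp [restrictTo, this, hS this]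
  refine Finset.le_sup (f := numScheduled) (Finset.mem_filter.2 ⟨Finset.mem_univ y, ?_, ?_⟩)
  · intro j i' k h
    have hi' : i' = 0 := Subsingleton.elim _ _
    subst hi'
    rw [hval j k h]
    exact hy j 0 k h
  · convert hu using 1
    simp only [loads]
    congr 1
    funext jk
    split_ifs with h
    · rw [hval _ _ h]
    · rfl

theorem normOpt_mono (N : Fin m → Seminorm ℝ (Fin n × Fin r → ℝ)) (I : JobSeq m n r) (i : Fin m)
    (u : ℝ) {S S' : Finset (Fin n)} (hS : S ⊆ S') : normOpt N I i u S ≤ normOpt N I i u S' := by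
  classical
  refine Finset.sup_le fun y hy => ?_
  have h := (Finset.mem_filter.1 hy).2
  exact le_normOpt_of_admissible hS h.1 h.2

/-- The jobs that an allocation puts on machine `i`. -/
def jobsOn (x : PartialAlloc m n r) (i : Fin m) : Finset (Fin n) :=
  Finset.univ.filter fun j => (x j).map Prod.fst = some i

/-- Keeping only the jobs of `J` and reading machine `i` as the single machine gives a feasible
packing, since the norm is monotone. -/
theorem card_le_normOpt {N : Fin m → Seminorm ℝ (Fin n × Fin r → ℝ)} {I : JobSeq m n r}
    {i : Fin m} (hN : IsMonotoneNorm (N i)) {x : PartialAlloc m n r} (hx : Admissible I x)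
    {u : ℝ} (hu : loads N I x i ≤ u) {S J : Finset (Fin n)} (hJ : J ⊆ jobsOn x i) (hS : J ⊆ S) :
    J.card ≤ normOpt N I i u S := by
  classical
  let y : PartialAlloc 1 n r := fun j => if j ∈ J then (x j).map fun d => (0, d.2) else none
  have hxy : ∀ j d, y j = some d → j ∈ J ∧ x j = some (i, d.2) := by
    intro j d h
    by_cases hj : j ∈ J
    · refine ⟨hj, ?_⟩
      have h1 := (Finset.mem_filter.1 (hJ hj)).2
      simp only [y, if_pos hj] at h
      rcases hxj : x j with _ | ⟨i', k⟩
      · simp [hxj] at h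
      · simp only [hxj, Option.map_some, Option.some.injEq] at h h1
        rw [← h, ← h1]
    · simp [y, hj] at h
  have hcard : J.card = numScheduled y := by
    rw [numScheduled]
    congr 1
    ext j
    simp only [Finset.mem_filter, Finset.mem_univ, true_and]
    constructor
    · intro hj
      have h1 := (Finset.mem_filter.1 (hJ hj)).2
      rcases hxj : x j with _ | ⟨i', k⟩
      · simp [hxj] at h1
      · simp [y, hj, hxj]
    · intro h
      obtain ⟨d, hd⟩ := Option.isSome_iff_exists.1 h
      exact (hxy j d hd).1
  rw [hcard]
  refine le_normOpt_of_admissible subset_rfl ?_ (le_trans ?_ hu)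
  · intro j i' k h
    obtain ⟨h1, h2⟩ := hxy j _ h
    simpa [restrictTo, hS h1] using hx j i k h2
  · refine hN.monotone _ _ (fun jk => ?_) (fun jk => ?_)
    · simp only [Pi.zero_apply]; split_ifs
      · exact ENNReal.toReal_nonneg
      · exact le_rfl
    · by_cases h : y jk.1 = some (0, jk.2)
      · obtain ⟨h1, h2⟩ := hxy _ _ h
        simp only [if_pos h, if_pos h2, restrictTo, if_pos (hS h1), le_refl]
      · simp only [if_neg h]; split_ifs
        · exact ENNReal.toReal_nonneg
        · exact le_rfl

end Restrict

/-- A family of Norm-Packing algorithms, one for every machine, budget and target. -/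
abbrev AlgFamily (m n r : ℕ) : Type 1 := Fin m → ℝ → ℕ → OnlineAlg 1 n r

section Family

variable {m n r : ℕ} {N : Fin m → Seminorm ℝ (Fin n × Fin r → ℝ)} {α c : ℝ}

structure AlgFamily.Solves (A : AlgFamily m n r) (N : Fin m → Seminorm ℝ (Fin n × Fin r → ℝ))
    (α c : ℝ) : Prop where
  admissible : ∀ i u w I ω, Admissible I ((A i u w).run ω I)
  load_le : ∀ i u w I ω, 0 ≤ u → loads (fun _ => N i) I ((A i u w).run ω I) 0 ≤ c * u
  value : ∀ i u w I, 0 ≤ u → w ≤ opt (fun z => z 0) (fun _ => N i) u I →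
    α * w ≤ (A i u w).expectedValue I

theorem exists_algFamily (h : ∀ i, NormPackSolvable (N i) α c) :
    ∃ A : AlgFamily m n r, A.Solves N α c := by
  -- Solvability concerns nonnegative budgets; replacing `u` by `max u 0` makes the family total.
  have h1 : ∀ (i : Fin m) (u : ℝ) (w : ℕ), ∃ A : OnlineAlg 1 n r, ∀ I : JobSeq 1 n r,
      (∀ ω, Admissible I (A.run ω I) ∧
        loads (fun _ => N i) I (A.run ω I) 0 ≤ c * max u 0) ∧
      ((w : ℝ) ≤ (opt (fun z => z 0) (fun _ => N i) (max u 0) I : ℝ) →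
        α * w ≤ A.expectedValue I) := fun i u w =>
    (h i).2.2.2 (max u 0) (le_max_right _ _) (le_max_right _ _) w
  choose A hA using h1
  refine ⟨A, fun i u w I ω => ((hA i u w I).1 ω).1, fun i u w I ω hu => ?_,
    fun i u w I hu hw => ?_⟩
  · have := ((hA i u w I).1 ω).2
    rwa [max_eq_left hu] at this
  · refine (hA i u w I).2 ?_
    rw [max_eq_left hu]
    exact_mod_cast hw

def packOracle (A : AlgFamily m n r) (N : Fin m → Seminorm ℝ (Fin n × Fin r → ℝ))
    (I : JobSeq m n r) : Oracle m n where
  pr := fun i u w S j => (A i u w).acceptProb (restrictTo I i S) j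
  nopt := normOpt N I

theorem acceptProb_congr {m n r : ℕ} (A : OnlineAlg m n r) {I I' : JobSeq m n r} {j : Fin n}
    (h : ∀ l ≤ j, I l = I' l) : A.acceptProb I j = A.acceptProb I' j := by
  rw [OnlineAlg.acceptProb, OnlineAlg.acceptProb]
  congr 1
  ext ω
  simp only [Set.mem_ofPred_eq, A.online ω I I' j h]

theorem packOracle_valid {A : AlgFamily m n r} (hA : A.Solves N α c) (I : JobSeq m n r) :
    (packOracle A N I).Valid α where
  pr_nonneg := fun _ _ _ _ _ => MeasureTheory.measureReal_nonneg
  pr_le_one := fun _ _ _ _ _ => MeasureTheory.measureReal_le_one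
  pr_notMem := fun i u w S j hj => by
    have : {ω | ((A i u w).run ω (restrictTo I i S) j).isSome = true} = ∅ := by
      ext ω
      simp only [Set.mem_ofPred_eq, Set.mem_empty_iff_false, iff_false]
      intro h
      obtain ⟨d, hd⟩ := Option.isSome_iff_exists.1 h
      exact hj (mem_of_admissible (hA.admissible i u w _ ω) hd)
    simp only [packOracle, OnlineAlg.acceptProb, this, MeasureTheory.measureReal_empty]
  pr_insert := fun i u w S j l hjl => acceptProb_congr _ (restrictTo_congr (fun _ _ => rfl)
    fun l' hl' => by simp [(hl'.trans_lt hjl).ne])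
  nopt_mono := fun i u S S' h => normOpt_mono N I i u h
  gain := fun i u w S hu hw => by
    have := hA.value i u w _ hu hw
    rwa [OnlineAlg.expectedValue_eq] at this

theorem restrictTo_eq_of_le {I I' : JobSeq m n r} {j : Fin n} (hI : ∀ l ≤ j, I l = I' l)
    (i : Fin m) {S : Finset (Fin n)} (hS : ∀ l ∈ S, l ≤ j) :
    restrictTo I i S = restrictTo I' i S := by
  funext l _ k
  by_cases h : l ∈ S
  · simp [restrictTo, h, hI l (hS l h)]
  · simp [restrictTo, h]

theorem runTo_packOracle_congr {a L : ℕ} (P : Scheme m a L) (A : AlgFamily m n r)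
    {I I' : JobSeq m n r} {j : Fin n} (hI : ∀ l ≤ j, I l = I' l) :
    runTo P (packOracle A N I) (stepsPerJob m a L * (j + 1)) =
      runTo P (packOracle A N I') (stepsPerJob m a L * (j + 1)) := by
  refine runTo_congr (j := j) (fun i u w S hS => ?_) (fun i u S hS => ?_) le_rfl
  · simp only [packOracle, restrictTo_eq_of_le hI i hS]
  · simp only [packOracle, normOpt, restrictTo_eq_of_le hI i hS]

end Family
/-! ### Probability estimates for the rounding -/

section Estimates

variable {ι T : Type*} [Fintype ι] [DecidableEq ι] [Fintype T] {q : T → ℝ}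

open Classical in
/-- Markov's inequality, in a form that also covers the threshold `0`. -/
theorem prodExp_markov (hq : ∀ t, 0 < q t) {g : (ι → T) → ℝ} (hg : ∀ σ, 0 ≤ g σ) {b δ : ℝ}
    (hb : 0 ≤ b) (hδ : 0 ≤ δ) (h : prodExp q g ≤ δ * b) :
    prodExp q (fun σ => if b < g σ then 1 else 0) ≤ δ := by
  -- At threshold `0` the expectation of `g` is `0`; since all weights are strictly positive, `g`
  -- vanishes everywhere.
  rcases hb.eq_or_lt with rfl | hb
  · rw [mul_zero] at h
    have hw : ∀ σ : ι → T, 0 < ∏ i, q (σ i) := fun σ => Finset.prod_pos fun i _ => hq _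
    have h0 := (Finset.sum_eq_zero_iff_of_nonneg fun σ _ => mul_nonneg (hw σ).le (hg σ)).1
      (le_antisymm h (Finset.sum_nonneg fun σ _ => mul_nonneg (hw σ).le (hg σ)))
    have h1 : ∀ σ, ¬ 0 < g σ := fun σ => by
      have := h0 σ (Finset.mem_univ σ)
      rcases mul_eq_zero.1 this with h2 | h2
      · exact absurd h2 (hw σ).ne'
      · exact h2.not_gt
    simpa [h1, prodExp] using hδ
  · have h1 : prodExp q (fun σ => if b < g σ then 1 else 0) ≤ prodExp q (fun σ => b⁻¹ * g σ) := by
      refine prodExp_mono (fun t => (hq t).le) fun σ => ?_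
      split_ifs with h2
      · rw [inv_mul_eq_div, le_div_iff₀ hb]; linarith
      · exact mul_nonneg (by positivity) (hg σ)
    rw [prodExp_mul_left] at h1
    refine h1.trans ?_
    rw [inv_mul_eq_div, div_le_iff₀ hb]
    exact h

open Classical in
/-- A job that is accepted by machine `i` with probability `a i (σ i)` is accepted by exactly one
machine, and without a bad event, with probability at least a twelfth of its mass. -/
theorem prodExp_collision (hq : ∀ t, 0 ≤ q t) (hq1 : ∑ t, q t = 1) {a : ι → T → ℝ}
    (ha : ∀ i t, 0 ≤ a i t) (bad : (ι → T) → Prop)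
    (hbad : ∀ i t, prodExp q (fun σ => if bad (Function.update σ i t) then 1 else 0) ≤ 5 / 6)
    (hmass : ∑ i, ∑ t, q t * a i t ≤ 1 / 12) :
    (∑ i, ∑ t, q t * a i t) / 12 ≤ prodExp q fun σ => if bad σ then 0 else
      ∑ i, a i (σ i) - ∑ i, ∑ l ∈ Finset.univ.erase i, a i (σ i) * a l (σ l) := by
  set μ : ι → ℝ := fun i => ∑ t, q t * a i t with hμ
  have hμ0 : ∀ i, 0 ≤ μ i := fun i => Finset.sum_nonneg fun t _ => mul_nonneg (hq t) (ha i t)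
  -- The bad event depends on the seed of machine `i`. Fixing that seed and using the conditional
  -- bound `hbad` replaces independence.
  have h1 : ∀ i, prodExp q (fun σ => (if bad σ then 1 else 0) * a i (σ i)) ≤ 5 / 6 * μ i := by
    intro i
    rw [prodExp_update hq1 i, hμ, Finset.mul_sum]
    refine Finset.sum_le_sum fun t _ => ?_
    have : prodExp q (fun σ => (if bad (Function.update σ i t) then (1 : ℝ) else 0) *
        a i (Function.update σ i t i)) =
        a i t * prodExp q (fun σ => if bad (Function.update σ i t) then 1 else 0) := by
      rw [← prodExp_mul_left]
      congr 1
      funext σ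
      rw [Function.update_self, mul_comm]
    rw [this]
    nlinarith [mul_le_mul_of_nonneg_left (hbad i t) (mul_nonneg (hq t) (ha i t))]
  have h2 : ∀ i, ∑ l ∈ Finset.univ.erase i, prodExp q (fun σ => a i (σ i) * a l (σ l)) ≤
      μ i * ∑ l, μ l := by
    intro i
    rw [Finset.mul_sum]
    refine le_trans (Finset.sum_le_sum fun l hl => ?_)
      (Finset.sum_le_univ_sum_of_nonneg (s := Finset.univ.erase i)
        fun l => mul_nonneg (hμ0 i) (hμ0 l))
    rw [prodExp_coord_mul hq1 (Finset.ne_of_mem_erase hl).symm]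
  have h3 : prodExp q (fun σ => ∑ i, a i (σ i) - ∑ i, (if bad σ then 1 else 0) * a i (σ i) -
      ∑ i, ∑ l ∈ Finset.univ.erase i, a i (σ i) * a l (σ l)) ≤
      prodExp q fun σ => if bad σ then 0 else
        ∑ i, a i (σ i) - ∑ i, ∑ l ∈ Finset.univ.erase i, a i (σ i) * a l (σ l) := by
    refine prodExp_mono hq fun σ => ?_
    have : 0 ≤ ∑ i, ∑ l ∈ Finset.univ.erase i, a i (σ i) * a l (σ l) :=
      Finset.sum_nonneg fun i _ => Finset.sum_nonneg fun l _ => mul_nonneg (ha _ _) (ha _ _)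
    split_ifs
    · simp only [one_mul]; linarith
    · simp
  refine le_trans ?_ h3
  rw [prodExp_sub, prodExp_sub, prodExp_sum, prodExp_sum, prodExp_sum]
  simp only [prodExp_sum, prodExp_coord hq1]
  have h4 := Finset.sum_le_sum fun i (_ : i ∈ Finset.univ) => h1 i
  have h5 := Finset.sum_le_sum fun i (_ : i ∈ Finset.univ) => h2 i
  rw [← Finset.mul_sum] at h4
  rw [← Finset.sum_mul] at h5
  have h6 : 0 ≤ ∑ i, μ i := Finset.sum_nonneg fun i _ => hμ0 i
  change (∑ i, μ i) / 12 ≤ ∑ i, μ i - _ - _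
  -- The remaining fraction is `1 - 5/6 - 1/12 = 1/12`.
  nlinarith [mul_le_mul_of_nonneg_left hmass h6]

end Estimates

/-! ### Bonferroni's inequality, finite mixtures and infinite products. -/

section Measure

open MeasureTheory

/-- The second Bonferroni inequality. -/
theorem bonferroni {Ω ι : Type*} [MeasurableSpace Ω] [Fintype ι] [DecidableEq ι] (μ : Measure Ω)
    [IsProbabilityMeasure μ] {s : ι → Set Ω} (hs : ∀ i, MeasurableSet (s i)) :
    ∑ i, μ.real (s i) - ∑ i, ∑ l ∈ Finset.univ.erase i, μ.real (s i ∩ s l) ≤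
      μ.real (⋃ i, s i) := by
  classical
  have hint : ∀ t : Set Ω, MeasurableSet t → Integrable (t.indicator fun _ => (1 : ℝ)) μ :=
    fun t ht => (integrable_const 1).indicator ht
  have hre : ∀ t : Set Ω, MeasurableSet t → μ.real t = ∫ ω, t.indicator (fun _ => (1 : ℝ)) ω ∂μ :=
    fun t ht => by rw [integral_indicator_const _ ht]; simp
  rw [hre _ (MeasurableSet.iUnion hs)]
  simp only [fun i => hre _ (hs i), fun i l => hre _ ((hs i).inter (hs l))]
  rw [← integral_finsetSum _ fun i _ => hint _ (hs i)]
  simp only [fun i => (integral_finsetSum (μ := μ) (Finset.univ.erase i)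
    (f := fun l => (s i ∩ s l).indicator fun _ => (1 : ℝ))
    (fun l _ => hint _ ((hs i).inter (hs l)))).symm]
  rw [← integral_finsetSum, ← integral_sub]
  · refine integral_mono ?_ (hint _ (MeasurableSet.iUnion hs)) fun ω => ?_
    · exact (integrable_finsetSum _ fun i _ => hint _ (hs i)).sub (integrable_finsetSum _
        fun i _ => integrable_finsetSum _ fun l _ => hint _ ((hs i).inter (hs l)))
    · simp only [Set.indicator_apply, Set.mem_inter_iff, Set.mem_iUnion]
      by_cases h : ∃ i, ω ∈ s i
      · rw [if_pos h]
        obtain ⟨i, hi⟩ := h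
        -- If `ω` lies in `x` of the sets, ordered pairs give `x - x(x-1)`, which is at most `1`
        -- because `(x-1)^2 ≥ 0`.
        have h1 : ∀ i, (∑ l ∈ Finset.univ.erase i, if ω ∈ s i ∧ ω ∈ s l then (1 : ℝ) else 0) =
            (if ω ∈ s i then 1 else 0) * ((∑ l, if ω ∈ s l then (1 : ℝ) else 0) - 1) := by
          intro i
          by_cases hi : ω ∈ s i
          · rw [← Finset.add_sum_erase _ _ (Finset.mem_univ i)]
            simp [hi]
          · simp [hi]
        simp only [h1, ← Finset.sum_mul]
        have h2 : (1 : ℝ) ≤ ∑ l, if ω ∈ s l then (1 : ℝ) else 0 := by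
          have := Finset.single_le_sum (f := fun l => if ω ∈ s l then (1 : ℝ) else 0)
            (fun l _ => by positivity) (Finset.mem_univ i)
          simpa [hi] using this
        nlinarith [mul_nonneg (sub_nonneg.2 h2) (sub_nonneg.2 h2)]
      · push Not at h
        simp [h]
  · exact integrable_finsetSum _ fun i _ => hint _ (hs i)
  · exact integrable_finsetSum _
        fun i _ => integrable_finsetSum _ fun l _ => hint _ ((hs i).inter (hs l))
  · exact fun i _ => integrable_finsetSum _ fun l _ => hint _ ((hs i).inter (hs l))

section FiniteMixture

variable {T Ω : Type*} [Fintype T] [MeasurableSpace Ω]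

/-- The measure on `T` with weights `P`, on the discrete sigma-algebra. -/
def weightMeasure (P : T → ℝ) : @Measure T ⊤ :=
  letI : MeasurableSpace T := ⊤
  ∑ t, ENNReal.ofReal (P t) • Measure.dirac t

theorem isProbabilityMeasure_weightMeasure {P : T → ℝ} (hP : ∀ t, 0 ≤ P t) (h1 : ∑ t, P t = 1) :
    @IsProbabilityMeasure T ⊤ (weightMeasure P) := by
  let _ : MeasurableSpace T := ⊤
  refine ⟨?_⟩
  simp only [weightMeasure, Measure.finsetSum_apply, Measure.smul_apply, measure_univ,
    smul_eq_mul, mul_one]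
  rw [← ENNReal.ofReal_sum_of_nonneg fun t _ => hP t, h1, ENNReal.ofReal_one]

theorem measurableSet_of_slices {s : Set (T × Ω)} (h : ∀ t, MeasurableSet {ω | (t, ω) ∈ s}) :
    @MeasurableSet _ (@Prod.instMeasurableSpace T Ω ⊤ _) s := by
  let _ : MeasurableSpace T := ⊤
  have : s = ⋃ t, {t} ×ˢ {ω | (t, ω) ∈ s} := by
    ext ⟨t, ω⟩
    simp
  rw [this]
  exact MeasurableSet.iUnion fun t => (measurableSet_singleton t).prod (h t)

theorem weightMeasure_prod_real {P : T → ℝ} (hP : ∀ t, 0 ≤ P t) (μ : Measure Ω)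
    [IsProbabilityMeasure μ] {s : Set (T × Ω)} (h : ∀ t, MeasurableSet {ω | (t, ω) ∈ s}) :
    (@Measure.prod T Ω ⊤ _ (weightMeasure P) μ).real s =
      ∑ t, P t * μ.real {ω | (t, ω) ∈ s} := by
  let _ : MeasurableSpace T := ⊤
  have hs := measurableSet_of_slices h
  rw [Measure.real, Measure.prod_apply hs, weightMeasure, lintegral_finsetSum_measure]
  simp only [lintegral_smul_measure, lintegral_dirac, smul_eq_mul]
  rw [ENNReal.toReal_sum fun t _ => ENNReal.mul_ne_top ENNReal.ofReal_ne_top (measure_ne_top _ _)]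
  refine Finset.sum_congr rfl fun t _ => ?_
  rw [ENNReal.toReal_mul, ENNReal.toReal_ofReal (hP t)]
  rfl

end FiniteMixture

theorem infinitePi_real_inter {ι : Type*} {X : ι → Type*} [∀ i, MeasurableSpace (X i)]
    (μ : ∀ i, Measure (X i)) [∀ i, IsProbabilityMeasure (μ i)] {x y : ι} (hxy : x ≠ y)
    {s : Set (X x)} {t : Set (X y)} (hs : MeasurableSet s) (ht : MeasurableSet t) :
    (Measure.infinitePi μ).real ({ω | ω x ∈ s} ∩ {ω | ω y ∈ t}) =
      (μ x).real s * (μ y).real t := by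
  have h : ProbabilityTheory.iIndepFun (fun i (ω : ∀ i, X i) => ω i) (Measure.infinitePi μ) :=
    ProbabilityTheory.iIndepFun_infinitePi (X := fun i (z : X i) => z) fun i => measurable_id
  have h2 := (h.indepFun hxy).measure_inter_preimage_eq_mul s t hs ht
  have hx := (measurePreserving_eval_infinitePi μ x).measure_preimage hs.nullMeasurableSet
  have hy := (measurePreserving_eval_infinitePi μ y).measure_preimage ht.nullMeasurableSet
  change (Measure.infinitePi μ) ((fun ω => ω x) ⁻¹' s ∩ (fun ω => ω y) ⁻¹' t) = _ at h2
  simp only [Measure.real]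
  change ((Measure.infinitePi μ) ((fun ω => ω x) ⁻¹' s ∩ (fun ω => ω y) ⁻¹' t)).toReal = _
  rw [h2, ENNReal.toReal_mul]
  congr 2

theorem infinitePi_real_eval {ι : Type*} {X : ι → Type*} [∀ i, MeasurableSpace (X i)]
    (μ : ∀ i, Measure (X i)) [∀ i, IsProbabilityMeasure (μ i)] {x : ι}
    {s : Set (X x)} (hs : MeasurableSet s) :
    (Measure.infinitePi μ).real {ω | ω x ∈ s} = (μ x).real s := by
  have hx := (measurePreserving_eval_infinitePi μ x).measure_preimage hs.nullMeasurableSet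
  simp only [Measure.real]
  rw [← hx]
  rfl

end Measure

/-! ### The randomized algorithm -/

section Rounding

open MeasureTheory

variable {m n r : ℕ} (K : ℕ) (p : ℝ) (f : (Fin m → ℝ) → ℝ) (B : ℝ) (M : ℕ)
  (A : AlgFamily m n r) (N : Fin m → Seminorm ℝ (Fin n × Fin r → ℝ))

/-- The seed of a machine. -/
abbrev Seed (K : ℕ) : Type := Option (Fin (K + 3) × Fin (K + 1))

/-- The randomness of all Norm-Packing algorithms. -/
abbrev AlgFamily.Rand (A : AlgFamily m n r) : Type :=
  ∀ x : Fin m × ℝ × ℕ, (A x.1 x.2.1 x.2.2).Ω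

/-- The state of the process once job `j` has been processed. -/
def stateAfter (I : JobSeq m n r) (j : Fin n) : State m n (K + 3) (K + 1) :=
  runTo (packScheme K p f B M) (packOracle A N I) (stepsPerJob m (K + 3) (K + 1) * (j + 1))

/-- The way in which machine `i` would schedule job `j`. -/
def offerWay {A : AlgFamily m n r} (st : State m n (K + 3) (K + 1)) (σ : Fin m → Seed K)
    (ω : A.Rand) (I : JobSeq m n r) (j : Fin n) (i : Fin m) : Option (Fin r) :=
  (σ i).elim none fun s =>
    ((A i (st.bud (i, s)) (classTarget M K s.1)).run (ω (i, (st.bud (i, s), classTarget M K s.1)))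
      (restrictTo I i (st.seg (i, s))) j).map Prod.snd

open Classical in
/-- Some machine that would schedule the job. -/
def selectMachine (d : Fin m → Option (Fin r)) : Option (Fin m × Fin r) :=
  if h : ∃ x : Fin m × Fin r, d x.1 = some x.2 then some h.choose else none

theorem selectMachine_eq_some {d : Fin m → Option (Fin r)} {i : Fin m} {k : Fin r}
    (h : selectMachine d = some (i, k)) : d i = some k := by
  rw [selectMachine] at h
  split_ifs at h with hd
  have := hd.choose_spec
  rwa [Option.some.inj h] at this

theorem isSome_selectMachine {d : Fin m → Option (Fin r)} {i : Fin m} (h : (d i).isSome = true) :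
    (selectMachine d).isSome = true := by
  obtain ⟨k, hk⟩ := Option.isSome_iff_exists.1 h
  rw [selectMachine, dif_pos ⟨(i, k), hk⟩]
  rfl

open Classical in
-- The test looks at the opened budgets, not at the actual load. The simulated algorithms ignore
-- rejections, so what is really scheduled on a machine is part of its simulated run.
def roundRun {A : AlgFamily m n r} (σ : Fin m → Seed K) (ω : A.Rand) (I : JobSeq m n r) :
    PartialAlloc m n r := fun j =>
  if (3 * p) ^ p * B < f (seedLoad (stateAfter K p f B M A N I j).bud σ) then none
  else selectMachine (offerWay K M (stateAfter K p f B M A N I j) σ ω I j)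

theorem measurableSet_offerWay {A : AlgFamily m n r} (st : State m n (K + 3) (K + 1))
    (σ : Fin m → Seed K) (I : JobSeq m n r) (j : Fin n) (i : Fin m) (E : Set (Option (Fin r))) :
    MeasurableSet {ω : A.Rand | offerWay K M st σ ω I j i ∈ E} := by
  rcases hs : σ i with _ | s
  · simp only [offerWay, hs, Option.elim_none]
    exact MeasurableSet.const _
  · simp only [offerWay, hs, Option.elim_some]
    let x : Fin m × ℝ × ℕ := (i, (st.bud (i, s), classTarget M K s.1))
    have h1 : MeasurableSet {z : (A x.1 x.2.1 x.2.2).Ω | ((A x.1 x.2.1 x.2.2).run z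
        (restrictTo I i (st.seg (i, s))) j).map Prod.snd ∈ E} := by
      have : {z : (A x.1 x.2.1 x.2.2).Ω | ((A x.1 x.2.1 x.2.2).run z
          (restrictTo I i (st.seg (i, s))) j).map Prod.snd ∈ E} =
          ⋃ d ∈ {d : Option (Fin 1 × Fin r) | d.map Prod.snd ∈ E},
            {z | (A x.1 x.2.1 x.2.2).run z (restrictTo I i (st.seg (i, s))) j = d} := by
        ext z
        simp
      rw [this]
      exact MeasurableSet.biUnion (Set.to_countable _) fun d _ => (A x.1 x.2.1 x.2.2).meas _ _ d
    have h2 : Measurable fun ω : A.Rand => ω x := measurable_pi_apply x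
    exact h2 h1

/-- The algorithm for Schedule-Packing. -/
def packAlg : OnlineAlg m n r where
  Ω := (Fin m → Seed K) × A.Rand
  mΩ := @Prod.instMeasurableSpace (Fin m → Seed K) A.Rand ⊤ _
  μ := @Measure.prod (Fin m → Seed K) A.Rand ⊤ _
    (weightMeasure fun σ => ∏ i, seedProb K (σ i))
    -- The budgets depend on the job sequence, so the randomness for every real budget is drawn in
    -- advance.
    (Measure.infinitePi fun x : Fin m × ℝ × ℕ => (A x.1 x.2.1 x.2.2).μ)
  prob := by
    let _ : MeasurableSpace (Fin m → Seed K) := ⊤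
    have h1 : ∑ σ : Fin m → Seed K, ∏ i, seedProb K (σ i) = 1 := by
      simpa [prodExp] using prodExp_const (ι := Fin m) (sum_seedProb K) 1
    have := isProbabilityMeasure_weightMeasure (P := fun σ : Fin m → Seed K =>
      ∏ i, seedProb K (σ i)) (fun σ => Finset.prod_nonneg fun i _ => (seedProb_pos K _).le) h1
    infer_instance
  run := fun ω I => roundRun K p f B M N ω.1 ω.2 I
  online := by
    intro ω I I' j hI
    have h1 : stateAfter K p f B M A N I j = stateAfter K p f B M A N I' j :=
      runTo_packOracle_congr _ A hI
    have h2 : ∀ st : State m n (K + 3) (K + 1),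
        offerWay K M st ω.1 ω.2 I j = offerWay K M st ω.1 ω.2 I' j := by
      intro st
      funext i
      rcases hs : ω.1 i with _ | s
      · simp [offerWay, hs]
      · simp only [offerWay, hs, Option.elim_some]
        rw [(A _ _ _).online _ _ _ j (restrictTo_congr hI fun _ _ => Iff.rfl)]
    simp only [roundRun, h1, h2]
  meas := by
    intro I j d
    refine measurableSet_of_slices fun σ => ?_
    simp only [Set.mem_ofPred_eq, roundRun]
    split_ifs
    · exact MeasurableSet.const _
    · have : {ω : A.Rand | selectMachine
          (offerWay K M (stateAfter K p f B M A N I j) σ ω I j) = d} =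
          ⋃ D ∈ {D : Fin m → Option (Fin r) | selectMachine D = d}, ⋂ i,
            {ω : A.Rand | offerWay K M (stateAfter K p f B M A N I j) σ ω I j i ∈
              ({D i} : Set (Option (Fin r)))} := by
        ext ω
        simp only [Set.mem_ofPred_eq, Set.mem_iUnion, Set.mem_iInter, Set.mem_singleton_iff,
          exists_prop]
        constructor
        · exact fun h => ⟨_, h, fun i => rfl⟩
        · rintro ⟨D, h, hD⟩
          rwa [show offerWay K M (stateAfter K p f B M A N I j) σ ω I j = D from funext hD]
      rw [this]
      exact MeasurableSet.biUnion (Set.to_countable _) fun D _ =>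
        MeasurableSet.iInter fun i => measurableSet_offerWay K M _ σ I j i _

variable {K p f B M A N} {α c : ℝ}

/-- A scheduled job is scheduled by the Norm-Packing algorithm of its machine, run on the segment
of any later state. -/
theorem roundRun_eq_some (hA : A.Solves N α c) {σ : Fin m → Seed K} {ω : A.Rand}
    {I : JobSeq m n r} {j j' : Fin n} (hj : j ≤ j') {i : Fin m} {k : Fin r}
    (h : roundRun K p f B M N σ ω I j = some (i, k)) :
    ∃ s, σ i = some s ∧
      (A i ((stateAfter K p f B M A N I j').bud (i, s)) (classTarget M K s.1)).run
        (ω (i, ((stateAfter K p f B M A N I j').bud (i, s), classTarget M K s.1)))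
        (restrictTo I i ((stateAfter K p f B M A N I j').seg (i, s))) j = some (0, k) := by
  rw [roundRun] at h
  split_ifs at h
  have h1 := selectMachine_eq_some h
  rcases hs : σ i with _ | s
  · simp [offerWay, hs] at h1
  refine ⟨s, rfl, ?_⟩
  simp only [offerWay, hs, Option.elim_some, Option.map_eq_some_iff] at h1
  obtain ⟨⟨z, k'⟩, h2, h3⟩ := h1
  obtain rfl : z = 0 := Subsingleton.elim _ _
  simp only at h3
  subst h3
  have hle : stepsPerJob m (K + 3) (K + 1) * ((j : ℕ) + 1) ≤
      stepsPerJob m (K + 3) (K + 1) * ((j' : ℕ) + 1) :=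
    Nat.mul_le_mul_left _ (Nat.succ_le_succ (Fin.le_def.1 hj))
  have hmem := mem_of_admissible (hA.admissible _ _ _ _ _) h2
  -- A nonempty segment shows that the atom has been started, hence its budget is final.
  have hstart : (i, s) ∈ (stateAfter K p f B M A N I j).started := by
    by_contra hn
    rw [stateAfter] at hn hmem
    rw [(runTo_not_started _ _ hn).2] at hmem
    simp at hmem
  have hbud : (stateAfter K p f B M A N I j').bud (i, s) =
      (stateAfter K p f B M A N I j).bud (i, s) := (runTo_le hle).bud _ hstart
  rw [hbud, ← h2]
  -- The two segments agree up to `j`, and the simulated algorithm is online.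
  exact (A _ _ _).online _ _ _ j (restrictTo_congr (fun _ _ => rfl)
    fun l hl => runTo_mem_seg_iff hl _ hle)

theorem admissible_roundRun (hA : A.Solves N α c) (σ : Fin m → Seed K) (ω : A.Rand)
    (I : JobSeq m n r) : Admissible I (roundRun K p f B M N σ ω I) := by
  intro j i k h
  obtain ⟨s, -, hs⟩ := roundRun_eq_some hA le_rfl h
  have h1 := hA.admissible _ _ _ _ _ j 0 k hs
  have h2 := mem_of_admissible (hA.admissible _ _ _ _ _) hs
  simpa [restrictTo, h2] using h1

theorem load_roundRun_le (hf : PBounded p f) (hB : 0 ≤ B) (hfB : f 0 ≤ B) (hc : 1 ≤ c)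
    (hN : ∀ i, IsMonotoneNorm (N i)) (hA : A.Solves N α c) (σ : Fin m → Seed K) (ω : A.Rand)
    (I : JobSeq m n r) :
    f (loads N I (roundRun K p f B M N σ ω I)) ≤ (3 * p * c) ^ p * B := by
  classical
  have hp := hf.one_le
  have hload0 : loads N I (roundRun K p f B M N σ ω I) ∈ orthant m :=
    fun i => apply_nonneg (N i) _
  set J := Finset.univ.filter fun j => (roundRun K p f B M N σ ω I j).isSome = true with hJ
  rcases J.eq_empty_or_nonempty with h | h
  · have h1 : ∀ j, roundRun K p f B M N σ ω I j = none := by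
      intro j
      by_contra hn
      have : j ∈ J := Finset.mem_filter.2 ⟨Finset.mem_univ j, Option.isSome_iff_ne_none.2 hn⟩
      simp [h] at this
    have h2 : loads N I (roundRun K p f B M N σ ω I) = 0 := by
      funext i
      simp only [loads, h1, reduceCtorEq, if_false, Pi.zero_apply]
      exact map_zero (N i)
    rw [h2]
    refine hfB.trans (le_mul_of_one_le_left hB (Real.one_le_rpow ?_ (by linarith)))
    nlinarith
  -- The last scheduled job passed the test. All scheduled jobs belong to the simulated runs on the
  -- segments of that moment, so its budgets control all loads.
  · obtain ⟨j₀, hj₀, hmax⟩ := J.exists_max_image id h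
    set st := stateAfter K p f B M A N I j₀ with hst
    have hinv : Invariant K p f B M (packOracle A N I) st :=
      invariant_runTo hf hB hfB (packOracle_valid hA I) _
    have hok : f (seedLoad st.bud σ) ≤ (3 * p) ^ p * B := by
      by_contra! hbad
      have := (Finset.mem_filter.1 hj₀).2
      rw [roundRun, if_pos hbad] at this
      simp at this
    have hy := seedLoad_mem hinv.bud_nonneg σ
    have hle : loads N I (roundRun K p f B M N σ ω I) ≤ c • seedLoad st.bud σ := by
      intro i
      have hrun : ∀ j k, roundRun K p f B M N σ ω I j = some (i, k) → ∃ s, σ i = some s ∧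
          (A i (st.bud (i, s)) (classTarget M K s.1)).run
            (ω (i, (st.bud (i, s), classTarget M K s.1)))
            (restrictTo I i (st.seg (i, s))) j = some (0, k) := fun j k h =>
        roundRun_eq_some hA (hmax j (Finset.mem_filter.2 ⟨Finset.mem_univ j, by simp [h]⟩)) h
      rcases hs : σ i with _ | s
      · have h2 : loads N I (roundRun K p f B M N σ ω I) i = N i 0 := by
          rw [loads]
          congr 1
          funext jk
          rw [if_neg, Pi.zero_apply]
          intro h
          obtain ⟨s, hs', -⟩ := hrun _ _ h
          simp [hs] at hs'
        rw [h2, map_zero]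
        exact mul_nonneg (by linarith) (hy i)
      · have h1 := hA.load_le i (st.bud (i, s)) (classTarget M K s.1)
          (restrictTo I i (st.seg (i, s))) (ω (i, (st.bud (i, s), classTarget M K s.1)))
          (hinv.bud_nonneg _)
        have h2 : (c • seedLoad st.bud σ) i = c * st.bud (i, s) := by simp [seedLoad, hs]
        rw [h2]
        refine le_trans ((hN i).monotone _ _ (fun jk => ?_) fun jk => ?_) h1
        · simp only [Pi.zero_apply]; split_ifs
          · exact ENNReal.toReal_nonneg
          · exact le_rfl
        · by_cases h : roundRun K p f B M N σ ω I jk.1 = some (i, jk.2)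
          · obtain ⟨s', hs', h3⟩ := hrun _ _ h
            obtain rfl : s = s' := by simpa [hs] using hs'
            have h4 := mem_of_admissible (hA.admissible _ _ _ _ _) h3
            simp only [if_pos h, if_pos h3, restrictTo, if_pos h4, le_refl]
          · simp only [if_neg h]; split_ifs
            · exact ENNReal.toReal_nonneg
            · exact le_rfl
    calc f (loads N I (roundRun K p f B M N σ ω I)) ≤ f (c • seedLoad st.bud σ) :=
          hf.monotone hload0 (smul_mem_orthant (by linarith) hy) hle
      _ ≤ c ^ p * f (seedLoad st.bud σ) := hf.smul_le hy hc
      _ ≤ c ^ p * ((3 * p) ^ p * B) :=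
          mul_le_mul_of_nonneg_left hok (Real.rpow_nonneg (by linarith) _)
      _ = (3 * p * c) ^ p * B := by
          rw [Real.mul_rpow (by linarith : (0 : ℝ) ≤ 3 * p) (by linarith)]; ring

end Rounding

/-! ### The probability that a job is accepted. -/

section Rounding

open MeasureTheory

variable {m n r : ℕ} {K : ℕ} {p : ℝ} {f : (Fin m → ℝ) → ℝ} {B : ℝ} {M : ℕ}
  {A : AlgFamily m n r} {N : Fin m → Seminorm ℝ (Fin n × Fin r → ℝ)} {α c : ℝ}

/-- The probability that machine `i` with seed `t` would schedule job `j`. -/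
def wayProb (A : AlgFamily m n r) (M : ℕ) (st : State m n (K + 3) (K + 1)) (I : JobSeq m n r)
    (j : Fin n) (i : Fin m) (t : Seed K) : ℝ :=
  t.elim 0 fun s => (A i (st.bud (i, s)) (classTarget M K s.1)).acceptProb
    (restrictTo I i (st.seg (i, s))) j

theorem wayProb_nonneg (st : State m n (K + 3) (K + 1)) (I : JobSeq m n r)
    (j : Fin n) (i : Fin m) (t : Seed K) : 0 ≤ wayProb A M st I j i t := by
  rcases t with _ | s
  · exact le_rfl
  · exact measureReal_nonneg

theorem sum_wayProb (st : State m n (K + 3) (K + 1)) (I : JobSeq m n r) (j : Fin n) :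
    ∑ i, ∑ t, seedProb K t * wayProb A M st I j i t =
      st.mass (packScheme K p f B M) (packOracle A N I) j := by
  rw [State.mass, Fintype.sum_prod_type]
  refine Finset.sum_congr rfl fun i _ => ?_
  rw [Fintype.sum_option]
  simp [wayProb, seedProb, packScheme, packOracle]

/-- The event that machine `i` would schedule job `j`. -/
def wayEvent (A : AlgFamily m n r) (M : ℕ) (st : State m n (K + 3) (K + 1)) (σ : Fin m → Seed K)
    (I : JobSeq m n r) (j : Fin n) (i : Fin m) : Set A.Rand :=
  {ω | (offerWay K M st σ ω I j i).isSome = true}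

theorem measurableSet_wayEvent (st : State m n (K + 3) (K + 1)) (σ : Fin m → Seed K)
    (I : JobSeq m n r) (j : Fin n) (i : Fin m) : MeasurableSet (wayEvent A M st σ I j i) :=
  measurableSet_offerWay K M st σ I j i {o | o.isSome = true}

theorem wayEvent_eq (st : State m n (K + 3) (K + 1)) {σ : Fin m → Seed K}
    (I : JobSeq m n r) (j : Fin n) {i : Fin m} {s : Fin (K + 3) × Fin (K + 1)}
    (hs : σ i = some s) : wayEvent A M st σ I j i =
      {ω | ω (i, (st.bud (i, s), classTarget M K s.1)) ∈
        {z | ((A i (st.bud (i, s)) (classTarget M K s.1)).run z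
          (restrictTo I i (st.seg (i, s))) j).isSome = true}} := by
  ext ω
  simp [wayEvent, offerWay, hs]

theorem wayEvent_of_none (st : State m n (K + 3) (K + 1)) {σ : Fin m → Seed K}
    (I : JobSeq m n r) (j : Fin n) {i : Fin m} (hs : σ i = none) :
    wayEvent A M st σ I j i = ∅ := by
  ext ω
  simp [wayEvent, offerWay, hs]

/-- The joint distribution of the Norm-Packing algorithms. -/
def AlgFamily.law (A : AlgFamily m n r) : Measure A.Rand :=
  Measure.infinitePi fun x : Fin m × ℝ × ℕ => (A x.1 x.2.1 x.2.2).μ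

instance (A : AlgFamily m n r) : IsProbabilityMeasure A.law :=
  inferInstanceAs (IsProbabilityMeasure (Measure.infinitePi _))

theorem law_wayEvent (st : State m n (K + 3) (K + 1)) (σ : Fin m → Seed K)
    (I : JobSeq m n r) (j : Fin n) (i : Fin m) :
    A.law.real (wayEvent A M st σ I j i) = wayProb A M st I j i (σ i) := by
  rcases hs : σ i with _ | s
  · rw [wayEvent_of_none st I j hs]; simp [wayProb]
  · rw [wayEvent_eq st I j hs, AlgFamily.law]
    exact infinitePi_real_eval (fun x : Fin m × ℝ × ℕ => (A x.1 x.2.1 x.2.2).μ)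
      (x := (i, (st.bud (i, s), classTarget M K s.1)))
      ((A i (st.bud (i, s)) (classTarget M K s.1)).measurableSet_accept _ j)

/-- Different machines read different coordinates of the product measure, whatever budgets and
targets they use. -/
theorem law_wayEvent_inter (st : State m n (K + 3) (K + 1)) (σ : Fin m → Seed K)
    (I : JobSeq m n r) (j : Fin n) {i l : Fin m} (hil : i ≠ l) :
    A.law.real (wayEvent A M st σ I j i ∩ wayEvent A M st σ I j l) =
      wayProb A M st I j i (σ i) * wayProb A M st I j l (σ l) := by
  rcases hs : σ i with _ | s
  · rw [wayEvent_of_none st I j hs]; simp [wayProb]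
  rcases hs' : σ l with _ | s'
  · rw [wayEvent_of_none st I j hs']; simp [wayProb]
  rw [wayEvent_eq st I j hs, wayEvent_eq st I j hs', AlgFamily.law]
  refine infinitePi_real_inter (fun x : Fin m × ℝ × ℕ => (A x.1 x.2.1 x.2.2).μ)
    (x := (i, (st.bud (i, s), classTarget M K s.1)))
    (y := (l, (st.bud (l, s'), classTarget M K s'.1))) (fun h => hil (congrArg Prod.fst h))
    ((A i (st.bud (i, s)) (classTarget M K s.1)).measurableSet_accept _ j)
    ((A l (st.bud (l, s')) (classTarget M K s'.1)).measurableSet_accept _ j)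

theorem roundRun_isSome (σ : Fin m → Seed K) (I : JobSeq m n r) (j : Fin n)
    (hok : ¬ (3 * p) ^ p * B < f (seedLoad (stateAfter K p f B M A N I j).bud σ)) :
    {ω : A.Rand | (roundRun K p f B M N σ ω I j).isSome = true} =
      ⋃ i, wayEvent A M (stateAfter K p f B M A N I j) σ I j i := by
  ext ω
  simp only [roundRun, if_neg hok, Set.mem_ofPred_eq, Set.mem_iUnion, wayEvent]
  constructor
  · intro h
    obtain ⟨⟨i, k⟩, hik⟩ := Option.isSome_iff_exists.1 h
    exact ⟨i, by rw [selectMachine_eq_some hik]; rfl⟩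
  · rintro ⟨i, hi⟩
    exact isSome_selectMachine hi

open Classical in
/-- A job is scheduled with probability at least a twelfth of its mass. -/
theorem mass_le_acceptProb (hf : PBounded p f) (hB : 0 ≤ B) (hfB : f 0 ≤ B)
    (hA : A.Solves N α c) (I : JobSeq m n r) (j : Fin n) :
    (stateAfter K p f B M A N I j).mass (packScheme K p f B M) (packOracle A N I) j / 12 ≤
      (packAlg K p f B M A N).acceptProb I j := by
  have hp := hf.one_le
  have hO := packOracle_valid hA I
  set st := stateAfter K p f B M A N I j with hst
  have hinv : Invariant K p f B M (packOracle A N I) st := invariant_runTo hf hB hfB hO _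
  have hq : ∀ t, 0 ≤ seedProb K t := fun t => (seedProb_pos K t).le
  set bad : (Fin m → Seed K) → Prop := fun σ => (3 * p) ^ p * B < f (seedLoad st.bud σ) with hbad
  have hslice : ∀ σ, MeasurableSet {ω : A.Rand | (roundRun K p f B M N σ ω I j).isSome = true} := by
    intro σ
    by_cases h : bad σ
    · have h' : (3 * p) ^ p * B < f (seedLoad (stateAfter K p f B M A N I j).bud σ) := h
      simp only [roundRun, if_pos h']
      exact MeasurableSet.const _
    · rw [roundRun_isSome σ I j h]
      exact MeasurableSet.iUnion fun i => measurableSet_wayEvent _ σ I j i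
  have hacc : (packAlg K p f B M A N).acceptProb I j = prodExp (seedProb K) fun σ =>
      A.law.real {ω | (roundRun K p f B M N σ ω I j).isSome = true} :=
    weightMeasure_prod_real (P := fun σ : Fin m → Seed K => ∏ i, seedProb K (σ i))
      (fun σ => Finset.prod_nonneg fun i _ => hq _) A.law
      (s := {x | (roundRun K p f B M N x.1 x.2 I j).isSome = true}) hslice
  rw [hacc, ← sum_wayProb]
  refine (prodExp_collision hq (sum_seedProb K) (wayProb_nonneg st I j) bad ?_ ?_).trans
    (prodExp_mono hq fun σ => ?_)
  · intro i t
    simp only [hbad, seedLoad_update]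
    -- Whatever the resampled seed, machine `i` on its own contributes a budget with value at most
    -- `B`.
    have hu : 0 ≤ (t.elim 0 fun s => st.bud (i, s)) ∧
        f (Pi.single i (t.elim 0 fun s => st.bud (i, s))) ≤ B := by
      rcases t with _ | s
      · simpa using hfB
      · exact ⟨hinv.bud_nonneg _, hinv.single_le (i, s)⟩
    refine prodExp_markov (seedProb_pos K)
      (g := fun σ => f (Function.update (seedLoad st.bud σ) i (t.elim 0 fun s => st.bud (i, s))))
      (fun σ => hf.nonneg _ (update_mem_orthant (seedLoad_mem hinv.bud_nonneg σ) i hu.1))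
      (mul_nonneg (Real.rpow_nonneg (by linarith) _) hB) (by norm_num) ?_
    refine (expLoad_update_bound hf hq (sum_seedProb K) hinv.bud_nonneg (θ := 3 / 2 * p)
      (by linarith) hinv.expLoad_le hu.1 hu.2).trans ?_
    rw [← mul_assoc]
    exact mul_le_mul_of_nonneg_right (rpow_markov_facts hp) hB
  · rw [sum_wayProb (p := p) (f := f) (B := B) (N := N)]
    refine (mass_runTo_le (P := packScheme K p f B M) hO (fun s => (atomProb_pos K s).le)
      (η := 1 / 144) (atomProb_le K) (by norm_num) ?_ _ j).trans ?_
    all_goals norm_num [packScheme]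
  · split_ifs with h
    · exact measureReal_nonneg
    · rw [roundRun_isSome σ I j h]
      refine le_trans (le_of_eq ?_) (bonferroni A.law fun i => measurableSet_wayEvent _ σ I j i)
      congr 1
      · exact Finset.sum_congr rfl fun i _ => (law_wayEvent _ σ I j i).symm
      · refine Finset.sum_congr rfl fun i _ => Finset.sum_congr ?_ fun l hl =>
          (law_wayEvent_inter _ σ I j (Finset.ne_of_mem_erase hl).symm).symm
        congr!

end Rounding
/-! ### The main theorem -/

section Main

open MeasureTheory

variable {m n r : ℕ} {p B α c : ℝ} {f : (Fin m → ℝ) → ℝ}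
  {N : Fin m → Seminorm ℝ (Fin n × Fin r → ℝ)}

/-- An allocation `y` all of whose jobs on machine `i` are scheduled in the same way by `x` has
the smaller load on machine `i`. -/
theorem loads_le_loads (hN : ∀ i, IsMonotoneNorm (N i)) (I : JobSeq m n r)
    {x y : PartialAlloc m n r} {i : Fin m} (h : ∀ j k, y j = some (i, k) → x j = some (i, k)) :
    loads N I y i ≤ loads N I x i := by
  refine (hN i).monotone _ _ (fun jk => ?_) fun jk => ?_
  · simp only [Pi.zero_apply]; split_ifs
    · exact ENNReal.toReal_nonneg
    · exact le_rfl
  · by_cases hy : y jk.1 = some (i, jk.2)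
    · simp only [if_pos hy, if_pos (h _ _ hy), le_refl]
    · simp only [if_neg hy]; split_ifs
      · exact ENNReal.toReal_nonneg
      · exact le_rfl

theorem loads_mem_orthant (I : JobSeq m n r) (x : PartialAlloc m n r) :
    loads N I x ∈ orthant m := fun i => apply_nonneg (N i) _

theorem disjoint_jobsOn (x : PartialAlloc m n r) {i l : Fin m} (h : i ≠ l) :
    Disjoint (jobsOn x i) (jobsOn x l) := by
  rw [Finset.disjoint_left]
  intro j hi hl
  have h1 := (Finset.mem_filter.1 hi).2
  have h2 := (Finset.mem_filter.1 hl).2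
  exact h (Option.some.inj (h1.symm.trans h2))

theorem sum_card_jobsOn (x : PartialAlloc m n r) : ∑ i, (jobsOn x i).card = numScheduled x := by
  classical
  rw [numScheduled, ← Finset.card_biUnion]
  · congr 1
    ext j
    simp only [jobsOn, Finset.mem_biUnion, Finset.mem_univ, true_and, Finset.mem_filter]
    rcases hx : x j with _ | d <;> simp
  · exact fun i _ l _ h => disjoint_jobsOn x h

/-- `packAlg` schedules enough jobs if the optimum uses only machines with finite capacity. -/
theorem value_packAlg {K M : ℕ} {A : AlgFamily m n r} (hf : PBounded p f) (hm : m ≤ 2 ^ K)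
    (hα : 0 ≤ α) (hα1 : α ≤ 1) (hB : 0 ≤ B) (hfB : f 0 ≤ B) (hN : ∀ i, IsMonotoneNorm (N i))
    (hA : A.Solves N α c) (I : JobSeq m n r) {x : PartialAlloc m n r} (hx : Admissible I x)
    (hxB : f (loads N I x) ≤ B)
    (hfree : ∀ j i k, x j = some (i, k) → ¬ ∀ u, 0 ≤ u → f (Pi.single i u) ≤ B)
    (hM : M ≤ numScheduled x) :
    α * M ≤ 18432 * ((K + 1) * (K + 3)) * (packAlg K p f B M A N).expectedValue I := by
  classical
  -- The allocation is trimmed to exactly `M` jobs, as the size classes are relative to `M`.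
  obtain ⟨J, hJ, hJM⟩ := Finset.exists_subset_card_eq hM
  let y : PartialAlloc m n r := fun j => if j ∈ J then x j else none
  have hyx : ∀ j d, y j = some d → x j = some d := by
    intro j d h
    by_cases hj : j ∈ J
    · simpa [y, hj] using h
    · simp [y, hj] at h
  have hyM : numScheduled y = M := by
    rw [← hJM, numScheduled]
    congr 1
    ext j
    simp only [Finset.mem_filter, Finset.mem_univ, true_and]
    by_cases hj : j ∈ J
    · simpa [y, hj] using (Finset.mem_filter.1 (hJ hj)).2
    · simp [y, hj]
  have hy : Admissible I y := fun j i k h => hx j i k (hyx j _ h)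
  have hyB : f (loads N I y) ≤ B := (hf.monotone (loads_mem_orthant I y)
    (loads_mem_orthant I x) fun i => loads_le_loads hN I fun j k => hyx j _).trans hxB
  have hO := packOracle_valid hA I
  have hfrac := fractional_value (M := M) hf hm hα hα1 hB hfB hO rfl (loads N I y)
    (loads_mem_orthant I y) hyB (jobsOn y) (by rw [sum_card_jobsOn, hyM])
    (fun i l h => disjoint_jobsOn y h) ?_
    (fun i u S J' h1 h2 hu => card_le_normOpt (hN i) hy hu h1 h2)
  · refine hfrac.trans ?_
    rw [OnlineAlg.expectedValue_eq]
    have h1 : ∀ j, (runTo (packScheme K p f B M) (packOracle A N I)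
        (n * stepsPerJob m (K + 3) (K + 1))).mass (packScheme K p f B M) (packOracle A N I) j ≤
        12 * (packAlg K p f B M A N).acceptProb I j := by
      intro j
      have h2 := mass_le_acceptProb (K := K) (M := M) hf hB hfB hA I j
      have h3 : stepsPerJob m (K + 3) (K + 1) * ((j : ℕ) + 1) ≤
          n * stepsPerJob m (K + 3) (K + 1) := by
        rw [mul_comm]
        exact Nat.mul_le_mul_right _ j.2
      -- The mass of `j` is frozen after its own steps, so the final mass is the one seen when `j`
      -- is decided.
      rw [mass_runTo_eq hO (fun s => (atomProb_pos K s).le) j h3]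
      rw [stateAfter] at h2
      linarith
    have h2 := Finset.sum_le_sum fun j (_ : j ∈ Finset.univ) => h1 j
    rw [← Finset.mul_sum] at h2
    have h3 := mul_le_mul_of_nonneg_left h2
      (show (0 : ℝ) ≤ 1536 * ((K + 1) * (K + 3)) by positivity)
    linarith
  · rintro i ⟨j, hj⟩
    have h1 := (Finset.mem_filter.1 hj).2
    rcases hyj : y j with _ | ⟨i', k⟩
    · simp [hyj] at h1
    · obtain rfl : i' = i := by simpa [hyj] using h1
      exact hfree j _ k (hyx j _ hyj)

open Classical in
/-- The assignments of a job to the machines in `Z`. -/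
def freeWay (Z : Set (Fin m)) (b : Job m r) : Option (Fin m × Fin r) :=
  if h : ∃ d : Fin m × Fin r, d.1 ∈ Z ∧ b d.1 d.2 ≠ ⊤ then some h.choose else none

theorem freeWay_eq_some {Z : Set (Fin m)} {b : Job m r} {d : Fin m × Fin r}
    (h : freeWay Z b = some d) : d.1 ∈ Z ∧ b d.1 d.2 ≠ ⊤ := by
  rw [freeWay] at h
  split_ifs at h with h'
  rw [← Option.some.inj h]
  exact h'.choose_spec

theorem isSome_freeWay {Z : Set (Fin m)} {b : Job m r} {i : Fin m} {k : Fin r} (hi : i ∈ Z)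
    (hk : b i k ≠ ⊤) : (freeWay Z b).isSome = true := by
  rw [freeWay, dif_pos ⟨(i, k), hi, hk⟩]
  rfl

/-- The algorithm that puts jobs on the machines in `Z` whenever this is possible. -/
def OnlineAlg.withFree (A : OnlineAlg m n r) (Z : Set (Fin m)) : OnlineAlg m n r where
  Ω := A.Ω
  mΩ := A.mΩ
  μ := A.μ
  prob := A.prob
  run := fun ω I j => (freeWay Z (I j)).or (A.run ω I j)
  online := fun ω I I' j h => by rw [A.online ω I I' j h, h j le_rfl]
  meas := fun I j d => by
    change MeasurableSet {ω | (freeWay Z (I j)).or (A.run ω I j) = d}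
    rcases freeWay Z (I j) with _ | d'
    · simp only [Option.none_or]
      exact A.meas I j d
    · simp only [Option.some_or]
      exact MeasurableSet.const _

theorem withFree_expectedValue_ge (A : OnlineAlg m n r) (Z : Set (Fin m)) (I : JobSeq m n r) :
    A.expectedValue I ≤ (A.withFree Z).expectedValue I ∧
      ((Finset.univ.filter fun j => (freeWay Z (I j)).isSome = true).card : ℝ) ≤
        (A.withFree Z).expectedValue I := by
  classical
  rw [OnlineAlg.expectedValue_eq, OnlineAlg.expectedValue_eq]
  constructor
  · refine Finset.sum_le_sum fun j _ => ?_
    refine measureReal_mono (fun ω h => ?_)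
    simp only [Set.mem_ofPred_eq, OnlineAlg.withFree, Option.isSome_or, Bool.or_eq_true] at h ⊢
    exact Or.inr h
  · rw [Finset.card_filter]
    push_cast
    refine Finset.sum_le_sum fun j _ => ?_
    split_ifs with h
    · have h1 : {ω | ((A.withFree Z).run ω I j).isSome = true} = Set.univ := by
        ext ω
        simp [OnlineAlg.withFree, h]
      rw [OnlineAlg.acceptProb, h1, probReal_univ]
    · exact measureReal_nonneg

/-- With `K = Nat.clog 2 m`, `2^(K-1) < m` and `m ≥ 2` bound both `K - 1` and `1` by `log m / log
2`, so the factors are at most `3 / log 2` and `5 / log 2` times `log m`. -/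
theorem log_bound {m : ℕ} (hm : 2 ≤ m) :
    (((Nat.clog 2 m : ℝ) + 1) * (Nat.clog 2 m + 3)) ≤ 60 * Real.log m ^ 2 := by
  have h2 : (0.6931471803 : ℝ) < Real.log 2 := Real.log_two_gt_d9
  have hK : 2 ^ (Nat.clog 2 m - 1) < m := by
    have := Nat.pow_pred_clog_lt_self (b := 2) one_lt_two hm
    simpa using this
  have hpos : 1 ≤ Nat.clog 2 m := Nat.clog_pos one_lt_two hm
  have h3 : ((Nat.clog 2 m : ℝ) - 1) * Real.log 2 ≤ Real.log m := by
    have h4 : Real.log ((2 : ℝ) ^ (Nat.clog 2 m - 1)) ≤ Real.log m :=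
      Real.log_le_log (by positivity) (by exact_mod_cast hK.le)
    rw [Real.log_pow, Nat.cast_sub hpos] at h4
    exact_mod_cast h4
  have h5 : Real.log 2 ≤ Real.log m := Real.log_le_log (by norm_num) (by exact_mod_cast hm)
  have h6 : (1 : ℝ) ≤ Nat.clog 2 m := by exact_mod_cast hpos
  set K : ℝ := (Nat.clog 2 m : ℝ)
  set l := Real.log m
  have h7 : K + 1 ≤ 5 * l := by nlinarith
  have h8 : K + 3 ≤ 8 * l := by nlinarith
  nlinarith

end Main

open Classical in
theorem schedPackSolvable_of_normPackSolvable {m n r : ℕ} (hm : 2 ≤ m) {p α c : ℝ}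
    {f : (Fin m → ℝ) → ℝ} {N : Fin m → Seminorm ℝ (Fin n × Fin r → ℝ)} (hf : PBounded p f)
    (hN : ∀ i, IsMonotoneNorm (N i)) (h : ∀ i, NormPackSolvable (N i) α c) :
    SchedPackSolvable f N (1 / 2211840 * α / Real.log m ^ 2) ((3 * p * c) ^ p) := by
  obtain ⟨hα, hα1, hc, -⟩ := h ⟨0, by omega⟩
  have hp := hf.one_le
  have hlog : Real.log 2 ≤ Real.log m := Real.log_le_log (by norm_num) (by exact_mod_cast hm)
  have hlog2 : (0.6931471803 : ℝ) < Real.log 2 := Real.log_two_gt_d9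
  have hsq : 0.48 ≤ Real.log m ^ 2 := by nlinarith
  have hsq0 : 0 < Real.log m ^ 2 := by linarith
  refine ⟨by positivity, ?_, Real.one_le_rpow (by nlinarith) (by linarith), ?_⟩
  · rw [div_le_one hsq0]; linarith
  intro B hB hfB M
  obtain ⟨A, hA⟩ := exists_algFamily h
  let Z : Set (Fin m) := {i | ∀ u, 0 ≤ u → f (Pi.single i u) ≤ B}
  -- The target is halved since at least half of the optimum lies either in jobs with a free way or
  -- on the other machines.
  let A₀ := packAlg (Nat.clog 2 m) p f B ⌈M / 2⌉₊ A N
  refine ⟨A₀.withFree Z, fun I => ⟨fun ω => ⟨?_, ?_⟩, ?_⟩⟩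
  · intro j i k hjk
    change (freeWay Z (I j)).or (A₀.run ω I j) = some (i, k) at hjk
    rcases Option.or_eq_some_iff.1 hjk with h1 | ⟨-, h1⟩
    · exact (freeWay_eq_some h1).2
    · exact admissible_roundRun hA ω.1 ω.2 I j i k h1
  · refine le_trans ?_ (load_roundRun_le (K := Nat.clog 2 m) (M := ⌈M / 2⌉₊) hf hB hfB hc hN hA
      ω.1 ω.2 I)
    -- Diverting jobs to free machines only lowers the other loads, and free coordinates do not
    -- affect `f`.
    refine hf.le_of_le_off (B := B) (loads_mem_orthant I _) (loads_mem_orthant I _) fun i => ?_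
    by_cases hi : i ∈ Z
    · exact Or.inr hi
    · left
      refine loads_le_loads hN I fun j k hjk => ?_
      change (freeWay Z (I j)).or (A₀.run ω I j) = some (i, k) at hjk
      rcases Option.or_eq_some_iff.1 hjk with h1 | ⟨-, h1⟩
      · exact absurd (freeWay_eq_some h1).1 hi
      · exact h1
  · intro hM
    obtain ⟨hval, hfree⟩ := withFree_expectedValue_ge A₀ Z I
    set E := (A₀.withFree Z).expectedValue I
    have hE0 : 0 ≤ E := le_trans (Nat.cast_nonneg _) hfree
    rw [div_mul_eq_mul_div, div_le_iff₀ hsq0]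
    -- `M` is an arbitrary real; the claim is trivial unless it is positive.
    rcases le_or_gt M 0 with hM0 | hM0
    · have h1 : α * M ≤ 0 := mul_nonpos_of_nonneg_of_nonpos hα hM0
      have h2 : 0 ≤ E * Real.log m ^ 2 := by positivity
      linarith
    obtain ⟨x, hx, hxopt⟩ : ∃ x : PartialAlloc m n r,
        (Admissible I x ∧ f (loads N I x) ≤ B) ∧ opt f N B I = numScheduled x := by
      have hne : (Finset.univ.filter fun x : PartialAlloc m n r =>
          Admissible I x ∧ f (loads N I x) ≤ B).Nonempty := by
        refine ⟨fun _ => none, Finset.mem_filter.2 ⟨Finset.mem_univ _, ?_, ?_⟩⟩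
        · intro j i k hjk
          simp at hjk
        · have : loads N I (fun _ => none) = 0 := by
            funext i
            simp only [loads, reduceCtorEq, if_false, Pi.zero_apply]
            exact map_zero (N i)
          rwa [this]
      obtain ⟨x, hx, hxe⟩ := Finset.exists_mem_eq_sup _ hne numScheduled
      exact ⟨x, (Finset.mem_filter.1 hx).2, hxe⟩
    rw [hxopt] at hM
    let y : PartialAlloc m n r := fun j => (x j).filter fun d => decide (d.1 ∉ Z)
    have hyx : ∀ j d, y j = some d → x j = some d ∧ d.1 ∉ Z := fun j d hd => by
      simpa [y, Option.filter_eq_some_iff] using hd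
    have hsplit : numScheduled x ≤ numScheduled y +
        (Finset.univ.filter fun j => (freeWay Z (I j)).isSome = true).card := by
      rw [numScheduled, numScheduled]
      refine le_trans (Finset.card_le_card fun j hj => ?_) (Finset.card_union_le _ _)
      obtain ⟨⟨i, k⟩, hik⟩ := Option.isSome_iff_exists.1 (Finset.mem_filter.1 hj).2
      by_cases hi : i ∈ Z
      · exact Finset.mem_union_right _ (Finset.mem_filter.2 ⟨Finset.mem_univ j,
          isSome_freeWay hi (hx.1 j i k hik)⟩)
      · refine Finset.mem_union_left _ (Finset.mem_filter.2 ⟨Finset.mem_univ j, ?_⟩)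
        simp [y, hik, hi]
    have hsplit' : (numScheduled x : ℝ) ≤ numScheduled y +
        (Finset.univ.filter fun j => (freeWay Z (I j)).isSome = true).card := by
      exact_mod_cast hsplit
    have hαM : α * M ≤ M := mul_le_of_le_one_left hM0.le hα1
    by_cases hcase : M / 2 ≤ (Finset.univ.filter fun j => (freeWay Z (I j)).isSome = true).card
    · have h1 : M / 2 ≤ E := hcase.trans hfree
      nlinarith
    · push Not at hcase
      have hyM : ⌈M / 2⌉₊ ≤ numScheduled y := Nat.ceil_le.2 (by linarith)
      have hyadm : Admissible I y := fun j i k hd => hx.1 j i k (hyx j _ hd).1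
      have hyB : f (loads N I y) ≤ B := (hf.monotone (loads_mem_orthant I y)
        (loads_mem_orthant I x)
        fun i => loads_le_loads hN I fun j k hd => (hyx j _ hd).1).trans hx.2
      have hv := value_packAlg hf (Nat.le_pow_clog one_lt_two m) hα hα1 hB hfB hN hA I hyadm hyB
        (fun j i k hd => (hyx j _ hd).2) hyM
      have h1 : α * (M / 2) ≤ α * (⌈M / 2⌉₊ : ℝ) :=
        mul_le_mul_of_nonneg_left (Nat.le_ceil _) hα
      have h2 := mul_le_mul_of_nonneg_right (log_bound hm) hE0
      have h3 : 18432 * (((Nat.clog 2 m : ℝ) + 1) * (Nat.clog 2 m + 3)) *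
          A₀.expectedValue I ≤ 18432 * (((Nat.clog 2 m : ℝ) + 1) * (Nat.clog 2 m + 3)) * E :=
        mul_le_mul_of_nonneg_left hval (by positivity)
      linarith

end OnlineSched
end

theorem mainTheorem8 :
    ∃ C : ℝ, 0 < C ∧
      ∀ (m n r : ℕ), 2 ≤ m →
      ∀ (p α c : ℝ) (f : (Fin m → ℝ) → ℝ) (N : Fin m → Seminorm ℝ (Fin n × Fin r → ℝ)),
        OnlineSched.PBounded p f →
        (∀ i, OnlineSched.IsMonotoneNorm (N i)) →
        (∀ i, OnlineSched.NormPackSolvable (N i) α c) →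
        OnlineSched.SchedPackSolvable f N (C * α / Real.log m ^ 2) ((3 * p * c) ^ p) :=
  -- The denominator is `2 * 60 * 18432`: the halved target, `log_bound`, and `18432 = 12 * 1536`
  -- from rounding and fractional value.
  ⟨1 / 2211840, by norm_num, fun _ _ _ hm _ _ _ _ _ hf hN h =>
    OnlineSched.schedPackSolvable_of_normPackSolvable hm hf hN h⟩
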